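/- **The logic $FO\lambda^{\Delta\mathbb N}$.** Terms are simply typed $\lambda$-terms, identified up to $\alpha\beta\eta$-conversion, over base types $i$ (PCF terms and PCF types), $nt$ (natural numbers), $atm$ and $prp$ (atoms and goal formulas of the object logic) and $lst$ (lists of atoms). The constants are $z:nt$, $s:nt\to nt$; $nil:lst$, $(::):atm\to lst\to lst$; $\langle\cdot\rangle:atm\to prp$, $tt:prp$, $\&:prp\to prp\to prp$, $\Rightarrow\,:atm\to prp\to prp$, $\bigwedge:(i\to prp)\to prp$; the PCF types $num,bool:i$, $arr:i\to i\to i$; the PCF terms $zero,true,false:i$, $succ,pred,is\_zero:i\to i$, $if:i\to i\to i\to i$, $abs,rec:i\to(i\to i)\to i$, $app:i\to i\to i$; and $typeof,\Downarrow,\leadsto,\leadsto^*:i\to i\to atm$, $value:i\to atm$. We write $\bigwedge n\,B$ for $\bigwedge(\lambda n.B)$. Formulas are built from atomic formulas by $\bot,\top,\wedge,\vee,\supset,\forall_\tau,\exists_\tau$, with $\tau$ any simple type over these base types. Sequents $\Gamma\longrightarrow C$ (with $\Gamma$ a finite multiset of formulas) are derived by the usual left and right rules of intuitionistic first-order sequent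 calculus, initial sequents $A,\Gamma\longrightarrow A$ for atomic $A$, contraction and cut, together with the following rules. * Natural numbers: $\Gamma\longrightarrow nat\,z$; from $\Gamma\longrightarrow nat\,I$ infer $\Gamma\longrightarrow nat\,(s\,I)$; from $\longrightarrow B\,z$, $\;B\,j\longrightarrow B\,(s\,j)$ ($j$ a new variable) and $B\,I,\Gamma\longrightarrow C$ infer $nat\,I,\Gamma\longrightarrow C$. * Definitions, relative to a fixed set of clauses $\forall\bar x[H\triangleq B]$ with atomic head $H$ (bodies $\top$ omitted below). Right: from $\Gamma\longrightarrow B\theta$ infer $\Gamma\longrightarrow H\theta$. Left, for an atom $A$ other than $nat\,I$: infer $A,\Gamma\longrightarrow C$ from the premises $B\theta,\Gamma\theta\longrightarrow C\theta$, one for each clause (with $\bar x$ renamed apart) and each $\theta$ in a complete set of unifiers of $A$ and the head $H$ of that clause. **The definition.** It consists of the following clauses, in which the capital letters are universally quantified. *Numbers:* $I=I$; $\;sum\,z\,J\,J\triangleq nat\,J$; $\;sum\,(s\,I)\,J\,(s\,K)\triangleq sum\,I\,J\,K$; $\;z<s\,J\triangleq nat\,J$; $\;s\,I<s\,J\triangleq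 I<J$; $\;I\le I$; $\;I\le J\triangleq I<J$. *Lists:* $length\,nil\,z$; $\;length\,(X::L)\,(s\,I)\triangleq length\,L\,I$; $\;list\,L\triangleq\exists i(nat\,i\wedge length\,L\,i)$; $\;element\,X\,(X::L)$; $\;element\,X\,(Y::L)\triangleq element\,X\,L$; $\;split\,nil\,nil\,nil$; $\;split\,(X::L_1)\,(X::L_2)\,L_3\triangleq split\,L_1\,L_2\,L_3$; $\;split\,(X::L_1)\,L_2\,(X::L_3)\triangleq split\,L_1\,L_2\,L_3$; $\;permute\,nil\,nil$; $\;permute\,(X::L_1)\,L_2\triangleq\exists l(split\,L_2\,(X::nil)\,l\wedge permute\,L_1\,l)$. *Object logic (intuitionistic sequents of height at most $I$):* $seq\,I\,(A'::L)\,\langle A\rangle\triangleq element\,A\,(A'::L)$; $\;seq\,I\,L\,tt$; $\;seq\,(s\,I)\,L\,(B\,\&\,C)\triangleq seq\,I\,L\,B\wedge seq\,I\,L\,C$; $\;seq\,(s\,I)\,L\,(A\Rightarrow B)\triangleq seq\,I\,(A::L)\,B$; $\;seq\,(s\,I)\,L\,(\bigwedge B)\triangleq\forall x\,seq\,I\,L\,(B\,x)$;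 $\;seq\,(s\,I)\,L\,\langle A\rangle\triangleq\exists b(prog\,A\,b\wedge seq\,I\,L\,b)$. *PCF:* the clauses $prog\,A\,G\triangleq\top$ for the following pairs, written $A\Leftarrow G$, or $A$ alone if $G$ is $tt$ (the brackets $\langle\cdot\rangle$ in $G$ are omitted, and $M:T$ abbreviates $typeof\,M\,T$). Typing: $zero:num$; $\;true:bool$; $\;false:bool$; $\;succ\,M:num\Leftarrow M:num$; $\;pred\,M:num\Leftarrow M:num$; $\;is\_zero\,M:bool\Leftarrow M:num$; $\;if\,M\,N_1\,N_2:T\Leftarrow M:bool\;\&\;N_1:T\;\&\;N_2:T$; $\;abs\,T\,R:arr\,T\,U\Leftarrow\bigwedge n(n:T\Rightarrow R\,n:U)$; $\;app\,M\,N:T\Leftarrow M:arr\,U\,T\;\&\;N:U$; $\;rec\,T\,R:T\Leftarrow\bigwedge n(n:T\Rightarrow R\,n:T)$. Natural semantics: $zero\Downarrow zero$; $\;true\Downarrow true$; $\;false\Downarrow false$; $\;succ\,M\Downarrow succ\,V\Leftarrow M\Downarrow V$; $\;pred\,M\Downarrow zero\Leftarrow M\Downarrow zero$; $\;pred\,M\Downarrow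 V\Leftarrow M\Downarrow succ\,V$; $\;is\_zero\,M\Downarrow true\Leftarrow M\Downarrow zero$; $\;is\_zero\,M\Downarrow false\Leftarrow M\Downarrow succ\,V$; $\;if\,M\,N_1\,N_2\Downarrow V\Leftarrow M\Downarrow true\;\&\;N_1\Downarrow V$; $\;if\,M\,N_1\,N_2\Downarrow V\Leftarrow M\Downarrow false\;\&\;N_2\Downarrow V$; $\;abs\,T\,R\Downarrow abs\,T\,R$; $\;app\,M\,N\Downarrow V\Leftarrow M\Downarrow abs\,T\,R\;\&\;R\,N\Downarrow V$; $\;rec\,T\,R\Downarrow V\Leftarrow R\,(rec\,T\,R)\Downarrow V$. Transition semantics: $succ\,M\leadsto succ\,M'\Leftarrow M\leadsto M'$; $\;pred\,zero\leadsto zero$; $\;pred\,(succ\,V)\leadsto V\Leftarrow value\,V$; $\;pred\,M\leadsto pred\,M'\Leftarrow M\leadsto M'$; $\;is\_zero\,zero\leadsto true$; $\;is\_zero\,(succ\,V)\leadsto false\Leftarrow value\,V$; $\;is\_zero\,M\leadsto is\_zero\,M'\Leftarrow M\leadsto M'$; $\;if\,true\,M\,N\leadsto M$; $\;if\,false\,M\,N\leadsto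 N$; $\;if\,M\,N_1\,N_2\leadsto if\,M'\,N_1\,N_2\Leftarrow M\leadsto M'$; $\;app\,(abs\,T\,R)\,N\leadsto R\,N$; $\;app\,M\,N\leadsto app\,M'\,N\Leftarrow M\leadsto M'$; $\;rec\,T\,R\leadsto R\,(rec\,T\,R)$; $\;M\leadsto^*M$; $\;M\leadsto^*N\Leftarrow M\leadsto M'\;\&\;M'\leadsto^*N$. Values: $value\,zero$; $\;value\,true$; $\;value\,false$; $\;value\,(succ\,V)\Leftarrow value\,V$; $\;value\,(abs\,T\,R)$. *Equality at type $i$:* $X\equiv X$. For an atom $A$ of the object logic, let $\rhd A$ abbreviate the formula $\exists j(nat\,j\wedge seq\,j\,nil\,\langle A\rangle)$. **Theorem.** For each of the following nine formulas $F$ (all quantifiers over type $i$), the sequent $\longrightarrow F$ is derivable in $FO\lambda^{\Delta\mathbb N}$ from this definition. Determinacy of semantics: 1. $\forall m\forall m_1\forall m_2(\rhd(m\Downarrow m_1)\supset\rhd(m\Downarrow m_2)\supset m_1\equiv m_2)$ 2. $\forall m\forall m_1\forall m_2(\rhd(m\leadsto m_1)\supset\rhd(m\leadsto m_2)\supset m_1\equiv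 m_2)$ 3. $\forall m\forall v_1\forall v_2(\rhd(value\,v_1)\supset\rhd(m\leadsto^*v_1)\supset\rhd(value\,v_2)\supset\rhd(m\leadsto^*v_2)\supset v_1\equiv v_2)$ Equivalence of semantics: 4. $\forall m\forall v(\rhd(m\Downarrow v)\supset(\rhd(value\,v)\wedge\rhd(m\leadsto^*v)))$ 5. $\forall m\forall v((\rhd(value\,v)\wedge\rhd(m\leadsto^*v))\supset\rhd(m\Downarrow v))$ Subject reduction: 6. $\forall m\forall n(\rhd(m\Downarrow n)\supset\forall t(\rhd(typeof\,m\,t)\supset\rhd(typeof\,n\,t)))$ 7. $\forall m\forall n(\rhd(m\leadsto n)\supset\forall t(\rhd(typeof\,m\,t)\supset\rhd(typeof\,n\,t)))$ 8. $\forall m\forall n(\rhd(m\leadsto^*n)\supset\forall t(\rhd(typeof\,m\,t)\supset\rhd(typeof\,n\,t)))$ Unicity of typing: 9. $\forall m\forall t_1\forall t_2(\rhd(typeof\,m\,t_1)\supset\rhd(typeof\,m\,t_2)\supset t_1\equiv t_2)$ -/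

import Mathlib

namespace FOLDN

/-! ### Simply typed lambda-terms over the signature of the PCF encoding -/

/-- Types without the formula type: `i` (object-level terms and object-level types), `nt` (natural
numbers), `atm` and `prp` (object-logic atoms and goal formulas), `lst` (lists of object-logic
atoms), and function types. -/
inductive Ty : Type
  | i | nt | atm | prp | lst
  | arr (a b : Ty)

/-- A list of typed variables; the variable of index `0` is the head of the list. -/
abbrev Ctx : Type := List Ty

/-- Typed de Bruijn indices. -/
inductive Var : Ctx → Ty → Type
  | zero {Γ : Ctx} {a : Ty} : Var (a :: Γ) a
  | succ {Γ : Ctx} {a b : Ty} (x : Var Γ a) : Var (b :: Γ) a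

/-- The constants. -/
inductive Const : Ty → Type
  -- natural numbers
  | z : Const .nt
  | s : Const (.arr .nt .nt)
  -- lists of atoms
  | nil : Const .lst
  | cons : Const (.arr .atm (.arr .lst .lst))
  -- goal formulas of the intuitionistic object logic
  | atom : Const (.arr .atm .prp)
  | tt : Const .prp
  | amp : Const (.arr .prp (.arr .prp .prp))
  | imp : Const (.arr .atm (.arr .prp .prp))
  | forallI : Const (.arr (.arr .i .prp) .prp)
  -- PCF types
  | num : Const .i
  | bool : Const .i
  | arrow : Const (.arr .i (.arr .i .i))
  -- PCF terms
  | zero : Const .i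
  | tru : Const .i
  | fls : Const .i
  | succ : Const (.arr .i .i)
  | pred : Const (.arr .i .i)
  | isZero : Const (.arr .i .i)
  | cond : Const (.arr .i (.arr .i (.arr .i .i)))
  | abs : Const (.arr .i (.arr (.arr .i .i) .i))
  | app : Const (.arr .i (.arr .i .i))
  | fix : Const (.arr .i (.arr (.arr .i .i) .i))
  -- judgements about PCF
  | typeof : Const (.arr .i (.arr .i .atm))
  | natsem : Const (.arr .i (.arr .i .atm))
  | transone : Const (.arr .i (.arr .i .atm))
  | transsem : Const (.arr .i (.arr .i .atm))
  | value : Const (.arr .i .atm)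

/-- Lambda-terms, before identification up to conversion. -/
inductive Raw : Ctx → Ty → Type
  | var {Γ : Ctx} {a : Ty} (x : Var Γ a) : Raw Γ a
  | const {Γ : Ctx} {a : Ty} (c : Const a) : Raw Γ a
  | lam {Γ : Ctx} {a b : Ty} (t : Raw (a :: Γ) b) : Raw Γ (.arr a b)
  | app {Γ : Ctx} {a b : Ty} (t : Raw Γ (.arr a b)) (u : Raw Γ a) : Raw Γ b

/-- Renamings of variables. -/
abbrev Ren (Γ Δ : Ctx) : Type := ∀ ⦃a : Ty⦄, Var Γ a → Var Δ a

/-- Substitutions by raw terms. -/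
abbrev RawSub (Γ Δ : Ctx) : Type := ∀ ⦃a : Ty⦄, Var Γ a → Raw Δ a

/-- Extension of a renaming under a binder. -/
def Ren.lift {Γ Δ : Ctx} {b : Ty} (ρ : Ren Γ Δ) : Ren (b :: Γ) (b :: Δ)
  | _, .zero => .zero
  | _, .succ x => .succ (ρ x)

/-- Renaming in raw terms. -/
def Raw.rename : {Γ Δ : Ctx} → {a : Ty} → Ren Γ Δ → Raw Γ a → Raw Δ a
  | _, _, _, ρ, .var x => .var (ρ x)
  | _, _, _, _, .const c => .const c
  | _, _, _, ρ, .lam t => .lam (t.rename ρ.lift)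
  | _, _, _, ρ, .app t u => .app (t.rename ρ) (u.rename ρ)

/-- The renaming that introduces one new variable. -/
def Ren.shift {Γ : Ctx} {b : Ty} : Ren Γ (b :: Γ) := fun _ x => .succ x

/-- Extension of a substitution under a binder. -/
def RawSub.lift {Γ Δ : Ctx} {b : Ty} (σ : RawSub Γ Δ) : RawSub (b :: Γ) (b :: Δ)
  | _, .zero => .var .zero
  | _, .succ x => (σ x).rename Ren.shift

/-- Capture-avoiding simultaneous substitution in raw terms. -/
def Raw.subst : {Γ Δ : Ctx} → {a : Ty} → RawSub Γ Δ → Raw Γ a → Raw Δ a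
  | _, _, _, σ, .var x => σ x
  | _, _, _, _, .const c => .const c
  | _, _, _, σ, .lam t => .lam (t.subst σ.lift)
  | _, _, _, σ, .app t u => .app (t.subst σ) (u.subst σ)

/-- The substitution of `u` for the variable of index `0`. -/
def RawSub.single {Γ : Ctx} {b : Ty} (u : Raw Γ b) : RawSub (b :: Γ) Γ
  | _, .zero => u
  | _, .succ x => .var x

/-- Beta-eta-conversion. -/
inductive Conv : {Γ : Ctx} → {a : Ty} → Raw Γ a → Raw Γ a → Prop
  | refl {Γ : Ctx} {a : Ty} (t : Raw Γ a) : Conv t t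
  | symm {Γ : Ctx} {a : Ty} {t u : Raw Γ a} : Conv t u → Conv u t
  | trans {Γ : Ctx} {a : Ty} {t u v : Raw Γ a} : Conv t u → Conv u v → Conv t v
  | lam {Γ : Ctx} {a b : Ty} {t u : Raw (a :: Γ) b} : Conv t u → Conv (.lam t) (.lam u)
  | app {Γ : Ctx} {a b : Ty} {t t' : Raw Γ (.arr a b)} {u u' : Raw Γ a} :
      Conv t t' → Conv u u' → Conv (.app t u) (.app t' u')
  | beta {Γ : Ctx} {a b : Ty} (t : Raw (a :: Γ) b) (u : Raw Γ a) :
      Conv (.app (.lam t) u) (t.subst (RawSub.single u))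
  | eta {Γ : Ctx} {a b : Ty} (t : Raw Γ (.arr a b)) :
      Conv (.lam (.app (t.rename Ren.shift) (.var .zero))) t

/-! Conversion is preserved by renaming and substitution. -/

theorem Raw.rename_rename {Γ : Ctx} {a : Ty} (t : Raw Γ a) :
    ∀ {Δ Θ : Ctx} (ρ : Ren Γ Δ) (τ : Ren Δ Θ),
      (t.rename ρ).rename τ = t.rename (fun _ x => τ (ρ x)) := by
  induction t with
  | var x => intros; rfl
  | const c => intros; rfl
  | lam t ih =>
    intro Δ Θ ρ τ
    simp only [Raw.rename, ih]
    congr 2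
    funext a x
    cases x <;> rfl
  | app t u iht ihu => intro Δ Θ ρ τ; simp only [Raw.rename, iht, ihu]

theorem Raw.subst_rename {Γ : Ctx} {a : Ty} (t : Raw Γ a) :
    ∀ {Δ Θ : Ctx} (ρ : Ren Γ Δ) (σ : RawSub Δ Θ),
      (t.rename ρ).subst σ = t.subst (fun _ x => σ (ρ x)) := by
  induction t with
  | var x => intros; rfl
  | const c => intros; rfl
  | lam t ih =>
    intro Δ Θ ρ σ
    simp only [Raw.rename, Raw.subst, ih]
    congr 2
    funext a x
    cases x <;> rfl
  | app t u iht ihu => intro Δ Θ ρ σ; simp only [Raw.rename, Raw.subst, iht, ihu]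

theorem Raw.rename_subst {Γ : Ctx} {a : Ty} (t : Raw Γ a) :
    ∀ {Δ Θ : Ctx} (σ : RawSub Γ Δ) (ρ : Ren Δ Θ),
      (t.subst σ).rename ρ = t.subst (fun _ x => (σ x).rename ρ) := by
  induction t with
  | var x => intros; rfl
  | const c => intros; rfl
  | lam t ih =>
    intro Δ Θ σ ρ
    simp only [Raw.rename, Raw.subst, ih]
    congr 2
    funext a x
    cases x with
    | zero => rfl
    | succ x => simp only [RawSub.lift, Raw.rename_rename]; rfl
  | app t u iht ihu => intro Δ Θ σ ρ; simp only [Raw.rename, Raw.subst, iht, ihu]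

theorem Raw.subst_subst {Γ : Ctx} {a : Ty} (t : Raw Γ a) :
    ∀ {Δ Θ : Ctx} (σ : RawSub Γ Δ) (τ : RawSub Δ Θ),
      (t.subst σ).subst τ = t.subst (fun _ x => (σ x).subst τ) := by
  induction t with
  | var x => intros; rfl
  | const c => intros; rfl
  | lam t ih =>
    intro Δ Θ σ τ
    simp only [Raw.subst, ih]
    congr 2
    funext a x
    cases x with
    | zero => rfl
    | succ x => simp only [RawSub.lift, Raw.subst_rename, Raw.rename_subst]; rfl
  | app t u iht ihu => intro Δ Θ σ τ; simp only [Raw.subst, iht, ihu]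

theorem Raw.subst_var {Γ : Ctx} {a : Ty} (t : Raw Γ a) :
    t.subst (fun _ x => .var x) = t := by
  induction t with
  | var x => rfl
  | const c => rfl
  | @lam Γ a b t ih =>
    have h : (RawSub.lift (b := a) (fun _ x => Raw.var x) : RawSub (a :: Γ) (a :: Γ)) =
        fun _ x => Raw.var x := by
      funext c x
      cases x <;> rfl
    simp only [Raw.subst, h, ih]
  | app t u iht ihu => simp only [Raw.subst, iht, ihu]

theorem Raw.rename_eq_subst {Γ Δ : Ctx} {a : Ty} (ρ : Ren Γ Δ) (t : Raw Γ a) :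
    t.rename ρ = t.subst (fun _ x => .var (ρ x)) := by
  rw [← Raw.subst_rename t ρ (fun _ x => .var x), Raw.subst_var]

theorem Conv.subst {Γ : Ctx} {a : Ty} {t u : Raw Γ a} (h : Conv t u) :
    ∀ {Δ : Ctx} (σ : RawSub Γ Δ), Conv (t.subst σ) (u.subst σ) := by
  induction h with
  | refl t => intro Δ σ; exact .refl _
  | symm _ ih => intro Δ σ; exact .symm (ih σ)
  | trans _ _ ih₁ ih₂ => intro Δ σ; exact .trans (ih₁ σ) (ih₂ σ)
  | lam _ ih => intro Δ σ; exact .lam (ih _)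
  | app _ _ ih₁ ih₂ => intro Δ σ; exact .app (ih₁ σ) (ih₂ σ)
  | beta t u =>
    intro Δ σ
    have h := Conv.beta (t.subst σ.lift) (u.subst σ)
    have e : (t.subst σ.lift).subst (RawSub.single (u.subst σ)) =
        (t.subst (RawSub.single u)).subst σ := by
      rw [Raw.subst_subst, Raw.subst_subst]
      congr 1
      funext c x
      cases x with
      | zero => rfl
      | succ x =>
        simp only [RawSub.lift, RawSub.single, Raw.subst_rename, Raw.subst]
        exact Raw.subst_var (σ x)
    rw [e] at h
    exact h
  | @eta Γ a b t =>
    intro Δ σ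
    have h := Conv.eta (t.subst σ)
    have e : (t.subst σ).rename (Ren.shift (b := a)) = (t.rename Ren.shift).subst σ.lift := by
      rw [Raw.rename_subst, Raw.subst_rename]
      rfl
    rw [e] at h
    exact h

theorem Conv.rename {Γ Δ : Ctx} {a : Ty} (ρ : Ren Γ Δ) {t u : Raw Γ a} (h : Conv t u) :
    Conv (t.rename ρ) (u.rename ρ) := by
  rw [Raw.rename_eq_subst, Raw.rename_eq_subst]
  exact h.subst _

/-- Beta-eta-convertibility as a setoid. -/
def convSetoid (Γ : Ctx) (a : Ty) : Setoid (Raw Γ a) :=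
  ⟨Conv, Conv.refl, Conv.symm, Conv.trans⟩

/-- Terms of type `a` with free variables in `Γ`: lambda-terms up to beta-eta-conversion. -/
def Tm (Γ : Ctx) (a : Ty) : Type := Quotient (convSetoid Γ a)

/-- A variable as a term. -/
def Tm.var {Γ : Ctx} {a : Ty} (x : Var Γ a) : Tm Γ a := Quotient.mk (convSetoid Γ a) (.var x)

/-- A constant as a term. -/
def Tm.const {Γ : Ctx} {a : Ty} (c : Const a) : Tm Γ a := Quotient.mk (convSetoid Γ a) (.const c)

/-- Abstraction. -/
def Tm.lam {Γ : Ctx} {a b : Ty} : Tm (a :: Γ) b → Tm Γ (.arr a b) :=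
  Quotient.map (sa := convSetoid _ _) (sb := convSetoid _ _) Raw.lam fun _ _ h => Conv.lam h

/-- Application. -/
def Tm.app {Γ : Ctx} {a b : Ty} : Tm Γ (.arr a b) → Tm Γ a → Tm Γ b :=
  Quotient.map₂ (sa := convSetoid _ _) (sb := convSetoid _ _) (sc := convSetoid _ _)
    Raw.app fun _ _ h _ _ h' => Conv.app h h'

/-- Renaming of variables in a term. -/
def Tm.rename {Γ Δ : Ctx} {a : Ty} (ρ : Ren Γ Δ) : Tm Γ a → Tm Δ a :=
  Quotient.map (sa := convSetoid _ _) (sb := convSetoid _ _) (Raw.rename ρ)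
    fun _ _ h => Conv.rename ρ h

/-- A term seen in a context with one more variable. -/
def Tm.weaken {Γ : Ctx} {a b : Ty} (t : Tm Γ a) : Tm (b :: Γ) a := t.rename Ren.shift

/-- Substitutions of terms in context `Δ` for the variables of `Γ`. -/
abbrev Sub (Γ Δ : Ctx) : Type := ∀ ⦃a : Ty⦄, Var Γ a → Tm Δ a

/-- Simultaneous substitution in a term. The choice of representatives of the substituted terms is
immaterial, since conversion is a congruence. -/
noncomputable def Tm.subst {Γ Δ : Ctx} {a : Ty} (σ : Sub Γ Δ) : Tm Γ a → Tm Δ a :=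
  Quotient.map (sa := convSetoid _ _) (sb := convSetoid _ _)
    (Raw.subst fun b x => Quotient.out (s := convSetoid Δ b) (σ x)) fun _ _ h => Conv.subst h _

/-- Extension of a substitution under a binder. -/
def Sub.lift {Γ Δ : Ctx} {b : Ty} (σ : Sub Γ Δ) : Sub (b :: Γ) (b :: Δ)
  | _, .zero => .var .zero
  | _, .succ x => (σ x).weaken

/-- The substitution of `t` for the variable of index `0`. -/
def Sub.single {Γ : Ctx} {b : Ty} (t : Tm Γ b) : Sub (b :: Γ) Γ
  | _, .zero => t
  | _, .succ x => .var x

/-- The inclusion of a context into its extension by one variable. -/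
def Sub.shift {Γ : Ctx} {b : Ty} : Sub Γ (b :: Γ) := fun _ x => .var (.succ x)

/-- First `θ`, then `σ`. -/
noncomputable def Sub.comp {Γ Δ Θ : Ctx} (θ : Sub Γ Δ) (σ : Sub Δ Θ) : Sub Γ Θ :=
  fun _ x => (θ x).subst σ

section Variables

variable {Γ : Ctx} {a b c d e : Ty}

/-- The variable of index `0`. -/
def v0 : Tm (a :: Γ) a := .var .zero
/-- The variable of index `1`. -/
def v1 : Tm (a :: b :: Γ) b := .var (.succ .zero)
/-- The variable of index `2`. -/
def v2 : Tm (a :: b :: c :: Γ) c := .var (.succ (.succ .zero))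
/-- The variable of index `3`. -/
def v3 : Tm (a :: b :: c :: d :: Γ) d := .var (.succ (.succ (.succ .zero)))
/-- The variable of index `4`. -/
def v4 : Tm (a :: b :: c :: d :: e :: Γ) e := .var (.succ (.succ (.succ (.succ .zero))))

end Variables

/-! ### Formulas -/

/-- Predicate constants. -/
inductive Pred : Type
  | nat
  | eq | lt | le | sum
  | length | list | element | split | permute
  | seq | prog
  | same

/-- Atomic formulas, other than those of the predicate `nat`. -/
inductive Atom (Γ : Ctx) : Type
  -- predicates over natural numbers
  | eq (I J : Tm Γ .nt)
  | lt (I J : Tm Γ .nt)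
  | le (I J : Tm Γ .nt)
  | sum (I J K : Tm Γ .nt)
  -- predicates over lists
  | length (L : Tm Γ .lst) (I : Tm Γ .nt)
  | list (L : Tm Γ .lst)
  | element (X : Tm Γ .atm) (L : Tm Γ .lst)
  | split (L L₁ L₂ : Tm Γ .lst)
  | permute (L L' : Tm Γ .lst)
  -- sequents and theory of the object logic
  | seq (I : Tm Γ .nt) (L : Tm Γ .lst) (B : Tm Γ .prp)
  | prog (A : Tm Γ .atm) (G : Tm Γ .prp)
  -- equality at type `i`
  | same (M N : Tm Γ .i)

/-- The predicate of an atomic formula. -/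
def Atom.predicate {Γ : Ctx} : Atom Γ → Pred
  | .eq _ _ => .eq
  | .lt _ _ => .lt
  | .le _ _ => .le
  | .sum _ _ _ => .sum
  | .length _ _ => .length
  | .list _ => .list
  | .element _ _ => .element
  | .split _ _ _ => .split
  | .permute _ _ => .permute
  | .seq _ _ _ => .seq
  | .prog _ _ => .prog
  | .same _ _ => .same

/-- Substitution in an atomic formula. -/
noncomputable def Atom.subst {Γ Δ : Ctx} (σ : Sub Γ Δ) : Atom Γ → Atom Δ
  | .eq I J => .eq (I.subst σ) (J.subst σ)
  | .lt I J => .lt (I.subst σ) (J.subst σ)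
  | .le I J => .le (I.subst σ) (J.subst σ)
  | .sum I J K => .sum (I.subst σ) (J.subst σ) (K.subst σ)
  | .length L I => .length (L.subst σ) (I.subst σ)
  | .list L => .list (L.subst σ)
  | .element X L => .element (X.subst σ) (L.subst σ)
  | .split L L₁ L₂ => .split (L.subst σ) (L₁.subst σ) (L₂.subst σ)
  | .permute L L' => .permute (L.subst σ) (L'.subst σ)
  | .seq I L B => .seq (I.subst σ) (L.subst σ) (B.subst σ)
  | .prog A G => .prog (A.subst σ) (G.subst σ)
  | .same M N => .same (M.subst σ) (N.subst σ)

/-- Formulas with free variables in a context. -/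
inductive Fm : Ctx → Type
  | nat {Γ : Ctx} (I : Tm Γ .nt) : Fm Γ
  | atom {Γ : Ctx} (A : Atom Γ) : Fm Γ
  | bot {Γ : Ctx} : Fm Γ
  | top {Γ : Ctx} : Fm Γ
  | and {Γ : Ctx} (B C : Fm Γ) : Fm Γ
  | or {Γ : Ctx} (B C : Fm Γ) : Fm Γ
  | imp {Γ : Ctx} (B C : Fm Γ) : Fm Γ
  | all {Γ : Ctx} (a : Ty) (B : Fm (a :: Γ)) : Fm Γ
  | ex {Γ : Ctx} (a : Ty) (B : Fm (a :: Γ)) : Fm Γ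

/-- Substitution in a formula. -/
noncomputable def Fm.subst : {Γ Δ : Ctx} → Sub Γ Δ → Fm Γ → Fm Δ
  | _, _, σ, .nat I => .nat (I.subst σ)
  | _, _, σ, .atom A => .atom (A.subst σ)
  | _, _, _, .bot => .bot
  | _, _, _, .top => .top
  | _, _, σ, .and B C => .and (B.subst σ) (C.subst σ)
  | _, _, σ, .or B C => .or (B.subst σ) (C.subst σ)
  | _, _, σ, .imp B C => .imp (B.subst σ) (C.subst σ)
  | _, _, σ, .all a B => .all a (B.subst σ.lift)
  | _, _, σ, .ex a B => .ex a (B.subst σ.lift)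

/-- `B[t/x]`, where `x` is the variable of index `0`. -/
noncomputable def Fm.inst {Γ : Ctx} {a : Ty} (B : Fm (a :: Γ)) (t : Tm Γ a) : Fm Γ :=
  B.subst (Sub.single t)

/-- A formula seen in a context with one more variable. -/
noncomputable def Fm.weaken {Γ : Ctx} {a : Ty} (B : Fm Γ) : Fm (a :: Γ) := B.subst Sub.shift

/-- The level of a formula, for given levels of the predicates. -/
def Fm.level (lvl : Pred → ℕ) : {Γ : Ctx} → Fm Γ → ℕ
  | _, .nat _ => lvl .nat
  | _, .atom A => lvl A.predicate
  | _, .bot => 0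
  | _, .top => 0
  | _, .and B C => max (B.level lvl) (C.level lvl)
  | _, .or B C => max (B.level lvl) (C.level lvl)
  | _, .imp B C => max (B.level lvl + 1) (C.level lvl)
  | _, .all _ B => B.level lvl
  | _, .ex _ B => B.level lvl

/-! ### Definitions and derivability -/

/-- A definitional clause: `head` is defined by `body`, for all values of the variables in
`ctx`. -/
structure Clause : Type where
  ctx : Ctx
  head : Atom ctx
  body : Fm ctx

/-- A stratified set of definitional clauses. The predicate `nat` is never defined by clauses. -/
structure Definition : Type where
  clauses : Set Clause
  level : Pred → ℕ
  stratified : ∀ c ∈ clauses, c.body.level level ≤ level c.head.predicate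

/-- A unifier of the atom `A` and the head of the clause `c`. The variables of the clause are kept
apart from those of `A`: `left` acts on the latter and `right` on the former. -/
structure Unifier {Γ : Ctx} (A : Atom Γ) (c : Clause) : Type where
  cod : Ctx
  left : Sub Γ cod
  right : Sub c.ctx cod
  unifies : A.subst left = c.head.subst right

/-- Every unifier is an instance of a member of `S`. -/
def IsCompleteSetOfUnifiers {Γ : Ctx} {A : Atom Γ} {c : Clause} (S : Set (Unifier A c)) : Prop :=
  ∀ ρ : Unifier A c, ∃ θ ∈ S, ∃ σ : Sub θ.cod ρ.cod,
    ρ.left = θ.left.comp σ ∧ ρ.right = θ.right.comp σ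

/-- `Der D H C`: the sequent with antecedent `H` and consequent `C`, whose free variables are in
`Γ`, is derivable from the definition `D`. -/
inductive Der (D : Definition) : {Γ : Ctx} → Multiset (Fm Γ) → Fm Γ → Prop
  | botL {Γ : Ctx} {H : Multiset (Fm Γ)} {B : Fm Γ} : Der D (.bot ::ₘ H) B
  | topR {Γ : Ctx} {H : Multiset (Fm Γ)} : Der D H .top
  | andL₁ {Γ : Ctx} {H : Multiset (Fm Γ)} {B C E : Fm Γ} :
      Der D (B ::ₘ H) E → Der D (.and B C ::ₘ H) E
  | andL₂ {Γ : Ctx} {H : Multiset (Fm Γ)} {B C E : Fm Γ} :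
      Der D (C ::ₘ H) E → Der D (.and B C ::ₘ H) E
  | andR {Γ : Ctx} {H : Multiset (Fm Γ)} {B C : Fm Γ} :
      Der D H B → Der D H C → Der D H (.and B C)
  | orL {Γ : Ctx} {H : Multiset (Fm Γ)} {B C E : Fm Γ} :
      Der D (B ::ₘ H) E → Der D (C ::ₘ H) E → Der D (.or B C ::ₘ H) E
  | orR₁ {Γ : Ctx} {H : Multiset (Fm Γ)} {B C : Fm Γ} : Der D H B → Der D H (.or B C)
  | orR₂ {Γ : Ctx} {H : Multiset (Fm Γ)} {B C : Fm Γ} : Der D H C → Der D H (.or B C)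
  | impL {Γ : Ctx} {H : Multiset (Fm Γ)} {B C E : Fm Γ} :
      Der D H B → Der D (C ::ₘ H) E → Der D (.imp B C ::ₘ H) E
  | impR {Γ : Ctx} {H : Multiset (Fm Γ)} {B C : Fm Γ} :
      Der D (B ::ₘ H) C → Der D H (.imp B C)
  | allL {Γ : Ctx} {H : Multiset (Fm Γ)} {a : Ty} {B : Fm (a :: Γ)} {C : Fm Γ} (t : Tm Γ a) :
      Der D (B.inst t ::ₘ H) C → Der D (.all a B ::ₘ H) C
  | allR {Γ : Ctx} {H : Multiset (Fm Γ)} {a : Ty} {B : Fm (a :: Γ)} :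
      Der D (H.map Fm.weaken) B → Der D H (.all a B)
  | exL {Γ : Ctx} {H : Multiset (Fm Γ)} {a : Ty} {B : Fm (a :: Γ)} {C : Fm Γ} :
      Der D (B ::ₘ H.map Fm.weaken) C.weaken → Der D (.ex a B ::ₘ H) C
  | exR {Γ : Ctx} {H : Multiset (Fm Γ)} {a : Ty} {B : Fm (a :: Γ)} (t : Tm Γ a) :
      Der D H (B.inst t) → Der D H (.ex a B)
  | initAtom {Γ : Ctx} {H : Multiset (Fm Γ)} {A : Atom Γ} : Der D (.atom A ::ₘ H) (.atom A)
  | initNat {Γ : Ctx} {H : Multiset (Fm Γ)} {I : Tm Γ .nt} : Der D (.nat I ::ₘ H) (.nat I)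
  | contrL {Γ : Ctx} {H : Multiset (Fm Γ)} {B C : Fm Γ} :
      Der D (B ::ₘ B ::ₘ H) C → Der D (B ::ₘ H) C
  | cut {Γ : Ctx} {H₁ H₂ : Multiset (Fm Γ)} {B C : Fm Γ} :
      Der D H₁ B → Der D (B ::ₘ H₂) C → Der D (H₁ + H₂) C
  | natRzero {Γ : Ctx} {H : Multiset (Fm Γ)} : Der D H (.nat (.const .z))
  | natRsucc {Γ : Ctx} {H : Multiset (Fm Γ)} {I : Tm Γ .nt} :
      Der D H (.nat I) → Der D H (.nat ((Tm.const .s).app I))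
  -- in the second premise the eigenvariable `j` has index `0`, so that `B` itself is `B j`
  | natL {Γ : Ctx} {H : Multiset (Fm Γ)} {I : Tm Γ .nt} {C : Fm Γ} (B : Fm (.nt :: Γ)) :
      Der D 0 (B.inst (.const .z)) →
      Der D {B} ((B.subst (Sub.lift Sub.shift)).inst ((Tm.const .s).app v0)) →
      Der D (B.inst I ::ₘ H) C →
      Der D (.nat I ::ₘ H) C
  | defR {Γ : Ctx} {H : Multiset (Fm Γ)} {A : Atom Γ} (c : Clause) (hc : c ∈ D.clauses)
      (θ : Sub c.ctx Γ) (hA : A = c.head.subst θ) :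
      Der D H (c.body.subst θ) → Der D H (.atom A)
  | defL {Γ : Ctx} {H : Multiset (Fm Γ)} {A : Atom Γ} {C : Fm Γ}
      (S : (c : Clause) → Set (Unifier A c))
      (hS : ∀ c ∈ D.clauses, IsCompleteSetOfUnifiers (S c)) :
      (∀ c ∈ D.clauses, ∀ θ ∈ S c,
        Der D (c.body.subst θ.right ::ₘ H.map (Fm.subst θ.left)) (C.subst θ.left)) →
      Der D (.atom A ::ₘ H) C

/-- A closed formula is derivable from `D`. -/
def Derivable (D : Definition) (B : Fm []) : Prop := Der D 0 B

/-! ### Notation for terms -/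

section Terms

variable {Γ : Ctx} {a b c d : Ty}

/-- A constant applied to one argument. -/
def ap₁ (k : Const (.arr a b)) (t : Tm Γ a) : Tm Γ b := (Tm.const k).app t

/-- A constant applied to two arguments. -/
def ap₂ (k : Const (.arr a (.arr b c))) (t : Tm Γ a) (u : Tm Γ b) : Tm Γ c := (ap₁ k t).app u

/-- A constant applied to three arguments. -/
def ap₃ (k : Const (.arr a (.arr b (.arr c d)))) (t : Tm Γ a) (u : Tm Γ b) (v : Tm Γ c) : Tm Γ d :=
  (ap₂ k t u).app v

def z : Tm Γ .nt := .const .z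
def s (I : Tm Γ .nt) : Tm Γ .nt := ap₁ .s I
def nil : Tm Γ .lst := .const .nil
def cons (X : Tm Γ .atm) (L : Tm Γ .lst) : Tm Γ .lst := ap₂ .cons X L

/-- The atom `A` as a goal formula. -/
def atom (A : Tm Γ .atm) : Tm Γ .prp := ap₁ .atom A
def tt : Tm Γ .prp := .const .tt
/-- Object-level conjunction. -/
def amp (B C : Tm Γ .prp) : Tm Γ .prp := ap₂ .amp B C
/-- Object-level implication. -/
def oimp (A : Tm Γ .atm) (B : Tm Γ .prp) : Tm Γ .prp := ap₂ .imp A B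
/-- Object-level universal quantification over `i`. -/
def oall (B : Tm Γ (.arr .i .prp)) : Tm Γ .prp := ap₁ .forallI B

def num : Tm Γ .i := .const .num
def bool : Tm Γ .i := .const .bool
def arrow (T U : Tm Γ .i) : Tm Γ .i := ap₂ .arrow T U

def zero : Tm Γ .i := .const .zero
def tru : Tm Γ .i := .const .tru
def fls : Tm Γ .i := .const .fls
def succ (M : Tm Γ .i) : Tm Γ .i := ap₁ .succ M
def pred (M : Tm Γ .i) : Tm Γ .i := ap₁ .pred M
def isZero (M : Tm Γ .i) : Tm Γ .i := ap₁ .isZero M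
def cond (M N₁ N₂ : Tm Γ .i) : Tm Γ .i := ap₃ .cond M N₁ N₂
def abs (T : Tm Γ .i) (R : Tm Γ (.arr .i .i)) : Tm Γ .i := ap₂ .abs T R
def app (M N : Tm Γ .i) : Tm Γ .i := ap₂ .app M N
/-- The recursion construct of PCF. -/
def fix (T : Tm Γ .i) (R : Tm Γ (.arr .i .i)) : Tm Γ .i := ap₂ .fix T R

def typeof (M T : Tm Γ .i) : Tm Γ .atm := ap₂ .typeof M T
/-- Natural semantics: `M` evaluates to `V`. -/
def natsem (M V : Tm Γ .i) : Tm Γ .atm := ap₂ .natsem M V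
/-- One step of the transition semantics. -/
def transone (M N : Tm Γ .i) : Tm Γ .atm := ap₂ .transone M N
/-- Finitely many steps of the transition semantics. -/
def transsem (M N : Tm Γ .i) : Tm Γ .atm := ap₂ .transsem M N
def value (V : Tm Γ .i) : Tm Γ .atm := ap₁ .value V

end Terms

/-! ### The clauses -/

/-- Predicates over natural numbers. -/
def natClauses : List Clause :=
  [ -- `I = I`
    ⟨[.nt], .eq v0 v0, .top⟩,
    -- sum: variables `J`, and `I, J, K`
    ⟨[.nt], .sum z v0 v0, .nat v0⟩,
    ⟨[.nt, .nt, .nt], .sum (s v0) v1 (s v2), .atom (.sum v0 v1 v2)⟩,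
    -- less than
    ⟨[.nt], .lt z (s v0), .nat v0⟩,
    ⟨[.nt, .nt], .lt (s v0) (s v1), .atom (.lt v0 v1)⟩,
    -- less than or equal
    ⟨[.nt], .le v0 v0, .top⟩,
    ⟨[.nt, .nt], .le v0 v1, .atom (.lt v0 v1)⟩ ]

/-- Predicates over lists of atoms. -/
def listClauses : List Clause :=
  [ ⟨[], .length nil z, .top⟩,
    -- variables `X, L, I`
    ⟨[.atm, .lst, .nt], .length (cons v0 v1) (s v2), .atom (.length v1 v2)⟩,
    ⟨[.lst], .list v0, .ex .nt (.and (.nat v0) (.atom (.length v1 v0)))⟩,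
    -- variables `X, L`, and `X, Y, L`
    ⟨[.atm, .lst], .element v0 (cons v0 v1), .top⟩,
    ⟨[.atm, .atm, .lst], .element v0 (cons v1 v2), .atom (.element v0 v2)⟩,
    -- variables `X, L₁, L₂, L₃`
    ⟨[], .split nil nil nil, .top⟩,
    ⟨[.atm, .lst, .lst, .lst], .split (cons v0 v1) (cons v0 v2) v3, .atom (.split v1 v2 v3)⟩,
    ⟨[.atm, .lst, .lst, .lst], .split (cons v0 v1) v2 (cons v0 v3), .atom (.split v1 v2 v3)⟩,
    -- variables `X, L₁, L₂`
    ⟨[], .permute nil nil, .top⟩,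
    ⟨[.atm, .lst, .lst], .permute (cons v0 v1) v2,
      .ex .lst (.and (.atom (.split v3 (cons v1 nil) v0)) (.atom (.permute v2 v0)))⟩ ]

/-- Derivability in the intuitionistic object logic. -/
def intuitClauses : List Clause :=
  [ -- variables `I, A', L, A`
    ⟨[.nt, .atm, .lst, .atm], .seq v0 (cons v1 v2) (atom v3), .atom (.element v3 (cons v1 v2))⟩,
    ⟨[.nt, .lst], .seq v0 v1 tt, .top⟩,
    -- variables `I, L, B, C`
    ⟨[.nt, .lst, .prp, .prp], .seq (s v0) v1 (amp v2 v3),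
      .and (.atom (.seq v0 v1 v2)) (.atom (.seq v0 v1 v3))⟩,
    -- variables `I, L, A, B`
    ⟨[.nt, .lst, .atm, .prp], .seq (s v0) v1 (oimp v2 v3), .atom (.seq v0 (cons v2 v1) v3)⟩,
    -- variables `I, L, B`
    ⟨[.nt, .lst, .arr .i .prp], .seq (s v0) v1 (oall v2),
      .all .i (.atom (.seq v1 v2 (v3.app v0)))⟩,
    -- variables `I, L, A`
    ⟨[.nt, .lst, .atm], .seq (s v0) v1 (atom v2),
      .ex .prp (.and (.atom (.prog v3 v0)) (.atom (.seq v1 v2 v0)))⟩ ]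

/-- The clause stating that the object-level theory contains `G ⇒ A`, universally quantified over
the variables in `Γ`. -/
def progClause (Γ : Ctx) (A : Tm Γ .atm) (G : Tm Γ .prp) : Clause := ⟨Γ, .prog A G, .top⟩

/-- Typing of PCF. -/
def typingClauses : List Clause :=
  [ progClause [] (typeof zero num) tt,
    progClause [] (typeof tru bool) tt,
    progClause [] (typeof fls bool) tt,
    progClause [.i] (typeof (succ v0) num) (atom (typeof v0 num)),
    progClause [.i] (typeof (pred v0) num) (atom (typeof v0 num)),
    progClause [.i] (typeof (isZero v0) bool) (atom (typeof v0 num)),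
    -- variables `M, N₁, N₂, T`
    progClause [.i, .i, .i, .i] (typeof (cond v0 v1 v2) v3)
      (amp (atom (typeof v0 bool)) (amp (atom (typeof v1 v3)) (atom (typeof v2 v3)))),
    -- variables `T, R, U`; under the abstraction they have index `1, 2, 3`
    progClause [.i, .arr .i .i, .i] (typeof (abs v0 v1) (arrow v0 v2))
      (oall (.lam (oimp (typeof v0 v1) (atom (typeof (v2.app v0) v3))))),
    -- variables `M, N, T, U`
    progClause [.i, .i, .i, .i] (typeof (app v0 v1) v2)
      (amp (atom (typeof v0 (arrow v3 v2))) (atom (typeof v1 v3))),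
    -- variables `T, R`
    progClause [.i, .arr .i .i] (typeof (fix v0 v1) v0)
      (oall (.lam (oimp (typeof v0 v1) (atom (typeof (v2.app v0) v1))))) ]

/-- Natural semantics of PCF. -/
def natsemClauses : List Clause :=
  [ progClause [] (natsem zero zero) tt,
    progClause [] (natsem tru tru) tt,
    progClause [] (natsem fls fls) tt,
    -- variables `M, V`
    progClause [.i, .i] (natsem (succ v0) (succ v1)) (atom (natsem v0 v1)),
    progClause [.i] (natsem (pred v0) zero) (atom (natsem v0 zero)),
    progClause [.i, .i] (natsem (pred v0) v1) (atom (natsem v0 (succ v1))),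
    progClause [.i] (natsem (isZero v0) tru) (atom (natsem v0 zero)),
    progClause [.i, .i] (natsem (isZero v0) fls) (atom (natsem v0 (succ v1))),
    -- variables `M, N₁, N₂, V`
    progClause [.i, .i, .i, .i] (natsem (cond v0 v1 v2) v3)
      (amp (atom (natsem v0 tru)) (atom (natsem v1 v3))),
    progClause [.i, .i, .i, .i] (natsem (cond v0 v1 v2) v3)
      (amp (atom (natsem v0 fls)) (atom (natsem v2 v3))),
    -- variables `T, R`
    progClause [.i, .arr .i .i] (natsem (abs v0 v1) (abs v0 v1)) tt,
    -- variables `M, N, V, T, R`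
    progClause [.i, .i, .i, .i, .arr .i .i] (natsem (app v0 v1) v2)
      (amp (atom (natsem v0 (abs v3 v4))) (atom (natsem (v4.app v1) v2))),
    -- variables `T, R, V`
    progClause [.i, .arr .i .i, .i] (natsem (fix v0 v1) v2)
      (atom (natsem (v1.app (fix v0 v1)) v2)) ]

/-- Transition semantics and values of PCF. -/
def transClauses : List Clause :=
  [ -- variables `M, M'`
    progClause [.i, .i] (transone (succ v0) (succ v1)) (atom (transone v0 v1)),
    progClause [] (transone (pred zero) zero) tt,
    progClause [.i] (transone (pred (succ v0)) v0) (atom (value v0)),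
    progClause [.i, .i] (transone (pred v0) (pred v1)) (atom (transone v0 v1)),
    progClause [] (transone (isZero zero) tru) tt,
    progClause [.i] (transone (isZero (succ v0)) fls) (atom (value v0)),
    progClause [.i, .i] (transone (isZero v0) (isZero v1)) (atom (transone v0 v1)),
    -- variables `M, N`
    progClause [.i, .i] (transone (cond tru v0 v1) v0) tt,
    progClause [.i, .i] (transone (cond fls v0 v1) v1) tt,
    -- variables `M, N₁, N₂, M'`
    progClause [.i, .i, .i, .i] (transone (cond v0 v1 v2) (cond v3 v1 v2)) (atom (transone v0 v3)),
    -- variables `T, R, N`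
    progClause [.i, .arr .i .i, .i] (transone (app (abs v0 v1) v2) (v1.app v2)) tt,
    -- variables `M, N, M'`
    progClause [.i, .i, .i] (transone (app v0 v1) (app v2 v1)) (atom (transone v0 v2)),
    -- variables `T, R`
    progClause [.i, .arr .i .i] (transone (fix v0 v1) (v1.app (fix v0 v1))) tt,
    -- many steps: variables `M`, and `M, N, M'`
    progClause [.i] (transsem v0 v0) tt,
    progClause [.i, .i, .i] (transsem v0 v1) (amp (atom (transone v0 v2)) (atom (transsem v2 v1))),
    -- values
    progClause [] (value zero) tt,
    progClause [] (value tru) tt,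
    progClause [] (value fls) tt,
    progClause [.i] (value (succ v0)) (atom (value v0)),
    progClause [.i, .arr .i .i] (value (abs v0 v1)) tt ]

/-- Equality at type `i`. -/
def sameClauses : List Clause := [ ⟨[.i], .same v0 v0, .top⟩ ]

/-- The definition that accumulates the clauses for natural numbers, lists of atoms, the object
logic, PCF, and equality at type `i`. All predicates have level `0`. -/
def pcfDefinition : Definition where
  clauses := {c | c ∈ natClauses ++ listClauses ++ intuitClauses ++
    (typingClauses ++ natsemClauses ++ transClauses) ++ sameClauses}
  level := fun _ => 0
  stratified := by
    have h : ∀ c ∈ natClauses ++ listClauses ++ intuitClauses ++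
        (typingClauses ++ natsemClauses ++ transClauses) ++ sameClauses,
        c.body.level (fun _ => 0) = 0 := by
      simp [natClauses, listClauses, intuitClauses, typingClauses, natsemClauses, transClauses,
        sameClauses, progClause, Fm.level]
    intro c hc
    exact (h c hc).le

/-- The formula `∃ i (nat i ∧ seq i L B)`: the goal `B` is provable in the object logic from the
atoms in `L` and the theory. -/
def prvFrom {Γ : Ctx} (L : Tm Γ .lst) (B : Tm Γ .prp) : Fm Γ :=
  .ex .nt (.and (.nat v0) (.atom (.seq v0 L.weaken B.weaken)))

/-- The formula `∃ i (nat i ∧ seq i nil B)`. -/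
def prv {Γ : Ctx} (B : Tm Γ .prp) : Fm Γ := prvFrom nil B

end FOLDN

open FOLDN

namespace FOLDN

/-! ### Weak head reduction and a logical relation for conversion -/

/-- One step of weak head reduction. -/
inductive Wh : {Γ : Ctx} → {a : Ty} → Raw Γ a → Raw Γ a → Prop
  | beta {Γ : Ctx} {a b : Ty} (t : Raw (a :: Γ) b) (u : Raw Γ a) :
      Wh (.app (.lam t) u) (t.subst (RawSub.single u))
  | app {Γ : Ctx} {a b : Ty} {t t' : Raw Γ (.arr a b)} {u : Raw Γ a} :
      Wh t t' → Wh (.app t u) (.app t' u)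

/-- Two neutral terms with the same head and convertible arguments. -/
inductive NeMatch : {Γ : Ctx} → {a : Ty} → Raw Γ a → Raw Γ a → Prop
  | var {Γ : Ctx} {a : Ty} (x : Var Γ a) : NeMatch (.var x) (.var x)
  | const {Γ : Ctx} {a : Ty} (c : Const a) : NeMatch (Γ := Γ) (.const c) (.const c)
  | app {Γ : Ctx} {a b : Ty} {n n' : Raw Γ (.arr a b)} {u u' : Raw Γ a} :
      NeMatch n n' → Conv u u' → NeMatch (.app n u) (.app n' u')

theorem NeMatch.symm {Γ : Ctx} {a : Ty} {n n' : Raw Γ a} (h : NeMatch n n') : NeMatch n' n := by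
  induction h with
  | var x => exact .var x
  | const c => exact .const c
  | app _ hu ih => exact .app ih hu.symm

theorem NeMatch.trans {Γ : Ctx} {a : Ty} {n m : Raw Γ a} (h : NeMatch n m) :
    ∀ {k : Raw Γ a}, NeMatch m k → NeMatch n k := by
  induction h with
  | var x => exact fun h => h
  | const c => exact fun h => h
  | app _ hu ih =>
    intro k h
    cases h with
    | app h' hu' => exact .app (ih h') (hu.trans hu')

theorem NeMatch.conv {Γ : Ctx} {a : Ty} {n n' : Raw Γ a} (h : NeMatch n n') : Conv n n' := by
  induction h with
  | var x => exact .refl _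
  | const c => exact .refl _
  | app _ hu ih => exact .app ih hu

theorem NeMatch.rename {Γ : Ctx} {a : Ty} {n n' : Raw Γ a} (h : NeMatch n n') :
    ∀ {Δ : Ctx} (ρ : Ren Γ Δ), NeMatch (n.rename ρ) (n'.rename ρ) := by
  induction h with
  | var x => exact fun ρ => .var _
  | const c => exact fun ρ => .const _
  | app _ hu ih => exact fun ρ => .app (ih ρ) (hu.rename ρ)

theorem Wh.conv {Γ : Ctx} {a : Ty} {t u : Raw Γ a} (h : Wh t u) : Conv t u := by
  induction h with
  | beta t u => exact .beta t u
  | app _ ih => exact .app ih (.refl _)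

theorem Raw.subst_single_rename {Γ Δ : Ctx} {a b : Ty} (ρ : Ren Γ Δ) (t : Raw (a :: Γ) b)
    (u : Raw Γ a) : (t.subst (RawSub.single u)).rename ρ =
      (t.rename ρ.lift).subst (RawSub.single (u.rename ρ)) := by
  rw [Raw.rename_subst, Raw.subst_rename]
  congr 1
  funext c x
  cases x <;> rfl

theorem Wh.rename {Γ : Ctx} {a : Ty} {t u : Raw Γ a} (h : Wh t u) :
    ∀ {Δ : Ctx} (ρ : Ren Γ Δ), Wh (t.rename ρ) (u.rename ρ) := by
  induction h with
  | beta t u =>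
    intro Δ ρ
    rw [Raw.subst_single_rename]
    exact .beta _ _
  | app _ ih => exact fun ρ => .app (ih ρ)

theorem NeMatch.not_wh {Γ : Ctx} {a : Ty} {n n' : Raw Γ a} (h : NeMatch n n') :
    ∀ {t : Raw Γ a}, ¬ Wh n t := by
  induction h with
  | var x => intro t h; cases h
  | const c => intro t h; cases h
  | app h _ ih =>
    intro t h'
    cases h' with
    | beta => cases h
    | app h' => exact ih h'

theorem Wh.deterministic {Γ : Ctx} {a : Ty} {t u : Raw Γ a} (h : Wh t u) :
    ∀ {v : Raw Γ a}, Wh t v → u = v := by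
  induction h with
  | beta t u =>
    intro v h
    cases h with
    | beta => rfl
    | app h => cases h
  | app h ih =>
    intro v h'
    cases h' with
    | beta => cases h
    | app h' => rw [ih h']

/-- Weak head reduction in any number of steps. -/
abbrev Whs {Γ : Ctx} {a : Ty} : Raw Γ a → Raw Γ a → Prop := Relation.ReflTransGen Wh

theorem Whs.conv {Γ : Ctx} {a : Ty} {t u : Raw Γ a} (h : Whs t u) : Conv t u := by
  induction h with
  | refl => exact .refl _
  | tail _ h ih => exact ih.trans h.conv

theorem Whs.rename {Γ Δ : Ctx} {a : Ty} {t u : Raw Γ a} (h : Whs t u) (ρ : Ren Γ Δ) :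
    Whs (t.rename ρ) (u.rename ρ) := by
  induction h with
  | refl => exact .refl
  | tail _ h ih => exact ih.tail (h.rename ρ)

theorem Whs.eq_of_neutral {Γ : Ctx} {a : Ty} {n n' u : Raw Γ a} (h : Whs n u)
    (hn : NeMatch n n') : n = u := by
  cases h.cases_head with
  | inl h => exact h
  | inr h => exact absurd h.choose_spec.1 hn.not_wh

/-- Weak head reduction is deterministic and neutral terms do not reduce. This makes `LRBase`
transitive. -/
theorem Whs.neutral_unique {Γ : Ctx} {a : Ty} {t n m n' m' : Raw Γ a} (h : Whs t n)
    (hn : NeMatch n n') (hm : NeMatch m m') (h' : Whs t m) : n = m := by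
  induction h using Relation.ReflTransGen.head_induction_on with
  | refl => exact h'.eq_of_neutral hn
  | head h _ ih =>
    cases h'.cases_head with
    | inl e => subst e; exact absurd h hm.not_wh
    | inr e =>
      obtain ⟨w, hw, hw'⟩ := e
      rw [h.deterministic hw] at ih
      exact ih hw'

/-- Both terms have weak head normal forms, which are neutral with matching heads. -/
def LRBase {Γ : Ctx} {a : Ty} (t u : Raw Γ a) : Prop :=
  ∃ n n', Whs t n ∧ Whs u n' ∧ NeMatch n n'

/-- The Kripke logical relation over `LRBase`. -/
def LR : (a : Ty) → {Γ : Ctx} → Raw Γ a → Raw Γ a → Prop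
  | .arr a b, Γ, t, u => ∀ (Δ : Ctx) (ρ : Ren Γ Δ) (v w : Raw Δ a), LR a v w →
      LR b (.app (t.rename ρ) v) (.app (u.rename ρ) w)
  | .i, _, t, u => LRBase t u
  | .nt, _, t, u => LRBase t u
  | .atm, _, t, u => LRBase t u
  | .prp, _, t, u => LRBase t u
  | .lst, _, t, u => LRBase t u

/-- Types other than function types. -/
def Ty.IsBase : Ty → Prop
  | .arr _ _ => False
  | _ => True

theorem LR_eq_of_isBase {a : Ty} (ha : a.IsBase) {Γ : Ctx} (t u : Raw Γ a) :
    LR a t u = LRBase t u := by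
  cases a with
  | arr => exact ha.elim
  | _ => rfl

theorem LRBase.conv {Γ : Ctx} {a : Ty} {t u : Raw Γ a} (h : LRBase t u) : Conv t u := by
  obtain ⟨n, n', hn, hn', h⟩ := h
  exact (hn.conv.trans h.conv).trans hn'.conv.symm

theorem LRBase.trans {Γ : Ctx} {a : Ty} {t u v : Raw Γ a} (h : LRBase t u) (h' : LRBase u v) :
    LRBase t v := by
  obtain ⟨n, m, hn, hm, h⟩ := h
  obtain ⟨m', k, hm', hk, h'⟩ := h'
  obtain rfl := hm.neutral_unique h.symm h' hm'
  exact ⟨n, k, hn, hk, h.trans h'⟩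

theorem Ty.isBase_or (a : Ty) : a.IsBase ∨ ∃ b c, a = .arr b c := by
  cases a with
  | arr b c => exact .inr ⟨b, c, rfl⟩
  | _ => exact .inl trivial

theorem Ty.induction_isBase {P : Ty → Prop} (base : ∀ a : Ty, a.IsBase → P a)
    (arr : ∀ a b, P a → P b → P (.arr a b)) (a : Ty) : P a := by
  induction a with
  | arr a b iha ihb => exact arr a b iha ihb
  | _ => exact base _ trivial

theorem LR.rename {a : Ty} {Γ Δ : Ctx} {t u : Raw Γ a} (ρ : Ren Γ Δ) (h : LR a t u) :
    LR a (t.rename ρ) (u.rename ρ) := by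
  rcases a.isBase_or with ha | ⟨b, c, rfl⟩
  · rw [LR_eq_of_isBase ha] at h ⊢
    obtain ⟨n, n', hn, hn', h⟩ := h
    exact ⟨_, _, hn.rename ρ, hn'.rename ρ, h.rename ρ⟩
  · intro Θ τ v w hvw
    rw [Raw.rename_rename, Raw.rename_rename]
    exact h Θ _ v w hvw

/-- The two halves need each other at function types. A neutral function stays neutral on related
arguments, which match because they are convertible; related functions are compared on a new
variable, which is neutral, and eta gives back the functions. -/
theorem LR.reflect_reify (a : Ty) :
    (∀ {Γ : Ctx} {n n' : Raw Γ a}, NeMatch n n' → LR a n n') ∧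
      ∀ {Γ : Ctx} {t u : Raw Γ a}, LR a t u → Conv t u := by
  induction a using Ty.induction_isBase with
  | base a ha =>
    refine ⟨fun {Γ n n'} h => ?_, fun {Γ t u} h => ?_⟩
    · rw [LR_eq_of_isBase ha]
      exact ⟨n, n', .refl, .refl, h⟩
    · rw [LR_eq_of_isBase ha] at h
      exact h.conv
  | arr a b iha ihb =>
    refine ⟨fun {Γ n n'} h => ?_, fun {Γ t u} h => ?_⟩
    · intro Δ ρ v w hvw
      exact ihb.1 (.app (h.rename ρ) (iha.2 hvw))
    · have h' := ihb.2 (h (a :: Γ) Ren.shift _ _ (iha.1 (.var .zero)))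
      exact (Conv.eta t).symm.trans (h'.lam.trans (.eta u))

/-- At base types only weak head normal forms matter; at function types the step takes place in the
head of the application. -/
theorem LR.expand_left (a : Ty) : ∀ {Γ : Ctx} {t t' u : Raw Γ a}, Wh t t' → LR a t' u →
    LR a t u := by
  induction a using Ty.induction_isBase with
  | base a ha =>
    intro Γ t t' u h h'
    rw [LR_eq_of_isBase ha] at h' ⊢
    obtain ⟨n, n', hn, hn', h''⟩ := h'
    exact ⟨n, n', .head h hn, hn', h''⟩
  | arr a b iha ihb =>
    intro Γ t t' u h h' Δ ρ v w hvw
    exact ihb (.app (h.rename ρ)) (h' Δ ρ v w hvw)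

theorem LR.symm (a : Ty) : ∀ {Γ : Ctx} {t u : Raw Γ a}, LR a t u → LR a u t := by
  induction a using Ty.induction_isBase with
  | base a ha =>
    intro Γ t u h
    rw [LR_eq_of_isBase ha] at h ⊢
    obtain ⟨n, n', hn, hn', h⟩ := h
    exact ⟨n', n, hn', hn, h.symm⟩
  | arr a b iha ihb => exact fun h Δ ρ v w hvw => ihb (h Δ ρ w v (iha hvw))

theorem LR.trans (a : Ty) : ∀ {Γ : Ctx} {t u v : Raw Γ a}, LR a t u → LR a u v → LR a t v := by
  induction a using Ty.induction_isBase with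
  | base a ha =>
    intro Γ t u v h h'
    rw [LR_eq_of_isBase ha] at h h' ⊢
    exact h.trans h'
  | arr a b iha ihb =>
    intro Γ t u v h h' Δ ρ x y hxy
    -- Reflexivity is not available yet; `y` is related to itself by symmetry and transitivity at
    -- the smaller type.
    exact ihb (h Δ ρ x y hxy) (h' Δ ρ y y (iha (LR.symm a hxy) hxy))

theorem LR.expand_right {a : Ty} {Γ : Ctx} {t u u' : Raw Γ a} (h : Wh u u') (h' : LR a t u') :
    LR a t u :=
  LR.symm a (LR.expand_left a h (LR.symm a h'))

/-- Applied to arguments, both abstractions beta-reduce to the instances related by `h`. This is the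
binder case of `LR.fundamental` and of `LR.of_conv`. -/
theorem LR.lam {Γ Δ : Ctx} {a b : Ty} {t u : Raw (a :: Γ) b} {σ τ : RawSub Γ Δ}
    (h : ∀ {Θ : Ctx} (ρ : Ren Δ Θ) (v w : Raw Θ a), LR a v w →
      LR b (t.subst fun _ x => ((σ.lift x).rename ρ.lift).subst (RawSub.single v))
        (u.subst fun _ x => ((τ.lift x).rename ρ.lift).subst (RawSub.single w))) :
    LR (.arr a b) ((Raw.lam t).subst σ) ((Raw.lam u).subst τ) := by
  intro Θ ρ v w hvw
  have h := h ρ v w hvw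
  refine LR.expand_left b (.beta _ _) (LR.expand_right (.beta _ _) ?_)
  rw [Raw.rename_subst, Raw.rename_subst, Raw.subst_subst, Raw.subst_subst]
  exact h

/-- The substitution used under a binder in the fundamental lemma. -/
theorem LR.lift {Γ Δ Θ : Ctx} {a : Ty} {σ τ : RawSub Γ Δ}
    (h : ∀ ⦃c : Ty⦄ (x : Var Γ c), LR c (σ x) (τ x)) (ρ : Ren Δ Θ) {v w : Raw Θ a}
    (hvw : LR a v w) ⦃c : Ty⦄ (x : Var (a :: Γ) c) :
    LR c (((σ.lift x).rename ρ.lift).subst (RawSub.single v))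
      (((τ.lift x).rename ρ.lift).subst (RawSub.single w)) := by
  cases x with
  | zero => exact hvw
  | succ x =>
    have e : ∀ (σ : RawSub Γ Δ) (v : Raw Θ a),
        ((σ.lift (Var.succ x)).rename ρ.lift).subst (RawSub.single v) = (σ x).rename ρ := by
      intro σ v
      simp only [RawSub.lift, Raw.rename_rename, Raw.subst_rename]
      rw [Raw.rename_eq_subst]
      rfl
    rw [e, e]
    exact (h x).rename ρ

theorem LR.fundamental {Γ : Ctx} {a : Ty} (t : Raw Γ a) : ∀ {Δ : Ctx} {σ τ : RawSub Γ Δ},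
    (∀ ⦃c : Ty⦄ (x : Var Γ c), LR c (σ x) (τ x)) → LR a (t.subst σ) (t.subst τ) := by
  induction t with
  | var x => exact fun h => h x
  | const c => exact fun _ => (LR.reflect_reify _).1 (.const c)
  | lam t ih => exact fun h => LR.lam fun ρ v w hvw => ih (LR.lift h ρ hvw)
  | app t u iht ihu =>
    intro Δ σ τ h
    have h' := iht h Δ (fun _ x => x) _ _ (ihu h)
    rwa [Raw.rename_eq_subst, Raw.rename_eq_subst, Raw.subst_var, Raw.subst_var] at h'

/-- Beta is absorbed by closure under weak head expansion, eta holds because functions are compared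
by their values, and symmetry and transitivity hold because the relation is a partial equivalence.
-/
theorem LR.of_conv {Γ : Ctx} {a : Ty} {t u : Raw Γ a} (hc : Conv t u) :
    ∀ {Δ : Ctx} {σ τ : RawSub Γ Δ}, (∀ ⦃c : Ty⦄ (x : Var Γ c), LR c (σ x) (τ x)) →
      LR a (t.subst σ) (u.subst τ) := by
  induction hc with
  | refl t => exact fun h => LR.fundamental t h
  | symm _ ih => exact fun h => LR.symm _ (ih fun _ x => LR.symm _ (h x))
  | trans _ _ ih₁ ih₂ =>
    intro Δ σ τ h
    -- The second conversion is used under `τ` on both sides, so `τ` has to be related to itself.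
    exact LR.trans _ (ih₁ h) (ih₂ fun _ x => LR.trans _ (LR.symm _ (h x)) (h x))
  | lam _ ih => exact fun h => LR.lam fun ρ v w hvw => ih (LR.lift h ρ hvw)
  | app _ _ iht ihu =>
    intro Δ σ τ h
    have h' := iht h Δ (fun _ x => x) _ _ (ihu h)
    rwa [Raw.rename_eq_subst, Raw.rename_eq_subst, Raw.subst_var, Raw.subst_var] at h'
  | beta t u =>
    intro Δ σ τ h
    refine LR.expand_left _ (.beta _ _) ?_
    rw [Raw.subst_subst, Raw.subst_subst]
    refine LR.fundamental t fun c x => ?_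
    cases x with
    | zero => exact LR.fundamental u h
    | succ x =>
      simp only [RawSub.lift, Raw.subst_rename]
      exact (Raw.subst_var (σ x)).symm ▸ h x
  | @eta Γ a b t =>
    intro Δ σ τ h Θ ρ v w hvw
    refine LR.expand_left _ (.beta _ _) ?_
    have h' := LR.fundamental t h Θ ρ v w hvw
    rw [Raw.rename_subst, Raw.subst_subst]
    simp only [Raw.subst, Raw.subst_rename]
    convert h' using 2
    · rw [Raw.rename_subst]
      congr 1
      funext c x
      change ((σ x).rename Ren.shift).subst (fun _ y => RawSub.single v (ρ.lift y)) = _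
      rw [Raw.subst_rename, Raw.rename_eq_subst]
      rfl
    · rfl

theorem Conv.lrBase {Γ : Ctx} {a : Ty} (ha : a.IsBase) {t u : Raw Γ a} (h : Conv t u) :
    LRBase t u := by
  have h' := LR.of_conv h (σ := fun _ x => .var x) (τ := fun _ x => .var x)
    fun c x => (LR.reflect_reify c).1 (.var x)
  rwa [Raw.subst_var, Raw.subst_var, LR_eq_of_isBase ha] at h'

/-- Neutral terms are their own weak head normal forms, so the normal forms supplied by the relation
are the given terms. The hypotheses `hn` and `hm` only express neutrality. -/
theorem Conv.neMatch {Γ : Ctx} {a : Ty} (ha : a.IsBase) {n n' m m' : Raw Γ a} (h : Conv n m)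
    (hn : NeMatch n n') (hm : NeMatch m m') : NeMatch n m := by
  obtain ⟨k, l, hk, hl, h⟩ := h.lrBase ha
  obtain rfl := hk.eq_of_neutral hn
  obtain rfl := hl.eq_of_neutral hm
  exact h

/-! ### Rigid terms -/

/-- A number that identifies the constant. -/
def Const.code : {a : Ty} → Const a → ℕ
  | _, .z => 1 | _, .s => 2 | _, .nil => 3 | _, .cons => 4 | _, .atom => 5 | _, .tt => 6
  | _, .amp => 7 | _, .imp => 8 | _, .forallI => 9 | _, .num => 10 | _, .bool => 11
  | _, .arrow => 12 | _, .zero => 13 | _, .tru => 14 | _, .fls => 15 | _, .succ => 16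
  | _, .pred => 17 | _, .isZero => 18 | _, .cond => 19 | _, .abs => 20 | _, .app => 21
  | _, .fix => 22 | _, .typeof => 23 | _, .natsem => 24 | _, .transone => 25
  | _, .transsem => 26 | _, .value => 27

/-- The code of the head constant of an application; `0` if the head is not a constant. -/
def Raw.headCode : {Γ : Ctx} → {a : Ty} → Raw Γ a → ℕ
  | _, _, .const c => c.code
  | _, _, .app t _ => t.headCode
  | _, _, _ => 0

theorem NeMatch.headCode {Γ : Ctx} {a : Ty} {n m : Raw Γ a} (h : NeMatch n m) :
    n.headCode = m.headCode := by
  induction h with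
  | var x => rfl
  | const c => rfl
  | app _ _ ih => exact ih

open Classical in
/-- The code of the head constant of a rigid term. -/
noncomputable def Tm.headCode {Γ : Ctx} {a : Ty} (t : Tm Γ a) : ℕ :=
  if h : ∃ n : Raw Γ a, NeMatch n n ∧ Quotient.mk (convSetoid Γ a) n = t then
    h.choose.headCode else 0

/-- Convertible neutral terms of base type have the same head, so the choice of a representative is
harmless. -/
theorem Tm.headCode_mk {Γ : Ctx} {a : Ty} (ha : a.IsBase) {n : Raw Γ a} (hn : NeMatch n n) :
    Tm.headCode (Quotient.mk (convSetoid Γ a) n) = n.headCode := by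
  have h : ∃ m : Raw Γ a, NeMatch m m ∧
      Quotient.mk (convSetoid Γ a) m = Quotient.mk (convSetoid Γ a) n := ⟨n, hn, rfl⟩
  unfold Tm.headCode
  rw [dif_pos h]
  have h' : Conv h.choose n := Quotient.exact h.choose_spec.2
  exact (h'.neMatch ha h.choose_spec.1 hn).headCode

theorem Tm.headCode_const {Γ : Ctx} {a : Ty} (ha : a.IsBase) (k : Const a) :
    (Tm.const k : Tm Γ a).headCode = k.code :=
  Tm.headCode_mk ha (.const k)

/-! ### Injectivity and head codes of applied constants -/

section

variable {Γ : Ctx} {a b c d : Ty}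

theorem headCode_ap₁ (k : Const (.arr a b)) (hb : b.IsBase) (t : Tm Γ a) :
    (ap₁ k t).headCode = k.code := by
  induction t using Quotient.ind
  exact Tm.headCode_mk hb (.app (.const k) (.refl _))

theorem headCode_ap₂ (k : Const (.arr a (.arr b c))) (hc : c.IsBase) (t : Tm Γ a) (u : Tm Γ b) :
    (ap₂ k t u).headCode = k.code := by
  induction t using Quotient.ind
  induction u using Quotient.ind
  exact Tm.headCode_mk hc (.app (.app (.const k) (.refl _)) (.refl _))

theorem headCode_ap₃ (k : Const (.arr a (.arr b (.arr c d)))) (hd : d.IsBase) (t : Tm Γ a)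
    (u : Tm Γ b) (v : Tm Γ c) : (ap₃ k t u v).headCode = k.code := by
  induction t using Quotient.ind
  induction u using Quotient.ind
  induction v using Quotient.ind
  exact Tm.headCode_mk hd (.app (.app (.app (.const k) (.refl _)) (.refl _)) (.refl _))

theorem ap₁_inj (k : Const (.arr a b)) (hb : b.IsBase) {t t' : Tm Γ a} :
    ap₁ k t = ap₁ k t' ↔ t = t' := by
  refine ⟨fun h => ?_, fun h => by rw [h]⟩
  induction t using Quotient.ind
  induction t' using Quotient.ind
  cases (Quotient.exact h : Conv _ _).neMatch hb (.app (.const k) (.refl _))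
    (.app (.const k) (.refl _)) with
  | app _ h => exact Quotient.sound h

theorem ap₂_inj (k : Const (.arr a (.arr b c))) (hc : c.IsBase) {t t' : Tm Γ a} {u u' : Tm Γ b} :
    ap₂ k t u = ap₂ k t' u' ↔ t = t' ∧ u = u' := by
  refine ⟨fun h => ?_, fun h => by rw [h.1, h.2]⟩
  induction t using Quotient.ind
  induction t' using Quotient.ind
  induction u using Quotient.ind
  induction u' using Quotient.ind
  cases (Quotient.exact h : Conv _ _).neMatch hc (.app (.app (.const k) (.refl _)) (.refl _))
    (.app (.app (.const k) (.refl _)) (.refl _)) with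
  | app h₁ h₂ =>
    cases h₁ with
    | app _ h₁ => exact ⟨Quotient.sound h₁, Quotient.sound h₂⟩

theorem ap₃_inj (k : Const (.arr a (.arr b (.arr c d)))) (hd : d.IsBase) {t t' : Tm Γ a}
    {u u' : Tm Γ b} {v v' : Tm Γ c} :
    ap₃ k t u v = ap₃ k t' u' v' ↔ t = t' ∧ u = u' ∧ v = v' := by
  refine ⟨fun h => ?_, fun h => by rw [h.1, h.2.1, h.2.2]⟩
  induction t using Quotient.ind
  induction t' using Quotient.ind
  induction u using Quotient.ind
  induction u' using Quotient.ind
  induction v using Quotient.ind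
  induction v' using Quotient.ind
  cases (Quotient.exact h : Conv _ _).neMatch hd
    (.app (.app (.app (.const k) (.refl _)) (.refl _)) (.refl _))
    (.app (.app (.app (.const k) (.refl _)) (.refl _)) (.refl _)) with
  | app h₁ h₃ =>
    cases h₁ with
    | app h₁ h₂ =>
      cases h₁ with
      | app _ h₁ => exact ⟨Quotient.sound h₁, Quotient.sound h₂, Quotient.sound h₃⟩

end

section

variable {Γ : Ctx}

theorem s_inj {I I' : Tm Γ .nt} : s I = s I' ↔ I = I' := ap₁_inj _ (by trivial)
theorem cons_inj {X X' : Tm Γ .atm} {L L' : Tm Γ .lst} :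
    cons X L = cons X' L' ↔ X = X' ∧ L = L' := ap₂_inj _ (by trivial)
theorem atom_inj {A A' : Tm Γ .atm} : atom A = atom A' ↔ A = A' := ap₁_inj _ (by trivial)
theorem amp_inj {B B' C C' : Tm Γ .prp} : amp B C = amp B' C' ↔ B = B' ∧ C = C' :=
  ap₂_inj _ (by trivial)
theorem oimp_inj {A A' : Tm Γ .atm} {B B' : Tm Γ .prp} :
    oimp A B = oimp A' B' ↔ A = A' ∧ B = B' := ap₂_inj _ (by trivial)
theorem oall_inj {B B' : Tm Γ (.arr .i .prp)} : oall B = oall B' ↔ B = B' := ap₁_inj _ (by trivial)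
theorem arrow_inj {T T' U U' : Tm Γ .i} : arrow T U = arrow T' U' ↔ T = T' ∧ U = U' :=
  ap₂_inj _ (by trivial)
theorem succ_inj {M M' : Tm Γ .i} : succ M = succ M' ↔ M = M' := ap₁_inj _ (by trivial)
theorem pred_inj {M M' : Tm Γ .i} : pred M = pred M' ↔ M = M' := ap₁_inj _ (by trivial)
theorem isZero_inj {M M' : Tm Γ .i} : isZero M = isZero M' ↔ M = M' := ap₁_inj _ (by trivial)
theorem cond_inj {M M' N₁ N₁' N₂ N₂' : Tm Γ .i} :
    cond M N₁ N₂ = cond M' N₁' N₂' ↔ M = M' ∧ N₁ = N₁' ∧ N₂ = N₂' := ap₃_inj _ (by trivial)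
theorem abs_inj {T T' : Tm Γ .i} {R R' : Tm Γ (.arr .i .i)} :
    abs T R = abs T' R' ↔ T = T' ∧ R = R' := ap₂_inj _ (by trivial)
theorem app_inj {M M' N N' : Tm Γ .i} : app M N = app M' N' ↔ M = M' ∧ N = N' :=
  ap₂_inj _ (by trivial)
theorem fix_inj {T T' : Tm Γ .i} {R R' : Tm Γ (.arr .i .i)} :
    fix T R = fix T' R' ↔ T = T' ∧ R = R' := ap₂_inj _ (by trivial)
theorem typeof_inj {M M' N N' : Tm Γ .i} : typeof M N = typeof M' N' ↔ M = M' ∧ N = N' :=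
  ap₂_inj _ (by trivial)
theorem natsem_inj {M M' N N' : Tm Γ .i} : natsem M N = natsem M' N' ↔ M = M' ∧ N = N' :=
  ap₂_inj _ (by trivial)
theorem transone_inj {M M' N N' : Tm Γ .i} :
    transone M N = transone M' N' ↔ M = M' ∧ N = N' := ap₂_inj _ (by trivial)
theorem transsem_inj {M M' N N' : Tm Γ .i} :
    transsem M N = transsem M' N' ↔ M = M' ∧ N = N' := ap₂_inj _ (by trivial)
theorem value_inj {M M' : Tm Γ .i} : value M = value M' ↔ M = M' := ap₁_inj _ (by trivial)

theorem headCode_z : (z : Tm Γ .nt).headCode = 1 := Tm.headCode_const (by trivial) _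
theorem headCode_s (I : Tm Γ .nt) : (s I).headCode = 2 := headCode_ap₁ _ (by trivial) _
theorem headCode_nil : (nil : Tm Γ .lst).headCode = 3 := Tm.headCode_const (by trivial) _
theorem headCode_cons (X : Tm Γ .atm) (L : Tm Γ .lst) : (cons X L).headCode = 4 :=
  headCode_ap₂ _ (by trivial) _ _
theorem headCode_atom (A : Tm Γ .atm) : (atom A).headCode = 5 := headCode_ap₁ _ (by trivial) _
theorem headCode_tt : (tt : Tm Γ .prp).headCode = 6 := Tm.headCode_const (by trivial) _
theorem headCode_amp (B C : Tm Γ .prp) : (amp B C).headCode = 7 := headCode_ap₂ _ (by trivial) _ _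
theorem headCode_oimp (A : Tm Γ .atm) (B : Tm Γ .prp) : (oimp A B).headCode = 8 :=
  headCode_ap₂ _ (by trivial) _ _
theorem headCode_oall (B : Tm Γ (.arr .i .prp)) : (oall B).headCode = 9 :=
  headCode_ap₁ _ (by trivial) _
theorem headCode_zero : (zero : Tm Γ .i).headCode = 13 := Tm.headCode_const (by trivial) _
theorem headCode_tru : (tru : Tm Γ .i).headCode = 14 := Tm.headCode_const (by trivial) _
theorem headCode_fls : (fls : Tm Γ .i).headCode = 15 := Tm.headCode_const (by trivial) _
theorem headCode_succ (M : Tm Γ .i) : (succ M).headCode = 16 := headCode_ap₁ _ (by trivial) _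
theorem headCode_pred (M : Tm Γ .i) : (pred M).headCode = 17 := headCode_ap₁ _ (by trivial) _
theorem headCode_isZero (M : Tm Γ .i) : (isZero M).headCode = 18 := headCode_ap₁ _ (by trivial) _
theorem headCode_cond (M N₁ N₂ : Tm Γ .i) : (cond M N₁ N₂).headCode = 19 :=
  headCode_ap₃ _ (by trivial) _ _ _
theorem headCode_abs (T : Tm Γ .i) (R : Tm Γ (.arr .i .i)) : (abs T R).headCode = 20 :=
  headCode_ap₂ _ (by trivial) _ _
theorem headCode_app (M N : Tm Γ .i) : (app M N).headCode = 21 := headCode_ap₂ _ (by trivial) _ _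
theorem headCode_fix (T : Tm Γ .i) (R : Tm Γ (.arr .i .i)) : (fix T R).headCode = 22 :=
  headCode_ap₂ _ (by trivial) _ _
theorem headCode_typeof (M N : Tm Γ .i) : (typeof M N).headCode = 23 :=
  headCode_ap₂ _ (by trivial) _ _
theorem headCode_natsem (M N : Tm Γ .i) : (natsem M N).headCode = 24 :=
  headCode_ap₂ _ (by trivial) _ _
theorem headCode_transone (M N : Tm Γ .i) : (transone M N).headCode = 25 :=
  headCode_ap₂ _ (by trivial) _ _
theorem headCode_transsem (M N : Tm Γ .i) : (transsem M N).headCode = 26 :=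
  headCode_ap₂ _ (by trivial) _ _
theorem headCode_value (M : Tm Γ .i) : (value M).headCode = 27 := headCode_ap₁ _ (by trivial) _

end

/-- The clash rule. It reduces an impossible unification to the comparison of two numerals. -/
theorem Tm.absurd_of_headCode_ne {Γ : Ctx} {a : Ty} {t u : Tm Γ a} (h : t = u)
    (hne : t.headCode ≠ u.headCode) : False :=
  hne (congrArg Tm.headCode h)

/-! ### Substitution in terms and formulas -/

theorem Raw.subst_congr {Γ : Ctx} {a : Ty} (t : Raw Γ a) : ∀ {Δ : Ctx} {σ τ : RawSub Γ Δ},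
    (∀ ⦃c : Ty⦄ (x : Var Γ c), Conv (σ x) (τ x)) → Conv (t.subst σ) (t.subst τ) := by
  induction t with
  | var x => exact fun h => h x
  | const c => exact fun _ => .refl _
  | lam t ih =>
    intro Δ σ τ h
    refine .lam (ih fun c x => ?_)
    cases x with
    | zero => exact .refl _
    | succ x => exact (h x).rename _
  | app t u iht ihu => exact fun h => .app (iht h) (ihu h)

/-- The term of a raw term. -/
abbrev Raw.toTm {Γ : Ctx} {a : Ty} (t : Raw Γ a) : Tm Γ a := Quotient.mk (convSetoid Γ a) t

/-- Frees substitution from the representatives picked by `Quotient.out`: any representatives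
compute it. The laws of substitution are transferred from raw terms through this. -/
theorem Tm.subst_mk {Γ Δ : Ctx} {a : Ty} (σ : Sub Γ Δ) (τ : RawSub Γ Δ)
    (h : ∀ ⦃c : Ty⦄ (x : Var Γ c), (τ x).toTm = σ x) (t : Raw Γ a) :
    t.toTm.subst σ = (t.subst τ).toTm := by
  refine Quotient.sound (Raw.subst_congr t fun c x => ?_)
  exact Quotient.exact ((Quotient.out_eq (s := convSetoid Δ c) (σ x)).trans (h x).symm)

/-- Representatives of the terms of a substitution. -/
noncomputable def Sub.out {Γ Δ : Ctx} (σ : Sub Γ Δ) : RawSub Γ Δ :=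
  fun c x => Quotient.out (s := convSetoid Δ c) (σ x)

theorem Sub.out_toTm {Γ Δ : Ctx} (σ : Sub Γ Δ) ⦃c : Ty⦄ (x : Var Γ c) : (σ.out x).toTm = σ x :=
  Quotient.out_eq (s := convSetoid Δ c) (σ x)

theorem Sub.out_lift_toTm {Γ Δ : Ctx} {b : Ty} (σ : Sub Γ Δ) ⦃c : Ty⦄ (x : Var (b :: Γ) c) :
    (σ.out.lift x).toTm = σ.lift x := by
  cases x with
  | zero => rfl
  | succ x =>
    change Tm.rename Ren.shift (σ.out x).toTm = _
    rw [σ.out_toTm]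
    rfl

/-- The identity substitution. -/
def Sub.id {Γ : Ctx} : Sub Γ Γ := fun _ x => .var x

/-- Extension of a substitution by a term for the variable of index `0`. -/
def Sub.cons {Γ Δ : Ctx} {b : Ty} (t : Tm Δ b) (σ : Sub Γ Δ) : Sub (b :: Γ) Δ
  | _, .zero => t
  | _, .succ x => σ x

/-- The substitution with empty domain. -/
def Sub.empty {Δ : Ctx} : Sub [] Δ := fun _ x => nomatch x

section

variable {Γ Δ Θ : Ctx} {a b c d e : Ty}

theorem Tm.subst_var (σ : Sub Γ Δ) (x : Var Γ a) : (Tm.var x).subst σ = σ x :=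
  Tm.subst_mk σ σ.out σ.out_toTm (.var x) |>.trans (σ.out_toTm x)

theorem Tm.subst_const (σ : Sub Γ Δ) (k : Const a) : (Tm.const k).subst σ = .const k := rfl

theorem Tm.subst_app (σ : Sub Γ Δ) (t : Tm Γ (.arr a b)) (u : Tm Γ a) :
    (t.app u).subst σ = (t.subst σ).app (u.subst σ) := by
  induction t using Quotient.ind
  induction u using Quotient.ind
  rfl

theorem Tm.subst_lam (σ : Sub Γ Δ) (t : Tm (a :: Γ) b) :
    t.lam.subst σ = (t.subst σ.lift).lam := by
  induction t using Quotient.ind with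
  | _ t =>
    have h := Tm.subst_mk σ.lift σ.out.lift σ.out_lift_toTm t
    change _ = Tm.lam (Tm.subst σ.lift t.toTm)
    rw [h]
    exact Tm.subst_mk σ σ.out σ.out_toTm (.lam t)

theorem Tm.subst_subst (σ : Sub Γ Δ) (τ : Sub Δ Θ) (t : Tm Γ a) :
    (t.subst σ).subst τ = t.subst (σ.comp τ) := by
  induction t using Quotient.ind with
  | _ t =>
    change (t.toTm.subst σ).subst τ = t.toTm.subst _
    rw [Tm.subst_mk σ _ σ.out_toTm, Tm.subst_mk τ _ τ.out_toTm,
      Tm.subst_mk (σ.comp τ) (fun _ x => (σ.out x).subst τ.out), Raw.subst_subst]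
    intro c x
    rw [← Tm.subst_mk τ _ τ.out_toTm, σ.out_toTm]
    rfl

theorem Tm.subst_id (t : Tm Γ a) : t.subst Sub.id = t := by
  induction t using Quotient.ind with
  | _ t =>
    change t.toTm.subst _ = t.toTm
    rw [Tm.subst_mk Sub.id (fun _ x => .var x) fun _ _ => rfl, Raw.subst_var]

theorem Tm.weaken_eq_subst (t : Tm Γ a) : (t.weaken : Tm (b :: Γ) a) = t.subst Sub.shift := by
  induction t using Quotient.ind with
  | _ t =>
    change (t.rename Ren.shift).toTm = t.toTm.subst _
    rw [Tm.subst_mk Sub.shift (fun _ x => .var (.succ x)) fun _ _ => rfl, Raw.rename_eq_subst]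
    rfl

theorem Sub.shift_comp_lift (σ : Sub Γ Δ) :
    Sub.shift.comp (σ.lift (b := b)) = σ.comp Sub.shift := by
  funext c x
  simp only [Sub.comp, Sub.shift, Tm.subst_var, Sub.lift]
  exact Tm.weaken_eq_subst _

theorem Sub.shift_comp_cons (σ : Sub Γ Δ) (t : Tm Δ b) : Sub.shift.comp (Sub.cons t σ) = σ := by
  funext c x
  simp only [Sub.comp, Sub.shift, Tm.subst_var]
  rfl

theorem Sub.single_eq_cons (t : Tm Γ b) : Sub.single t = Sub.cons t Sub.id := by
  funext c x
  cases x <;> rfl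

theorem Tm.weaken_subst_lift (σ : Sub Γ Δ) (t : Tm Γ a) :
    (t.weaken (b := b)).subst σ.lift = (t.subst σ).weaken := by
  rw [Tm.weaken_eq_subst, Tm.weaken_eq_subst, Tm.subst_subst, Tm.subst_subst, Sub.shift_comp_lift]

theorem Tm.weaken_subst_cons (σ : Sub Γ Δ) (t : Tm Γ a) (u : Tm Δ b) :
    t.weaken.subst (Sub.cons u σ) = t.subst σ := by
  rw [Tm.weaken_eq_subst, Tm.subst_subst, Sub.shift_comp_cons]

theorem Tm.lam_app (t : Tm (a :: Γ) b) (u : Tm Γ a) : t.lam.app u = t.subst (Sub.single u) := by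
  induction t using Quotient.ind with
  | _ t =>
    induction u using Quotient.ind with
    | _ u =>
      refine (Quotient.sound (Conv.beta t u)).trans ?_
      refine (Tm.subst_mk (Sub.single u.toTm) (RawSub.single u) (fun c x => ?_) t).symm
      cases x <;> rfl

theorem Sub.comp_id (σ : Sub Γ Δ) : σ.comp Sub.id = σ := by
  funext c x
  exact Tm.subst_id _

theorem Sub.id_comp (σ : Sub Γ Δ) : Sub.id.comp σ = σ := by
  funext c x
  exact Tm.subst_var σ x

theorem Sub.lift_id : (Sub.id.lift : Sub (b :: Γ) (b :: Γ)) = Sub.id := by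
  funext c x
  cases x with
  | zero => rfl
  | succ x => exact (Tm.weaken_eq_subst _).trans (Tm.subst_var _ _)

theorem Sub.lift_comp (σ : Sub Γ Δ) (τ : Sub Δ Θ) :
    (σ.comp τ).lift (b := b) = σ.lift.comp τ.lift := by
  funext c x
  cases x with
  | zero => exact (Tm.subst_var (τ.lift (b := b)) .zero).symm
  | succ x => exact (Tm.weaken_subst_lift τ (σ x)).symm

theorem Sub.lift_comp_cons (σ : Sub Γ Δ) (τ : Sub Δ Θ) (t : Tm Θ b) :
    σ.lift.comp (Sub.cons t τ) = Sub.cons t (σ.comp τ) := by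
  funext c x
  cases x with
  | zero => exact Tm.subst_var _ _
  | succ x => exact Tm.weaken_subst_cons τ (σ x) t

theorem Sub.cons_comp (σ : Sub Γ Δ) (τ : Sub Δ Θ) (t : Tm Δ b) :
    (Sub.cons t σ).comp τ = Sub.cons (t.subst τ) (σ.comp τ) := by
  funext c x
  cases x <;> rfl

theorem Sub.single_comp (σ : Sub Γ Δ) (t : Tm Γ b) :
    (Sub.single t).comp σ = σ.lift.comp (Sub.single (t.subst σ)) := by
  rw [Sub.single_eq_cons, Sub.single_eq_cons, Sub.cons_comp, Sub.lift_comp_cons, Sub.id_comp,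
    Sub.comp_id]

/-! Formulas -/

theorem Atom.subst_subst (σ : Sub Γ Δ) (τ : Sub Δ Θ) (A : Atom Γ) :
    (A.subst σ).subst τ = A.subst (σ.comp τ) := by
  cases A <;> simp only [Atom.subst, Tm.subst_subst]

theorem Atom.subst_id (A : Atom Γ) : A.subst Sub.id = A := by
  cases A <;> simp only [Atom.subst, Tm.subst_id]

theorem Fm.subst_subst (B : Fm Γ) : ∀ {Δ Θ : Ctx} (σ : Sub Γ Δ) (τ : Sub Δ Θ),
    (B.subst σ).subst τ = B.subst (σ.comp τ) := by
  induction B with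
  | nat I => intros; simp only [Fm.subst, Tm.subst_subst]
  | atom A => intros; simp only [Fm.subst, Atom.subst_subst]
  | bot => intros; rfl
  | top => intros; rfl
  | and B C ihB ihC => intros; simp only [Fm.subst, ihB, ihC]
  | or B C ihB ihC => intros; simp only [Fm.subst, ihB, ihC]
  | imp B C ihB ihC => intros; simp only [Fm.subst, ihB, ihC]
  | all a B ih => intros; simp only [Fm.subst, ih, Sub.lift_comp]
  | ex a B ih => intros; simp only [Fm.subst, ih, Sub.lift_comp]

theorem Fm.subst_id (B : Fm Γ) : B.subst Sub.id = B := by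
  induction B with
  | nat I => simp only [Fm.subst, Tm.subst_id]
  | atom A => simp only [Fm.subst, Atom.subst_id]
  | bot => rfl
  | top => rfl
  | and B C ihB ihC => simp only [Fm.subst, ihB, ihC]
  | or B C ihB ihC => simp only [Fm.subst, ihB, ihC]
  | imp B C ihB ihC => simp only [Fm.subst, ihB, ihC]
  | all a B ih => simp only [Fm.subst, Sub.lift_id, ih]
  | ex a B ih => simp only [Fm.subst, Sub.lift_id, ih]

theorem Fm.subst_weaken (B : Fm Γ) (σ : Sub Γ Δ) :
    (B.weaken (a := a)).subst σ.lift = (B.subst σ).weaken := by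
  rw [Fm.weaken, Fm.weaken, Fm.subst_subst, Fm.subst_subst, Sub.shift_comp_lift]

theorem Fm.subst_inst (B : Fm (a :: Γ)) (σ : Sub Γ Δ) (t : Tm Γ a) :
    (B.inst t).subst σ = (B.subst σ.lift).inst (t.subst σ) := by
  rw [Fm.inst, Fm.inst, Fm.subst_subst, Fm.subst_subst, Sub.single_comp]

theorem Fm.subst_lift_inst (B : Fm (a :: Γ)) (σ : Sub Γ Δ) (t : Tm Δ a) :
    (B.subst σ.lift).inst t = B.subst (Sub.cons t σ) := by
  rw [Fm.inst, Sub.single_eq_cons, Fm.subst_subst, Sub.lift_comp_cons, Sub.comp_id]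

/-- Lets an eigenvariable premise be read as an instance by a term, namely the new variable. -/
theorem Fm.shift_inst_var (B : Fm (a :: Γ)) :
    (B.subst (Sub.lift Sub.shift)).inst (Tm.var .zero) = B := by
  rw [Fm.subst_lift_inst]
  refine Eq.trans ?_ B.subst_id
  congr 1
  funext c x
  cases x <;> rfl

end

/-! ### Structural rules -/

section

variable {D : Definition} {Γ Δ : Ctx}

theorem Der.weaken {H : Multiset (Fm Γ)} {C : Fm Γ} (h : Der D H C) :
    ∀ H' : Multiset (Fm Γ), Der D (H + H') C := by
  induction h with
  | botL => intro K; rw [Multiset.cons_add]; exact .botL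
  | topR => intro K; exact .topR
  | andL₁ _ ih => intro K; rw [Multiset.cons_add]; exact .andL₁ (by simpa using ih K)
  | andL₂ _ ih => intro K; rw [Multiset.cons_add]; exact .andL₂ (by simpa using ih K)
  | andR _ _ ih₁ ih₂ => intro K; exact .andR (ih₁ K) (ih₂ K)
  | orL _ _ ih₁ ih₂ =>
    intro K
    rw [Multiset.cons_add]
    exact .orL (by simpa using ih₁ K) (by simpa using ih₂ K)
  | orR₁ _ ih => intro K; exact .orR₁ (ih K)
  | orR₂ _ ih => intro K; exact .orR₂ (ih K)
  | impL _ _ ih₁ ih₂ =>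
    intro K
    rw [Multiset.cons_add]
    exact .impL (ih₁ K) (by simpa using ih₂ K)
  | impR _ ih => intro K; exact .impR (by simpa using ih K)
  | allL t _ ih => intro K; rw [Multiset.cons_add]; exact .allL t (by simpa using ih K)
  | allR _ ih => intro K; exact .allR (by simpa using ih (K.map Fm.weaken))
  | exL _ ih =>
    intro K
    rw [Multiset.cons_add]
    exact .exL (by simpa using ih (K.map Fm.weaken))
  | exR t _ ih => intro K; exact .exR t (ih K)
  | initAtom => intro K; rw [Multiset.cons_add]; exact .initAtom
  | initNat => intro K; rw [Multiset.cons_add]; exact .initNat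
  | contrL _ ih => intro K; rw [Multiset.cons_add]; exact .contrL (by simpa using ih K)
  | cut _ _ ih₁ ih₂ =>
    intro K
    rw [add_assoc]
    exact .cut (by simpa using ih₁ 0) (by simpa using ih₂ K)
  | natRzero => intro K; exact .natRzero
  | natRsucc _ ih => intro K; exact .natRsucc (ih K)
  | natL B h₁ h₂ _ _ _ ih =>
    intro K
    rw [Multiset.cons_add]
    exact .natL B h₁ h₂ (by simpa using ih K)
  | defR c hc θ hA _ ih => intro K; exact .defR c hc θ hA (ih K)
  | defL S hS _ ih =>
    intro K
    rw [Multiset.cons_add]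
    refine .defL S hS fun c hc θ hθ => ?_
    simpa using ih c hc θ hθ (K.map (Fm.subst θ.left))

theorem Fm.map_weaken_subst {a : Ty} (H : Multiset (Fm Γ)) (σ : Sub Γ Δ) :
    (H.map (Fm.weaken (a := a))).map (Fm.subst σ.lift) =
      (H.map (Fm.subst σ)).map Fm.weaken := by
  simp only [Multiset.map_map, Function.comp_def, Fm.subst_weaken]

theorem Der.subst {H : Multiset (Fm Γ)} {C : Fm Γ} (h : Der D H C) :
    ∀ {Δ : Ctx} (σ : Sub Γ Δ), Der D (H.map (Fm.subst σ)) (C.subst σ) := by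
  induction h with
  | botL => intro Δ σ; rw [Multiset.map_cons]; exact .botL
  | topR => intro Δ σ; exact .topR
  | andL₁ _ ih => intro Δ σ; rw [Multiset.map_cons]; exact .andL₁ (by simpa using ih σ)
  | andL₂ _ ih => intro Δ σ; rw [Multiset.map_cons]; exact .andL₂ (by simpa using ih σ)
  | andR _ _ ih₁ ih₂ => intro Δ σ; exact .andR (ih₁ σ) (ih₂ σ)
  | orL _ _ ih₁ ih₂ =>
    intro Δ σ
    rw [Multiset.map_cons]
    exact .orL (by simpa using ih₁ σ) (by simpa using ih₂ σ)
  | orR₁ _ ih => intro Δ σ; exact .orR₁ (ih σ)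
  | orR₂ _ ih => intro Δ σ; exact .orR₂ (ih σ)
  | impL _ _ ih₁ ih₂ =>
    intro Δ σ
    rw [Multiset.map_cons]
    exact .impL (ih₁ σ) (by simpa using ih₂ σ)
  | impR _ ih => intro Δ σ; exact .impR (by simpa using ih σ)
  | allL t _ ih =>
    intro Δ σ
    rw [Multiset.map_cons]
    refine .allL (t.subst σ) ?_
    rw [← Fm.subst_inst, ← Multiset.map_cons]
    exact ih σ
  | allR _ ih =>
    intro Δ σ
    refine .allR ?_
    rw [← Fm.map_weaken_subst]
    exact ih σ.lift
  | exL _ ih =>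
    intro Δ σ
    rw [Multiset.map_cons]
    refine .exL ?_
    rw [← Fm.map_weaken_subst, ← Fm.subst_weaken, ← Multiset.map_cons]
    exact ih σ.lift
  | exR t _ ih =>
    intro Δ σ
    refine .exR (t.subst σ) ?_
    rw [← Fm.subst_inst]
    exact ih σ
  | initAtom => intro Δ σ; rw [Multiset.map_cons]; exact .initAtom
  | initNat => intro Δ σ; rw [Multiset.map_cons]; exact .initNat
  | contrL _ ih => intro Δ σ; rw [Multiset.map_cons]; exact .contrL (by simpa using ih σ)
  | cut _ _ ih₁ ih₂ =>
    intro Δ σ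
    rw [Multiset.map_add]
    exact .cut (ih₁ σ) (by simpa using ih₂ σ)
  | natRzero => intro Δ σ; exact .natRzero
  | natRsucc _ ih =>
    intro Δ σ
    simp only [Fm.subst, Tm.subst_app, Tm.subst_const]
    exact .natRsucc (ih σ)
  | natL B _ _ _ ih₁ ih₂ ih₃ =>
    intro Δ σ
    rw [Multiset.map_cons]
    refine .natL (B.subst σ.lift) ?_ ?_ ?_
    · have h := ih₁ σ
      rw [Fm.subst_inst] at h
      exact h
    · have h := ih₂ σ.lift
      rw [Fm.subst_inst, Fm.subst_subst, ← Sub.lift_comp, Sub.shift_comp_lift, Sub.lift_comp,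
        ← Fm.subst_subst, Tm.subst_app] at h
      simpa [v0, Tm.subst_var, Tm.subst_const, Sub.lift] using h
    · rw [← Fm.subst_inst, ← Multiset.map_cons]
      exact ih₃ σ
  | defR c hc θ hA _ ih =>
    intro Δ σ
    refine .defR c hc (θ.comp σ) (by rw [hA, Atom.subst_subst]) ?_
    rw [← Fm.subst_subst]
    exact ih σ
  | @defL Γ H A C S hS _ ih =>
    intro Δ σ
    rw [Multiset.map_cons]
    -- A unifier of `A.subst σ` with a clause head, composed with `σ`, is a unifier of `A`. By
    -- completeness it factors through some `θ` in `S`, and the premise for `θ`, substituted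
    -- further, is the one required.
    refine .defL (fun c => Set.univ) (fun c _ ρ =>
      ⟨ρ, trivial, Sub.id, (Sub.comp_id _).symm, (Sub.comp_id _).symm⟩) fun c hc ρ _ => ?_
    obtain ⟨θ, hθ, τ, h₁, h₂⟩ := hS c hc ⟨ρ.cod, σ.comp ρ.left, ρ.right, by
      rw [← Atom.subst_subst]; exact ρ.unifies⟩
    simp only at h₁ h₂
    have h := ih c hc θ hθ τ
    simp only [Multiset.map_cons, Multiset.map_map, Function.comp_def, Fm.subst_subst, ← h₁,
      ← h₂] at h ⊢
    exact h

theorem Der.contract {H K : Multiset (Fm Γ)} {C : Fm Γ} (h : Der D (K + (K + H)) C) :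
    Der D (K + H) C := by
  induction K using Multiset.induction_on generalizing H with
  | empty => simpa using h
  | cons B K ih =>
    rw [Multiset.cons_add]
    refine .contrL ?_
    rw [← Multiset.add_cons, ← Multiset.add_cons]
    refine ih ?_
    convert h using 1
    simp only [Multiset.cons_add, Multiset.add_cons]

/-- The primitive cut splits the antecedent; contraction lets both premises use all of it. The
elimination rules below are this cut against a left rule. -/
theorem Der.cut_shared {H : Multiset (Fm Γ)} {B C : Fm Γ} (h : Der D H B)
    (h' : Der D (B ::ₘ H) C) : Der D H C := by
  have h := Der.contract (H := 0) (K := H) (C := C) (D := D) (by simpa using Der.cut h h')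
  simpa using h

theorem Der.init (B : Fm Γ) : ∀ H : Multiset (Fm Γ), Der D (B ::ₘ H) B := by
  induction B with
  | nat I => exact fun _ => .initNat
  | atom A => exact fun _ => .initAtom
  | bot => exact fun _ => .botL
  | top => exact fun _ => .topR
  | and B C ihB ihC => exact fun H => .andR (.andL₁ (ihB H)) (.andL₂ (ihC H))
  | or B C ihB ihC => exact fun H => .orL (.orR₁ (ihB H)) (.orR₂ (ihC H))
  | imp B C ihB ihC =>
    intro H
    refine .impR ?_
    rw [Multiset.cons_swap]
    exact .impL (ihB H) (ihC _)
  | all a B ih =>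
    intro H
    refine .allR ?_
    rw [Multiset.map_cons]
    refine .allL (Tm.var .zero) ?_
    rw [Fm.shift_inst_var]
    exact ih _
  | ex a B ih =>
    intro H
    refine .exL (.exR (Tm.var .zero) ?_)
    rw [Fm.shift_inst_var]
    exact ih _

end

/-! ### Kripke-style rules -/

section

variable {D : Definition} {Γ Δ Θ : Ctx}

/-- What is derivable from `H` is, after the substitution `σ`, derivable from `H'`. -/
def Ext (D : Definition) (σ : Sub Γ Δ) (H : Multiset (Fm Γ)) (H' : Multiset (Fm Δ)) : Prop :=
  ∀ ⦃B : Fm Γ⦄, Der D H B → Der D H' (B.subst σ)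

theorem Ext.map_cons (σ : Sub Γ Δ) (H : Multiset (Fm Γ)) (F : Fm Δ) :
    Ext D σ H (F ::ₘ H.map (Fm.subst σ)) := by
  intro B h
  have h := (h.subst σ).weaken {F}
  rwa [add_comm, Multiset.singleton_add] at h

theorem Ext.map (σ : Sub Γ Δ) (H : Multiset (Fm Γ)) : Ext D σ H (H.map (Fm.subst σ)) :=
  fun _ h => h.subst σ

theorem Ext.id_cons (H : Multiset (Fm Γ)) (F : Fm Γ) : Ext D Sub.id H (F ::ₘ H) := by
  intro B h
  have h := h.weaken {F}
  rwa [add_comm, Multiset.singleton_add, ← B.subst_id] at h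

/-- The hypothesis is handed over as a derivable formula rather than as an entry of the antecedent,
so that arguments can run in natural-deduction style. Only the world `B ::ₘ H` is needed. -/
theorem Der.imp_intro {H : Multiset (Fm Γ)} {B C : Fm Γ}
    (k : ∀ H' : Multiset (Fm Γ), (∀ ⦃F : Fm Γ⦄, Der D H F → Der D H' F) → Der D H' B →
      Der D H' C) : Der D H (.imp B C) := by
  refine .impR (k _ (fun F h => ?_) (Der.init B H))
  have h := Ext.id_cons H B h
  rwa [Fm.subst_id] at h

theorem Der.imp_elim {H : Multiset (Fm Γ)} {B C : Fm Γ} (h : Der D H (.imp B C))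
    (hB : Der D H B) : Der D H C :=
  h.cut_shared (.impL hB (.init C H))

theorem Der.and_left {H : Multiset (Fm Γ)} {B C : Fm Γ} (h : Der D H (.and B C)) : Der D H B :=
  h.cut_shared (.andL₁ (.init B H))

theorem Der.and_right {H : Multiset (Fm Γ)} {B C : Fm Γ} (h : Der D H (.and B C)) : Der D H C :=
  h.cut_shared (.andL₂ (.init C H))

theorem Der.all_intro {H : Multiset (Fm Γ)} {a : Ty} {B : Fm (a :: Γ)}
    (k : ∀ (Δ : Ctx) (σ : Sub Γ Δ) (H' : Multiset (Fm Δ)), Ext D σ H H' → ∀ t : Tm Δ a,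
      Der D H' (B.subst (Sub.cons t σ))) : Der D H (.all a B) := by
  have h := k _ Sub.shift _ (Ext.map Sub.shift H) (Tm.var .zero)
  rw [← Fm.subst_lift_inst, Fm.shift_inst_var] at h
  exact .allR h

theorem Der.all_elim {H : Multiset (Fm Γ)} {a : Ty} {B : Fm (a :: Γ)} (h : Der D H (.all a B))
    (t : Tm Γ a) : Der D H (B.subst (Sub.cons t Sub.id)) := by
  rw [← Sub.single_eq_cons]
  exact h.cut_shared (.allL t (.init _ H))

theorem Der.ex_intro {H : Multiset (Fm Γ)} {a : Ty} {B : Fm (a :: Γ)} (t : Tm Γ a)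
    (h : Der D H (B.subst (Sub.cons t Sub.id))) : Der D H (.ex a B) := by
  rw [← Sub.single_eq_cons] at h
  exact .exR t h

theorem Der.ex_elim {H : Multiset (Fm Γ)} {a : Ty} {B : Fm (a :: Γ)} {C : Fm Γ}
    (h : Der D H (.ex a B))
    (k : ∀ (Δ : Ctx) (σ : Sub Γ Δ) (H' : Multiset (Fm Δ)), Ext D σ H H' → ∀ t : Tm Δ a,
      Der D H' (B.subst (Sub.cons t σ)) → Der D H' (C.subst σ)) : Der D H C := by
  refine h.cut_shared (.exL (k _ Sub.shift _ (Ext.map_cons Sub.shift H B) (Tm.var .zero) ?_))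
  rw [← Fm.subst_lift_inst, Fm.shift_inst_var]
  exact .init _ _

/-- The set of all unifiers is complete, since each factors through itself by the identity. What
remains is an arbitrary unifier, that is, an equation between an instance of `A` and an instance of
a clause head. -/
theorem Der.def_elim {H : Multiset (Fm Γ)} {A : Atom Γ} {C : Fm Γ} (h : Der D H (.atom A))
    (k : ∀ (Δ : Ctx) (σ : Sub Γ Δ) (H' : Multiset (Fm Δ)), Ext D σ H H' → ∀ c ∈ D.clauses,
      ∀ τ : Sub c.ctx Δ, A.subst σ = c.head.subst τ → Der D H' (c.body.subst τ) →
        Der D H' (C.subst σ)) : Der D H C := by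
  refine h.cut_shared (.defL (fun _ => Set.univ) (fun c _ ρ =>
    ⟨ρ, trivial, Sub.id, (Sub.comp_id _).symm, (Sub.comp_id _).symm⟩) fun c hc θ _ => ?_)
  exact k _ θ.left _ (Ext.map_cons _ _ _) c hc θ.right θ.unifies (.init _ _)

/-- Induction over the natural numbers, for an invariant that is stable under substitution. -/
theorem Der.nat_induction (P : ∀ {Γ : Ctx}, Tm Γ .nt → Fm Γ)
    (hP : ∀ {Γ Δ : Ctx} (σ : Sub Γ Δ) (I : Tm Γ .nt), (P I).subst σ = P (I.subst σ))
    (hz : ∀ {Γ : Ctx} (H : Multiset (Fm Γ)), Der D H (P z))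
    (hs : ∀ {Γ : Ctx} (H : Multiset (Fm Γ)) (I : Tm Γ .nt), Der D H (.nat I) → Der D H (P I) →
      Der D H (P (s I)))
    {H : Multiset (Fm Γ)} {I : Tm Γ .nt} (h : Der D H (.nat I)) : Der D H (P I) := by
  have e : ∀ {Δ : Ctx} (I : Tm Δ .nt) (σ : Sub Γ Δ),
      (Fm.and (.nat v0) (P v0)).subst (Sub.cons I σ) = .and (.nat I) (P I) := by
    intro Δ I σ
    simp only [Fm.subst, hP, v0, Tm.subst_var, Sub.cons]
  -- The first two premises of `natL` have no side formulas, hence `hz` and `hs` cannot rely on `H`.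
  -- The conjunct `nat` strengthens the invariant so that `nat I` is available in the step.
  refine h.cut_shared (.natL (.and (.nat v0) (P v0)) ?_ ?_ ?_)
  · rw [Fm.inst, Sub.single_eq_cons, e]
    exact .andR .natRzero (hz _)
  · rw [Fm.subst_lift_inst, e]
    exact .andR (.natRsucc (Der.init _ 0).and_left)
      (hs _ _ (Der.init _ 0).and_left (Der.init _ 0).and_right)
  · rw [Fm.inst, Sub.single_eq_cons, e]
    exact (Der.init _ _).and_right

end

/-! ### Substitution in the terms of the signature -/

section

variable {Γ Δ : Ctx} {a b c d e f : Ty} (σ : Sub Γ Δ)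

theorem v0_subst_cons (t : Tm Δ a) : v0.subst (Sub.cons t σ) = t := Tm.subst_var _ _
theorem v0_subst_lift : (v0 : Tm (a :: Γ) a).subst σ.lift = v0 := Tm.subst_var (σ.lift (b := a)) _
theorem v1_subst_cons (σ : Sub (b :: Γ) Δ) (t : Tm Δ a) :
    v1.subst (Sub.cons t σ) = v0.subst σ :=
  (Tm.subst_var _ _).trans (Tm.subst_var σ .zero).symm
theorem v2_subst_cons (σ : Sub (b :: c :: Γ) Δ) (t : Tm Δ a) :
    v2.subst (Sub.cons t σ) = v1.subst σ :=
  (Tm.subst_var _ _).trans (Tm.subst_var σ _).symm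
theorem v3_subst_cons (σ : Sub (b :: c :: d :: Γ) Δ) (t : Tm Δ a) :
    v3.subst (Sub.cons t σ) = v2.subst σ :=
  (Tm.subst_var _ _).trans (Tm.subst_var σ _).symm
theorem v4_subst_cons (σ : Sub (b :: c :: d :: e :: Γ) Δ) (t : Tm Δ a) :
    v4.subst (Sub.cons t σ) = v3.subst σ :=
  (Tm.subst_var _ _).trans (Tm.subst_var σ _).symm
theorem v1_subst_lift (σ : Sub (b :: Γ) Δ) :
    (v1 : Tm (a :: b :: Γ) b).subst σ.lift = (v0.subst σ).weaken :=
  (Tm.subst_var (σ.lift (b := a)) _).trans (congrArg Tm.weaken (Tm.subst_var σ .zero).symm)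
theorem v2_subst_lift (σ : Sub (b :: c :: Γ) Δ) :
    (v2 : Tm (a :: b :: c :: Γ) c).subst σ.lift = (v1.subst σ).weaken :=
  (Tm.subst_var (σ.lift (b := a)) _).trans (congrArg Tm.weaken (Tm.subst_var σ _).symm)
theorem v3_subst_lift (σ : Sub (b :: c :: d :: Γ) Δ) :
    (v3 : Tm (a :: b :: c :: d :: Γ) d).subst σ.lift = (v2.subst σ).weaken :=
  (Tm.subst_var (σ.lift (b := a)) _).trans (congrArg Tm.weaken (Tm.subst_var σ _).symm)

theorem v0_weaken : ((v0 : Tm (a :: Γ) a).weaken : Tm (b :: a :: Γ) a) = v1 := rfl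
theorem v1_weaken : ((v1 : Tm (a :: b :: Γ) b).weaken : Tm (c :: a :: b :: Γ) b) = v2 := rfl
theorem v2_weaken :
    ((v2 : Tm (a :: b :: c :: Γ) c).weaken : Tm (d :: a :: b :: c :: Γ) c) = v3 := rfl

theorem ap₁_subst (k : Const (.arr a b)) (t : Tm Γ a) : (ap₁ k t).subst σ = ap₁ k (t.subst σ) :=
  Tm.subst_app _ _ _
theorem ap₂_subst (k : Const (.arr a (.arr b c))) (t : Tm Γ a) (u : Tm Γ b) :
    (ap₂ k t u).subst σ = ap₂ k (t.subst σ) (u.subst σ) := by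
  rw [ap₂, Tm.subst_app, ap₁_subst]; rfl
theorem ap₃_subst (k : Const (.arr a (.arr b (.arr c d)))) (t : Tm Γ a) (u : Tm Γ b)
    (v : Tm Γ c) : (ap₃ k t u v).subst σ = ap₃ k (t.subst σ) (u.subst σ) (v.subst σ) := by
  rw [ap₃, Tm.subst_app, ap₂_subst]; rfl

theorem z_subst : (z : Tm Γ .nt).subst σ = z := rfl
theorem nil_subst : (nil : Tm Γ .lst).subst σ = nil := rfl
theorem tt_subst : (tt : Tm Γ .prp).subst σ = tt := rfl
theorem num_subst : (num : Tm Γ .i).subst σ = num := rfl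
theorem bool_subst : (bool : Tm Γ .i).subst σ = bool := rfl
theorem zero_subst : (zero : Tm Γ .i).subst σ = zero := rfl
theorem tru_subst : (tru : Tm Γ .i).subst σ = tru := rfl
theorem fls_subst : (fls : Tm Γ .i).subst σ = fls := rfl
theorem s_subst (I : Tm Γ .nt) : (s I).subst σ = s (I.subst σ) := ap₁_subst _ _ _
theorem cons_subst (X : Tm Γ .atm) (L : Tm Γ .lst) :
    (cons X L).subst σ = cons (X.subst σ) (L.subst σ) := ap₂_subst _ _ _ _
theorem atom_subst (A : Tm Γ .atm) : (atom A).subst σ = atom (A.subst σ) := ap₁_subst _ _ _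
theorem amp_subst (B C : Tm Γ .prp) : (amp B C).subst σ = amp (B.subst σ) (C.subst σ) :=
  ap₂_subst _ _ _ _
theorem oimp_subst (A : Tm Γ .atm) (B : Tm Γ .prp) :
    (oimp A B).subst σ = oimp (A.subst σ) (B.subst σ) := ap₂_subst _ _ _ _
theorem oall_subst (B : Tm Γ (.arr .i .prp)) : (oall B).subst σ = oall (B.subst σ) :=
  ap₁_subst _ _ _
theorem arrow_subst (T U : Tm Γ .i) : (arrow T U).subst σ = arrow (T.subst σ) (U.subst σ) :=
  ap₂_subst _ _ _ _
theorem succ_subst (M : Tm Γ .i) : (succ M).subst σ = succ (M.subst σ) := ap₁_subst _ _ _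
theorem pred_subst (M : Tm Γ .i) : (pred M).subst σ = pred (M.subst σ) := ap₁_subst _ _ _
theorem isZero_subst (M : Tm Γ .i) : (isZero M).subst σ = isZero (M.subst σ) := ap₁_subst _ _ _
theorem cond_subst (M N₁ N₂ : Tm Γ .i) :
    (cond M N₁ N₂).subst σ = cond (M.subst σ) (N₁.subst σ) (N₂.subst σ) := ap₃_subst _ _ _ _ _
theorem abs_subst (T : Tm Γ .i) (R : Tm Γ (.arr .i .i)) :
    (abs T R).subst σ = abs (T.subst σ) (R.subst σ) := ap₂_subst _ _ _ _
theorem app_subst (M N : Tm Γ .i) : (app M N).subst σ = app (M.subst σ) (N.subst σ) :=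
  ap₂_subst _ _ _ _
theorem fix_subst (T : Tm Γ .i) (R : Tm Γ (.arr .i .i)) :
    (fix T R).subst σ = fix (T.subst σ) (R.subst σ) := ap₂_subst _ _ _ _
theorem typeof_subst (M N : Tm Γ .i) : (typeof M N).subst σ = typeof (M.subst σ) (N.subst σ) :=
  ap₂_subst _ _ _ _
theorem natsem_subst (M N : Tm Γ .i) : (natsem M N).subst σ = natsem (M.subst σ) (N.subst σ) :=
  ap₂_subst _ _ _ _
theorem transone_subst (M N : Tm Γ .i) :
    (transone M N).subst σ = transone (M.subst σ) (N.subst σ) := ap₂_subst _ _ _ _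
theorem transsem_subst (M N : Tm Γ .i) :
    (transsem M N).subst σ = transsem (M.subst σ) (N.subst σ) := ap₂_subst _ _ _ _
theorem value_subst (M : Tm Γ .i) : (value M).subst σ = value (M.subst σ) := ap₁_subst _ _ _

theorem prvFrom_subst (L : Tm Γ .lst) (B : Tm Γ .prp) :
    (prvFrom L B).subst σ = prvFrom (L.subst σ) (B.subst σ) := by
  simp only [prvFrom, Fm.subst, Atom.subst, Tm.weaken_subst_lift, v0_subst_lift]

theorem prv_subst (B : Tm Γ .prp) : (prv B).subst σ = prv (B.subst σ) := by
  simp only [prv, prvFrom_subst, nil_subst]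

end

attribute [simp] v0_weaken v1_weaken v2_weaken Tm.subst_app Tm.subst_lam Tm.subst_id
  Tm.weaken_subst_lift Tm.weaken_subst_cons
  Sub.single_eq_cons v0_subst_cons v0_subst_lift v1_subst_cons v2_subst_cons v3_subst_cons
  v4_subst_cons v1_subst_lift v2_subst_lift v3_subst_lift z_subst nil_subst tt_subst
  num_subst bool_subst zero_subst tru_subst fls_subst s_subst cons_subst atom_subst amp_subst
  oimp_subst oall_subst arrow_subst succ_subst pred_subst isZero_subst cond_subst abs_subst
  app_subst fix_subst typeof_subst natsem_subst transone_subst transsem_subst value_subst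
  prvFrom_subst prv_subst Fm.subst Atom.subst Fm.subst_id

attribute [simp] s_inj cons_inj atom_inj amp_inj oimp_inj oall_inj arrow_inj succ_inj pred_inj
  isZero_inj cond_inj abs_inj app_inj fix_inj typeof_inj natsem_inj transone_inj transsem_inj
  value_inj headCode_z headCode_s headCode_nil headCode_cons headCode_atom headCode_tt headCode_amp
  headCode_oimp headCode_oall headCode_zero headCode_tru
  headCode_fls headCode_succ headCode_pred headCode_isZero headCode_cond headCode_abs headCode_app
  headCode_fix headCode_typeof headCode_natsem headCode_transone headCode_transsem headCode_value

/-! ### Inversion of atoms -/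

/-- The clauses of the object-level theory. -/
def progClauses : List Clause := typingClauses ++ natsemClauses ++ transClauses

/-- `G ⇒ A` is an instance of a clause of the object-level theory. -/
def Prog {Γ : Ctx} (A : Tm Γ .atm) (G : Tm Γ .prp) : Prop :=
  ∃ c ∈ progClauses, ∃ τ : Sub c.ctx Γ, Atom.prog A G = c.head.subst τ

theorem Prog.subst {Γ Δ : Ctx} {A : Tm Γ .atm} {G : Tm Γ .prp} (h : Prog A G) (σ : Sub Γ Δ) :
    Prog (A.subst σ) (G.subst σ) := by
  obtain ⟨c, hc, τ, h⟩ := h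
  refine ⟨c, hc, τ.comp σ, ?_⟩
  rw [← Atom.subst_subst, ← h]
  rfl

theorem body_of_mem_progClauses : ∀ c ∈ progClauses, c.body = .top := by
  simp [progClauses, typingClauses, natsemClauses, transClauses, progClause]

theorem predicate_of_mem_progClauses : ∀ c ∈ progClauses, c.head.predicate = .prog := by
  simp [progClauses, typingClauses, natsemClauses, transClauses, progClause, Atom.predicate]

theorem Atom.predicate_subst {Γ Δ : Ctx} (σ : Sub Γ Δ) (A : Atom Γ) :
    (A.subst σ).predicate = A.predicate := by
  cases A <;> rfl

/-- The group of clauses for a predicate. -/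
def clausesFor : Pred → List Clause
  | .seq => intuitClauses
  | .prog => progClauses
  | .same => sameClauses
  | .length | .list | .element | .split | .permute => listClauses
  | _ => natClauses

/-- Each group contains every clause for its predicates, so a case analysis only inspects the group
of the atom at hand. -/
theorem mem_clauses_iff (c : Clause) :
    c ∈ pcfDefinition.clauses ↔ c ∈ clausesFor c.head.predicate := by
  have h₁ : ∀ c ∈ natClauses, clausesFor c.head.predicate = natClauses := by
    simp [natClauses, clausesFor, Atom.predicate]
  have h₂ : ∀ c ∈ listClauses, clausesFor c.head.predicate = listClauses := by
    simp [listClauses, clausesFor, Atom.predicate]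
  have h₃ : ∀ c ∈ intuitClauses, clausesFor c.head.predicate = intuitClauses := by
    simp [intuitClauses, clausesFor, Atom.predicate]
  have h₄ : ∀ c ∈ progClauses, clausesFor c.head.predicate = progClauses := by
    intro c hc
    rw [predicate_of_mem_progClauses c hc]
    rfl
  have h₅ : ∀ c ∈ sameClauses, clausesFor c.head.predicate = sameClauses := by
    simp [sameClauses, clausesFor, Atom.predicate]
  have e : c ∈ pcfDefinition.clauses ↔
      (((c ∈ natClauses ∨ c ∈ listClauses) ∨ c ∈ intuitClauses) ∨ c ∈ progClauses) ∨
        c ∈ sameClauses := by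
    simp only [pcfDefinition, Set.mem_ofPred_eq, List.mem_append, progClauses]
  rw [e]
  refine ⟨?_, fun h => ?_⟩
  · rintro ((((h | h) | h) | h) | h)
    · rw [h₁ c h]; exact h
    · rw [h₂ c h]; exact h
    · rw [h₃ c h]; exact h
    · rw [h₄ c h]; exact h
    · rw [h₅ c h]; exact h
  · generalize c.head.predicate = p at h
    cases p <;> simp only [clausesFor] at h <;> tauto

/-- Derivability from the clauses for PCF. -/
abbrev PDer {Γ : Ctx} (H : Multiset (Fm Γ)) (C : Fm Γ) : Prop := Der pcfDefinition H C

/-- Extension of hypotheses, for the clauses for PCF. -/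
abbrev PExt {Γ Δ : Ctx} (σ : Sub Γ Δ) (H : Multiset (Fm Γ)) (H' : Multiset (Fm Δ)) : Prop :=
  Ext pcfDefinition σ H H'

section

variable {Γ : Ctx} {H : Multiset (Fm Γ)} {C : Fm Γ}

theorem Der.atom_elim {A : Atom Γ} (h : PDer H (.atom A))
    (k : ∀ (Δ : Ctx) (σ : Sub Γ Δ) (H' : Multiset (Fm Δ)), PExt σ H H' →
      ∀ c ∈ clausesFor A.predicate, ∀ τ : Sub c.ctx Δ, A.subst σ = c.head.subst τ →
        PDer H' (c.body.subst τ) → PDer H' (C.subst σ)) : PDer H C := by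
  refine Der.def_elim h fun Δ σ H' e c hc τ hA hB => k Δ σ H' e c ?_ τ hA hB
  rw [mem_clauses_iff] at hc
  rwa [← Atom.predicate_subst σ, hA, Atom.predicate_subst]

theorem Der.atom_intro {A : Atom Γ} (c : Clause) (hc : c ∈ clausesFor c.head.predicate)
    (τ : Sub c.ctx Γ) (hA : A = c.head.subst τ) (h : PDer H (c.body.subst τ)) :
    PDer H (.atom A) :=
  Der.defR c ((mem_clauses_iff c).2 hc) τ hA h

theorem Der.prog_intro {A : Tm Γ .atm} {G : Tm Γ .prp} (h : Prog A G) :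
    PDer H (.atom (.prog A G)) := by
  obtain ⟨c, hc, τ, h⟩ := h
  refine Der.atom_intro c ?_ τ h ?_
  · rw [predicate_of_mem_progClauses c hc]; exact hc
  · rw [body_of_mem_progClauses c hc]; exact .topR

/-- Program clauses have body `⊤`, so the whole content of a derivable `prog` atom is the unifier.
After a substitution it becomes the meta-level fact `Prog`. -/
theorem Der.prog_elim {A : Tm Γ .atm} {G : Tm Γ .prp} (h : PDer H (.atom (.prog A G)))
    (k : ∀ (Δ : Ctx) (σ : Sub Γ Δ) (H' : Multiset (Fm Δ)), PExt σ H H' →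
      Prog (A.subst σ) (G.subst σ) → PDer H' (C.subst σ)) : PDer H C :=
  h.atom_elim fun Δ σ H' e c hc τ hA _ => k Δ σ H' e ⟨c, hc, τ, hA⟩

theorem Der.same_intro (M : Tm Γ .i) : PDer H (.atom (.same M M)) :=
  Der.atom_intro ⟨[.i], .same v0 v0, .top⟩ (by simp [clausesFor, Atom.predicate, sameClauses])
    (Sub.cons M Sub.empty) (by simp) .topR

theorem Der.same_elim {M N : Tm Γ .i} (h : PDer H (.atom (.same M N)))
    (k : ∀ (Δ : Ctx) (σ : Sub Γ Δ) (H' : Multiset (Fm Δ)), PExt σ H H' →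
      M.subst σ = N.subst σ → PDer H' (C.subst σ)) : PDer H C := by
  refine h.atom_elim fun Δ σ H' e c hc τ hA _ => k Δ σ H' e ?_
  simp only [clausesFor, Atom.predicate, sameClauses, List.mem_singleton] at hc
  subst hc
  simp only [Atom.subst, Atom.same.injEq] at hA
  rw [hA.1, hA.2]

theorem Der.element_head (X : Tm Γ .atm) (L : Tm Γ .lst) :
    PDer H (.atom (.element X (cons X L))) :=
  Der.atom_intro ⟨[.atm, .lst], .element v0 (cons v0 v1), .top⟩
    (by simp [clausesFor, Atom.predicate, listClauses])
    (Sub.cons X (Sub.cons L Sub.empty)) (by simp) .topR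

theorem Der.element_tail {X : Tm Γ .atm} (Y : Tm Γ .atm) {L : Tm Γ .lst}
    (h : PDer H (.atom (.element X L))) : PDer H (.atom (.element X (cons Y L))) :=
  Der.atom_intro ⟨[.atm, .atm, .lst], .element v0 (cons v1 v2), .atom (.element v0 v2)⟩
    (by simp [clausesFor, Atom.predicate, listClauses])
    (Sub.cons X (Sub.cons Y (Sub.cons L Sub.empty))) (by simp) (by simpa using h)

theorem Der.element_elim {X : Tm Γ .atm} {L : Tm Γ .lst} (h : PDer H (.atom (.element X L)))
    (k₁ : ∀ (Δ : Ctx) (σ : Sub Γ Δ) (H' : Multiset (Fm Δ)), PExt σ H H' → ∀ L' : Tm Δ .lst,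
      L.subst σ = cons (X.subst σ) L' → PDer H' (C.subst σ))
    (k₂ : ∀ (Δ : Ctx) (σ : Sub Γ Δ) (H' : Multiset (Fm Δ)), PExt σ H H' →
      ∀ (Y : Tm Δ .atm) (L' : Tm Δ .lst), L.subst σ = cons Y L' →
        PDer H' (.atom (.element (X.subst σ) L')) → PDer H' (C.subst σ)) : PDer H C := by
  refine h.atom_elim fun Δ σ H' e c hc τ hA hB => ?_
  simp only [clausesFor, Atom.predicate, listClauses, List.mem_cons, List.not_mem_nil,
    or_false] at hc
  rcases hc with rfl | rfl | rfl | rfl | rfl | rfl | rfl | rfl | rfl | rfl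
  case inr.inr.inr.inl =>
    simp only [Atom.subst, Atom.element.injEq, cons_subst] at hA
    exact k₁ Δ σ H' e _ (by rw [hA.2, hA.1])
  case inr.inr.inr.inr.inl =>
    simp only [Atom.subst, Atom.element.injEq, cons_subst, Fm.subst] at hA hB
    exact k₂ Δ σ H' e _ _ hA.2 (by rw [hA.1]; exact hB)
  all_goals nomatch hA

/-- The last step in the derivation of an object-level sequent of height at most `I`. -/
inductive SeqStep (H : Multiset (Fm Γ)) : Tm Γ .nt → Tm Γ .lst → Tm Γ .prp → Prop
  | init {I : Tm Γ .nt} {L : Tm Γ .lst} {A : Tm Γ .atm} :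
      PDer H (.atom (.element A L)) → SeqStep H I L (atom A)
  | tt {I : Tm Γ .nt} {L : Tm Γ .lst} : SeqStep H I L tt
  | amp {I : Tm Γ .nt} {L : Tm Γ .lst} {B C : Tm Γ .prp} : PDer H (.atom (.seq I L B)) →
      PDer H (.atom (.seq I L C)) → SeqStep H (s I) L (amp B C)
  | oimp {I : Tm Γ .nt} {L : Tm Γ .lst} {A : Tm Γ .atm} {B : Tm Γ .prp} :
      PDer H (.atom (.seq I (cons A L) B)) → SeqStep H (s I) L (oimp A B)
  | oall {I : Tm Γ .nt} {L : Tm Γ .lst} {B : Tm Γ (.arr .i .prp)} :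
      PDer H (.all .i (.atom (.seq I.weaken L.weaken (B.weaken.app v0)))) →
        SeqStep H (s I) L (oall B)
  | prog {I : Tm Γ .nt} {L : Tm Γ .lst} {A : Tm Γ .atm} {G : Tm Γ .prp} : Prog A G →
      PDer H (.atom (.seq I L G)) → SeqStep H (s I) L (atom A)

theorem Der.seq_intro {I : Tm Γ .nt} {L : Tm Γ .lst} {B : Tm Γ .prp} (h : SeqStep H I L B) :
    PDer H (.atom (.seq I L B)) := by
  cases h with
  | @init _ _ A h =>
    have key : ∀ {Δ : Ctx} {H' : Multiset (Fm Δ)} (I : Tm Δ .nt) (A Y : Tm Δ .atm)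
        (L : Tm Δ .lst), PDer H' (.atom (.element A (cons Y L))) →
          PDer H' (.atom (.seq I (cons Y L) (atom A))) := fun I A Y L h =>
      Der.atom_intro ⟨[.nt, .atm, .lst, .atm], .seq v0 (cons v1 v2) (atom v3),
          .atom (.element v3 (cons v1 v2))⟩
        (by simp [clausesFor, Atom.predicate, intuitClauses])
        (Sub.cons I (Sub.cons Y (Sub.cons L (Sub.cons A Sub.empty)))) (by simp) (by simpa using h)
    -- The clause for initial sequents asks for a list of the form `cons Y L`; membership in the
    -- list exposes this form.
    refine h.element_elim (fun Δ σ H' e L' hL => ?_) (fun Δ σ H' e Y L' hL _ => ?_)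
    all_goals
      have h := e h
      simp only [Fm.subst, Atom.subst, atom_subst, hL] at h ⊢
      exact key _ _ _ _ h
  | tt =>
    exact Der.atom_intro ⟨[.nt, .lst], .seq v0 v1 FOLDN.tt, .top⟩
      (by simp [clausesFor, Atom.predicate, intuitClauses])
      (Sub.cons I (Sub.cons L Sub.empty)) (by simp) .topR
  | @amp I _ B C h₁ h₂ =>
    exact Der.atom_intro ⟨[.nt, .lst, .prp, .prp], .seq (s v0) v1 (FOLDN.amp v2 v3),
        .and (.atom (.seq v0 v1 v2)) (.atom (.seq v0 v1 v3))⟩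
      (by simp [clausesFor, Atom.predicate, intuitClauses])
      (Sub.cons I (Sub.cons L (Sub.cons B (Sub.cons C Sub.empty)))) (by simp)
      (by simpa using .andR h₁ h₂)
  | @oimp I _ A B h =>
    exact Der.atom_intro ⟨[.nt, .lst, .atm, .prp], .seq (s v0) v1 (FOLDN.oimp v2 v3),
        .atom (.seq v0 (cons v2 v1) v3)⟩
      (by simp [clausesFor, Atom.predicate, intuitClauses])
      (Sub.cons I (Sub.cons L (Sub.cons A (Sub.cons B Sub.empty)))) (by simp) (by simpa using h)
  | @oall I _ B h =>
    exact Der.atom_intro ⟨[.nt, .lst, .arr .i .prp], .seq (s v0) v1 (FOLDN.oall v2),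
        .all .i (.atom (.seq v1 v2 (v3.app v0)))⟩
      (by simp [clausesFor, Atom.predicate, intuitClauses])
      (Sub.cons I (Sub.cons L (Sub.cons B Sub.empty))) (by simp) (by simpa using h)
  | @prog I _ A G hG h =>
    exact Der.atom_intro ⟨[.nt, .lst, .atm], .seq (s v0) v1 (atom v2),
        .ex .prp (.and (.atom (.prog v3 v0)) (.atom (.seq v1 v2 v0)))⟩
      (by simp [clausesFor, Atom.predicate, intuitClauses])
      (Sub.cons I (Sub.cons L (Sub.cons A Sub.empty))) (by simp)
      (Der.ex_intro G (by simpa using .andR (Der.prog_intro hG) h))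

theorem Ext.trans {D : Definition} {Γ Δ Θ : Ctx} {σ : Sub Γ Δ} {τ : Sub Δ Θ}
    {H : Multiset (Fm Γ)} {H' : Multiset (Fm Δ)} {K : Multiset (Fm Θ)} (e : Ext D σ H H')
    (e' : Ext D τ H' K) : Ext D (σ.comp τ) H K := by
  intro B h
  rw [← Fm.subst_subst]
  exact e' (e h)

theorem Der.seq_elim {I : Tm Γ .nt} {L : Tm Γ .lst} {B : Tm Γ .prp}
    (h : PDer H (.atom (.seq I L B)))
    (k : ∀ (Δ : Ctx) (σ : Sub Γ Δ) (H' : Multiset (Fm Δ)), PExt σ H H' →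
      SeqStep H' (I.subst σ) (L.subst σ) (B.subst σ) → PDer H' (C.subst σ)) : PDer H C := by
  refine h.atom_elim fun Δ σ H' e c hc τ hA hB => ?_
  simp only [clausesFor, Atom.predicate, intuitClauses, List.mem_cons, List.not_mem_nil,
    or_false] at hc
  rcases hc with rfl | rfl | rfl | rfl | rfl | rfl
  all_goals
    simp only [Atom.subst, Atom.seq.injEq, cons_subst, Fm.subst, s_subst, atom_subst, tt_subst,
      amp_subst, oimp_subst, oall_subst, v1_subst_lift, v2_subst_lift, v3_subst_lift,
      v0_subst_lift, Tm.subst_app] at hA hB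
    obtain ⟨h₁, h₂, h₃⟩ := hA
  · exact k Δ σ H' e (by rw [h₁, h₂, h₃]; exact .init hB)
  · exact k Δ σ H' e (by rw [h₁, h₂, h₃]; exact .tt)
  · exact k Δ σ H' e (by rw [h₁, h₂, h₃]; exact .amp hB.and_left hB.and_right)
  · exact k Δ σ H' e (by rw [h₁, h₂, h₃]; exact .oimp hB)
  · exact k Δ σ H' e (by rw [h₁, h₂, h₃]; exact .oall hB)
  -- In the backchaining clause the goal sits under an existential and the program clause inside an
  -- atom. Opening both passes twice to a later world, hence the composed substitution.
  · refine hB.ex_elim fun Θ ρ K e₁ G hG => ?_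
    simp only [Fm.subst, Atom.subst, Tm.weaken_subst_cons, v0_subst_cons] at hG
    refine hG.and_left.prog_elim fun Ξ π J e₂ hP => ?_
    rw [Fm.subst_subst, Fm.subst_subst]
    refine k Ξ _ J (e.trans (e₁.trans e₂)) ?_
    simp only [← Tm.subst_subst, h₁, h₂, h₃, s_subst, atom_subst]
    exact .prog hP (e₂ hG.and_right)

end

/-! ### Introduction rules for quantifier blocks in front of an implication -/

section

variable {D : Definition} {Γ : Ctx} {H : Multiset (Fm Γ)} {a b c : Ty}

theorem Der.all_imp_intro {B C : Fm (a :: Γ)}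
    (k : ∀ (Δ : Ctx) (σ : Sub Γ Δ) (H' : Multiset (Fm Δ)), Ext D σ H H' → ∀ t : Tm Δ a,
      Der D H' (B.subst (Sub.cons t σ)) → Der D H' (C.subst (Sub.cons t σ))) :
    Der D H (.all a (.imp B C)) :=
  .all_intro fun Δ σ _ e t => .imp_intro fun _ e' h => k Δ σ _ (fun _ h => e' (e h)) t h

theorem Der.all₂_intro {B : Fm (b :: a :: Γ)}
    (k : ∀ (Δ : Ctx) (σ : Sub Γ Δ) (H' : Multiset (Fm Δ)), Ext D σ H H' →
      ∀ (t : Tm Δ a) (u : Tm Δ b), Der D H' (B.subst (Sub.cons u (Sub.cons t σ)))) :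
    Der D H (.all a (.all b B)) := by
  refine .all_intro fun Δ σ _ e t => .all_intro fun Θ τ K e' u => ?_
  rw [Fm.subst_subst, Sub.lift_comp_cons, Sub.cons_comp]
  exact k Θ _ K (e.trans e') _ u

theorem Der.all₂_imp_intro {B C : Fm (b :: a :: Γ)}
    (k : ∀ (Δ : Ctx) (σ : Sub Γ Δ) (H' : Multiset (Fm Δ)), Ext D σ H H' →
      ∀ (t : Tm Δ a) (u : Tm Δ b), Der D H' (B.subst (Sub.cons u (Sub.cons t σ))) →
        Der D H' (C.subst (Sub.cons u (Sub.cons t σ)))) :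
    Der D H (.all a (.all b (.imp B C))) :=
  .all₂_intro fun Δ σ _ e t u => .imp_intro fun _ e' h => k Δ σ _ (fun _ h => e' (e h)) t u h

theorem Der.all₃_imp_intro {B C : Fm (c :: b :: a :: Γ)}
    (k : ∀ (Δ : Ctx) (σ : Sub Γ Δ) (H' : Multiset (Fm Δ)), Ext D σ H H' →
      ∀ (t : Tm Δ a) (u : Tm Δ b) (v : Tm Δ c),
        Der D H' (B.subst (Sub.cons v (Sub.cons u (Sub.cons t σ)))) →
          Der D H' (C.subst (Sub.cons v (Sub.cons u (Sub.cons t σ))))) :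
    Der D H (.all a (.all b (.all c (.imp B C)))) := by
  refine .all₂_intro fun Δ σ _ e t u => .all_imp_intro fun Θ τ K e' v h => ?_
  rw [Fm.subst_subst, Sub.lift_comp_cons, Sub.cons_comp, Sub.cons_comp] at h ⊢
  exact k Θ _ K (e.trans e') _ _ v h

end

/-! ### The object logic -/

section

variable {Γ Δ : Ctx} {H : Multiset (Fm Γ)}

/-- The formula `seq I L B`. -/
abbrev seqF (I : Tm Γ .nt) (L : Tm Γ .lst) (B : Tm Γ .prp) : Fm Γ := .atom (.seq I L B)

/-- The formula `element X L`. -/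
abbrev elementF (X : Tm Γ .atm) (L : Tm Γ .lst) : Fm Γ := .atom (.element X L)

/-! ### Inversion of the last step of an object-level derivation -/

theorem SeqStep.of_z {L : Tm Γ .lst} {B : Tm Γ .prp} (h : SeqStep H z L B) (J : Tm Γ .nt) :
    SeqStep H J L B := by
  generalize hI : z = I at h
  cases h with
  | init h => exact .init h
  | tt => exact .tt
  | _ => exact (Tm.absurd_of_headCode_ne hI (by simp)).elim

/-- Terms being classes modulo conversion, the index is first generalized to an equation; clash and
injectivity then decide each case. The other inversions follow the same scheme. -/
theorem SeqStep.amp_inv {I : Tm Γ .nt} {L : Tm Γ .lst} {B C : Tm Γ .prp}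
    (h : SeqStep H I L (FOLDN.amp B C)) :
    ∃ I', I = s I' ∧ PDer H (seqF I' L B) ∧ PDer H (seqF I' L C) := by
  generalize hB : FOLDN.amp B C = G at h
  cases h with
  | amp h₁ h₂ =>
    obtain ⟨rfl, rfl⟩ := amp_inj.1 hB
    exact ⟨_, rfl, h₁, h₂⟩
  | _ => exact (Tm.absurd_of_headCode_ne hB (by simp)).elim

theorem SeqStep.oimp_inv {I : Tm Γ .nt} {L : Tm Γ .lst} {A : Tm Γ .atm} {B : Tm Γ .prp}
    (h : SeqStep H I L (FOLDN.oimp A B)) :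
    ∃ I', I = s I' ∧ PDer H (seqF I' (cons A L) B) := by
  generalize hB : FOLDN.oimp A B = G at h
  cases h with
  | oimp h =>
    obtain ⟨rfl, rfl⟩ := oimp_inj.1 hB
    exact ⟨_, rfl, h⟩
  | _ => exact (Tm.absurd_of_headCode_ne hB (by simp)).elim

theorem SeqStep.oall_inv {I : Tm Γ .nt} {L : Tm Γ .lst} {B : Tm Γ (.arr .i .prp)}
    (h : SeqStep H I L (FOLDN.oall B)) :
    ∃ I', I = s I' ∧ ∀ N, PDer H (seqF I' L (B.app N)) := by
  generalize hB : FOLDN.oall B = G at h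
  cases h with
  | oall h =>
    obtain rfl := oall_inj.1 hB
    exact ⟨_, rfl, fun N => by simpa using h.all_elim N⟩
  | _ => exact (Tm.absurd_of_headCode_ne hB (by simp)).elim

theorem SeqStep.atom_inv {I : Tm Γ .nt} {L : Tm Γ .lst} {A : Tm Γ .atm}
    (h : SeqStep H I L (atom A)) :
    PDer H (elementF A L) ∨ ∃ I' G, I = s I' ∧ Prog A G ∧ PDer H (seqF I' L G) := by
  generalize hB : atom A = G at h
  cases h with
  | init h =>
    obtain rfl := atom_inj.1 hB
    exact .inl h
  | prog h₁ h₂ =>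
    obtain rfl := atom_inj.1 hB
    exact .inr ⟨_, _, rfl, h₁, h₂⟩
  | _ => exact (Tm.absurd_of_headCode_ne hB (by simp)).elim

/-- Sequents of height `I` are also of height `J`. -/
noncomputable def monoF (I J : Tm Γ .nt) : Fm Γ :=
  .all .lst (.all .prp (.imp (seqF I.weaken.weaken v1 v0) (seqF J.weaken.weaken v1 v0)))

@[simp] theorem monoF_subst (σ : Sub Γ Δ) (I J : Tm Γ .nt) :
    (monoF I J).subst σ = monoF (I.subst σ) (J.subst σ) := by
  simp [monoF]

theorem monoF_intro {I J : Tm Γ .nt}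
    (k : ∀ (Δ : Ctx) (σ : Sub Γ Δ) (H' : Multiset (Fm Δ)), PExt σ H H' →
      ∀ (L : Tm Δ .lst) (B : Tm Δ .prp), PDer H' (seqF (I.subst σ) L B) →
        PDer H' (seqF (J.subst σ) L B)) : PDer H (monoF I J) :=
  .all₂_imp_intro fun Δ σ H' e L B h => by simpa using k Δ σ H' e L B (by simpa using h)

theorem monoF_elim {I J : Tm Γ .nt} (h : PDer H (monoF I J)) {L : Tm Γ .lst} {B : Tm Γ .prp}
    (h' : PDer H (seqF I L B)) : PDer H (seqF J L B) := by
  have h := (h.all_elim L)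
  simp only [Fm.subst] at h
  simpa using (h.all_elim B).imp_elim (by simpa using h')

/-- Leaves ignore the height, and every other clause puts its premises at the predecessor, where
`hIJ` applies. -/
theorem SeqStep.map_s {I J : Tm Γ .nt} (hIJ : PDer H (monoF I J)) {L : Tm Γ .lst}
    {B : Tm Γ .prp} (h : SeqStep H (s I) L B) : SeqStep H (s J) L B := by
  generalize hI : s I = I' at h
  cases h with
  | init h => exact .init h
  | tt => exact .tt
  | amp h₁ h₂ =>
    obtain rfl := s_inj.1 hI
    exact .amp (monoF_elim hIJ h₁) (monoF_elim hIJ h₂)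
  | oimp h =>
    obtain rfl := s_inj.1 hI
    exact .oimp (monoF_elim hIJ h)
  | prog hP h =>
    obtain rfl := s_inj.1 hI
    exact .prog hP (monoF_elim hIJ h)
  | oall h =>
    obtain rfl := s_inj.1 hI
    refine .oall (.all_intro fun Δ σ H' e N => ?_)
    have hIJ := e hIJ
    have h := (e h).all_elim N
    simp only [monoF_subst] at hIJ
    simp at h ⊢
    exact monoF_elim hIJ h

theorem monoF_refl (I : Tm Γ .nt) : PDer H (monoF I I) := monoF_intro fun _ _ _ _ _ _ h => h

theorem monoF_trans {I J K : Tm Γ .nt} (h : PDer H (monoF I J)) (h' : PDer H (monoF J K)) :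
    PDer H (monoF I K) := by
  refine monoF_intro fun Δ σ H' e L B hB => ?_
  have h := e h
  have h' := e h'
  rw [monoF_subst] at h h'
  exact monoF_elim h' (monoF_elim h hB)

theorem monoF_z (J : Tm Γ .nt) : PDer H (monoF z J) := by
  refine monoF_intro fun Δ σ H' e L B h => h.seq_elim fun Θ τ K e' h => .seq_intro ?_
  exact h.of_z _

theorem monoF_s {I J : Tm Γ .nt} (h : PDer H (monoF I J)) : PDer H (monoF (s I) (s J)) := by
  refine monoF_intro fun Δ σ H' e L B hB => hB.seq_elim fun Θ τ K e' hB => .seq_intro ?_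
  have h := e' (e h)
  simp only [monoF_subst, s_subst] at h hB ⊢
  exact hB.map_s h

/-- By induction: height `z` admits only leaves, which exist at every height, and `monoF_s` carries
the claim from one number to the next. -/
theorem monoF_self_s {I : Tm Γ .nt} (h : PDer H (.nat I)) : PDer H (monoF I (s I)) :=
  Der.nat_induction (fun I => monoF I (s I)) (by intros; simp) (fun _ => monoF_z _)
    (fun _ _ _ h => monoF_s h) h

/-- Two heights have a common upper bound. -/
theorem exists_common_height {I J : Tm Γ .nt} (hI : PDer H (.nat I)) (hJ : PDer H (.nat J)) :
    PDer H (.ex .nt (.and (.nat v0) (.and (monoF I.weaken v0) (monoF J.weaken v0)))) := by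
  have h := Der.nat_induction (D := pcfDefinition) (H := H) (I := I)
    (fun I => .all .nt (.imp (.nat v0)
      (.ex .nt (.and (.nat v0) (.and (monoF I.weaken.weaken v0) (monoF v1 v0))))))
    (by intros; simp) ?_ ?_ hI
  · simpa using (h.all_elim J).imp_elim (by simpa using hJ)
  -- The bound is in effect the sum of the two heights: `J` when the first is `z`, and one more at
  -- each successor.
  · refine fun H => .all_imp_intro fun Δ σ H' e J hJ => Der.ex_intro J ?_
    simp at hJ ⊢
    exact .andR hJ (.andR (monoF_z _) (monoF_refl _))
  · refine fun H I hI h => .all_imp_intro fun Δ σ H' e J hJ => ?_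
    have h := ((e h).all_elim J).imp_elim (by simpa using hJ)
    refine h.ex_elim fun Θ τ K e' M hM => ?_
    simp at hM ⊢
    refine .ex_intro (s M) ?_
    simp
    exact .andR (.natRsucc hM.and_left) (.andR (monoF_s hM.and_right.and_left)
      (monoF_trans hM.and_right.and_right (monoF_self_s hM.and_left)))

/-! ### Equality and predecessors of natural numbers -/

theorem Der.eq_intro (I : Tm Γ .nt) : PDer H (.atom (.eq I I)) :=
  Der.atom_intro ⟨[.nt], .eq v0 v0, .top⟩ (by simp [clausesFor, Atom.predicate, natClauses])
    (Sub.cons I Sub.empty) (by simp) .topR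

theorem Der.eq_elim {I J : Tm Γ .nt} {C : Fm Γ} (h : PDer H (.atom (.eq I J)))
    (k : ∀ (Δ : Ctx) (σ : Sub Γ Δ) (H' : Multiset (Fm Δ)), PExt σ H H' →
      I.subst σ = J.subst σ → PDer H' (C.subst σ)) : PDer H C := by
  refine h.atom_elim fun Δ σ H' e c hc τ hA _ => ?_
  simp only [clausesFor, Atom.predicate, natClauses, List.mem_cons, List.not_mem_nil,
    or_false] at hc
  rcases hc with rfl | rfl | rfl | rfl | rfl | rfl | rfl
  case inl =>
    simp only [Atom.subst, Atom.eq.injEq] at hA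
    exact k Δ σ H' e (by rw [hA.1, hA.2])
  all_goals nomatch hA

/-- No inversion rule for `nat` is given, only induction. The invariant says of `J` that every `x`
with `J = s x` is a natural number. At a successor, injectivity of `s` reduces it to the conjunct
`nat I` kept by `Der.nat_induction`. -/
theorem Der.nat_pred {I : Tm Γ .nt} (h : PDer H (.nat (s I))) : PDer H (.nat I) := by
  have h := Der.nat_induction (D := pcfDefinition) (H := H) (I := s I)
    (fun J => .all .nt (.imp (.atom (.eq J.weaken (s v0))) (.nat v0))) (by intros; simp) ?_ ?_ h
  · simpa using (h.all_elim I).imp_elim (by simpa using Der.eq_intro (s I))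
  · refine fun H => .all_imp_intro fun Δ σ H' e J hJ => Der.eq_elim hJ fun Θ τ K _ h => ?_
    exact (Tm.absurd_of_headCode_ne h (by simp)).elim
  · refine fun H I hI _ => .all_imp_intro fun Δ σ H' e J hJ => Der.eq_elim hJ fun Θ τ K e' h => ?_
    have hI := e' (e hI)
    simp at h hI ⊢
    rwa [← h]

theorem seqF_mono_s {I : Tm Γ .nt} {L : Tm Γ .lst} {B : Tm Γ .prp} (hI : PDer H (.nat (s I)))
    (h : PDer H (seqF I L B)) : PDer H (seqF (s I) L B) :=
  monoF_elim (monoF_self_s hI.nat_pred) h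

/-- Inversion lowers the height by one and monotonicity raises it again. Keeping the height `I` lets
an induction hypothesis for `I` apply to both conjuncts. -/
theorem seqF_amp_elim {I : Tm Γ .nt} {L : Tm Γ .lst} {B C : Tm Γ .prp} (hI : PDer H (.nat I))
    (h : PDer H (seqF I L (amp B C))) : PDer H (seqF I L B) ∧ PDer H (seqF I L C) := by
  -- The case analysis happens inside the calculus and has one conclusion, so both results are first
  -- collected in one formula.
  have h' : PDer H (.and (seqF I L B) (seqF I L C)) := by
    refine h.seq_elim fun Δ σ H' e h => ?_
    rw [amp_subst] at h
    obtain ⟨J, hJ, h₁, h₂⟩ := h.amp_inv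
    have hI := e hI
    simp only [Fm.subst, Atom.subst, hJ] at hI ⊢
    exact .andR (seqF_mono_s hI h₁) (seqF_mono_s hI h₂)
  exact ⟨h'.and_left, h'.and_right⟩

theorem seqF_oimp_elim {I : Tm Γ .nt} {L : Tm Γ .lst} {A : Tm Γ .atm} {B : Tm Γ .prp}
    (hI : PDer H (.nat I)) (h : PDer H (seqF I L (oimp A B))) : PDer H (seqF I (cons A L) B) := by
  refine h.seq_elim fun Δ σ H' e h => ?_
  rw [oimp_subst] at h
  obtain ⟨J, hJ, h₁⟩ := h.oimp_inv
  have hI := e hI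
  simp only [Fm.subst, Atom.subst, cons_subst, hJ] at hI ⊢
  exact seqF_mono_s hI h₁

theorem seqF_oall_elim {I : Tm Γ .nt} {L : Tm Γ .lst} {B : Tm Γ (.arr .i .prp)}
    (hI : PDer H (.nat I)) (h : PDer H (seqF I L (oall B))) (N : Tm Γ .i) :
    PDer H (seqF I L (B.app N)) := by
  refine h.seq_elim fun Δ σ H' e h => ?_
  rw [oall_subst] at h
  obtain ⟨J, hJ, h₁⟩ := h.oall_inv
  have hI := e hI
  simp only [Fm.subst, Atom.subst, Tm.subst_app, hJ] at hI ⊢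
  exact seqF_mono_s hI (h₁ _)

/-! Weakening -/

/-- The elements of `L` are elements of `L'`. -/
noncomputable def subsetF (L L' : Tm Γ .lst) : Fm Γ :=
  .all .atm (.imp (elementF v0 L.weaken) (elementF v0 L'.weaken))

@[simp] theorem subsetF_subst (σ : Sub Γ Δ) (L L' : Tm Γ .lst) :
    (subsetF L L').subst σ = subsetF (L.subst σ) (L'.subst σ) := by
  simp [subsetF]

theorem subsetF_intro {L L' : Tm Γ .lst}
    (k : ∀ (Δ : Ctx) (σ : Sub Γ Δ) (H' : Multiset (Fm Δ)), PExt σ H H' →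
      ∀ X : Tm Δ .atm, PDer H' (elementF X (L.subst σ)) → PDer H' (elementF X (L'.subst σ))) :
    PDer H (subsetF L L') :=
  .all_imp_intro fun Δ σ H' e X h => by simpa using k Δ σ H' e X (by simpa using h)

theorem subsetF_elim {L L' : Tm Γ .lst} (h : PDer H (subsetF L L')) {X : Tm Γ .atm}
    (h' : PDer H (elementF X L)) : PDer H (elementF X L') := by
  simpa using (h.all_elim X).imp_elim (by simpa using h')

theorem subsetF_cons {L L' : Tm Γ .lst} (h : PDer H (subsetF L L')) (A : Tm Γ .atm) :
    PDer H (subsetF (cons A L) (cons A L')) := by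
  refine subsetF_intro fun Δ σ H' e X hX => hX.element_elim (fun Θ τ K e' M hM => ?_)
    (fun Θ τ K e' Y M hM hX => ?_)
  · simp at hM ⊢
    rw [hM.1]
    exact .element_head _ _
  · have h := e' (e h)
    simp at h hM ⊢
    exact .element_tail _ (subsetF_elim h (hM.2 ▸ hX))

theorem subsetF_self_cons (A : Tm Γ .atm) (L : Tm Γ .lst) : PDer H (subsetF L (cons A L)) := by
  refine subsetF_intro fun Δ σ H' e X hX => ?_
  rw [cons_subst]
  exact .element_tail _ hX

/-- Sequents of height `I` may be weakened. -/
noncomputable def weakeningF (I : Tm Γ .nt) : Fm Γ :=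
  .all .lst (.all .lst (.all .prp (.imp (.and (subsetF v2 v1) (seqF I.weaken.weaken.weaken v2 v0))
    (seqF I.weaken.weaken.weaken v1 v0))))

@[simp] theorem weakeningF_subst (σ : Sub Γ Δ) (I : Tm Γ .nt) :
    (weakeningF I).subst σ = weakeningF (I.subst σ) := by
  simp [weakeningF]

theorem weakeningF_elim {I : Tm Γ .nt} (h : PDer H (weakeningF I)) {L L' : Tm Γ .lst}
    {B : Tm Γ .prp} (hL : PDer H (subsetF L L')) (hB : PDer H (seqF I L B)) :
    PDer H (seqF I L' B) := by
  have h := (h.all_elim L).all_elim L'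
  simpa using (h.all_elim B).imp_elim (by simpa using .andR hL hB)

theorem weakeningF_intro {I : Tm Γ .nt}
    (k : ∀ (Δ : Ctx) (σ : Sub Γ Δ) (H' : Multiset (Fm Δ)), PExt σ H H' →
      ∀ (L L' : Tm Δ .lst) (B : Tm Δ .prp), PDer H' (subsetF L L') → SeqStep H' (I.subst σ) L B →
        PDer H' (seqF (I.subst σ) L' B)) : PDer H (weakeningF I) := by
  refine .all₃_imp_intro fun Δ σ H' e L L' B h => ?_
  refine Der.seq_elim h.and_right fun Θ τ K e' hB => ?_
  have hL := e' h.and_left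
  simp at hL hB ⊢
  simpa [← Tm.subst_subst] using k Θ _ K (e.trans e') _ _ _ hL
    (by simpa [← Tm.subst_subst] using hB)

/-- Induction on the height. Lists are compared through their elements only, so adding the
hypothesis of an implication to both sides preserves the inclusion. -/
theorem weakeningF_of_nat {I : Tm Γ .nt} (h : PDer H (.nat I)) : PDer H (weakeningF I) := by
  refine Der.nat_induction (fun I => weakeningF I) (by intros; simp) (fun H => ?_)
    (fun H I hI h => ?_) h
  · refine weakeningF_intro fun Δ σ H' e L L' B hL hB => .seq_intro ?_
    generalize hI : z.subst σ = I at hB ⊢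
    cases hB with
    | init h => exact .init (subsetF_elim hL h)
    | tt => exact .tt
    | _ => exact (Tm.absurd_of_headCode_ne hI (by simp)).elim
  · refine weakeningF_intro fun Δ σ H' e L L' B hL hB => .seq_intro ?_
    have h := e h
    simp only [weakeningF_subst, s_subst] at h hB ⊢
    generalize hI : s (I.subst σ) = J at hB
    cases hB with
    | init h => exact .init (subsetF_elim hL h)
    | tt => exact .tt
    | amp h₁ h₂ =>
      obtain rfl := s_inj.1 hI
      exact .amp (weakeningF_elim h hL h₁) (weakeningF_elim h hL h₂)
    | oimp h₁ =>
      obtain rfl := s_inj.1 hI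
      exact .oimp (weakeningF_elim h (subsetF_cons hL _) h₁)
    | prog hP h₁ =>
      obtain rfl := s_inj.1 hI
      exact .prog hP (weakeningF_elim h hL h₁)
    | oall h₁ =>
      obtain rfl := s_inj.1 hI
      refine .oall (.all_intro fun Θ τ K e' N => ?_)
      have h := e' h
      have hL := e' hL
      have h₁ := (e' h₁).all_elim N
      simp at h hL h₁ ⊢
      exact weakeningF_elim h hL h₁

/-! Cut -/

/-- The elements of `L` have derivations of height `K` from `L'`. -/
noncomputable def coverF (K : Tm Γ .nt) (L L' : Tm Γ .lst) : Fm Γ :=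
  .all .atm (.imp (elementF v0 L.weaken) (seqF K.weaken L'.weaken (atom v0)))

@[simp] theorem coverF_subst (σ : Sub Γ Δ) (K : Tm Γ .nt) (L L' : Tm Γ .lst) :
    (coverF K L L').subst σ = coverF (K.subst σ) (L.subst σ) (L'.subst σ) := by
  simp [coverF]

theorem coverF_intro {K : Tm Γ .nt} {L L' : Tm Γ .lst}
    (k : ∀ (Δ : Ctx) (σ : Sub Γ Δ) (H' : Multiset (Fm Δ)), PExt σ H H' →
      ∀ X : Tm Δ .atm, PDer H' (elementF X (L.subst σ)) →
        PDer H' (seqF (K.subst σ) (L'.subst σ) (atom X))) :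
    PDer H (coverF K L L') :=
  .all_imp_intro fun Δ σ H' e X h => by simpa using k Δ σ H' e X (by simpa using h)

theorem coverF_elim {K : Tm Γ .nt} {L L' : Tm Γ .lst} (h : PDer H (coverF K L L')) {X : Tm Γ .atm}
    (h' : PDer H (elementF X L)) : PDer H (seqF K L' (atom X)) := by
  simpa using (h.all_elim X).imp_elim (by simpa using h')

/-- The new hypothesis is covered by an initial sequent, which has every height. The old derivations
are weakened by it, and weakening at height `K` needs `nat K`. -/
theorem coverF_cons {K : Tm Γ .nt} {L L' : Tm Γ .lst} (hK : PDer H (.nat K))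
    (h : PDer H (coverF K L L')) (A : Tm Γ .atm) : PDer H (coverF K (cons A L) (cons A L')) := by
  refine coverF_intro fun Δ σ H' e X hX => hX.element_elim (fun Θ τ J e' M hM => ?_)
    (fun Θ τ J e' Y M hM hX => ?_)
  · simp at hM ⊢
    rw [hM.1]
    exact .seq_intro (.init (.element_head _ _))
  · have h := e' (e h)
    have hK := e' (e hK)
    simp at h hM hK ⊢
    exact weakeningF_elim (weakeningF_of_nat hK) (subsetF_self_cons _ _)
      (coverF_elim h (hM.2 ▸ hX))

/-- A sequent of height `I` whose hypotheses have derivations of height `K` has a derivation of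
height `J`. -/
noncomputable def cutF (K I J : Tm Γ .nt) : Fm Γ :=
  .all .lst (.all .lst (.all .prp (.imp
    (.and (coverF K.weaken.weaken.weaken v2 v1) (seqF I.weaken.weaken.weaken v2 v0))
    (seqF J.weaken.weaken.weaken v1 v0))))

@[simp] theorem cutF_subst (σ : Sub Γ Δ) (K I J : Tm Γ .nt) :
    (cutF K I J).subst σ = cutF (K.subst σ) (I.subst σ) (J.subst σ) := by
  simp [cutF]

theorem cutF_elim {K I J : Tm Γ .nt} (h : PDer H (cutF K I J)) {L L' : Tm Γ .lst}
    {B : Tm Γ .prp} (hL : PDer H (coverF K L L')) (hB : PDer H (seqF I L B)) :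
    PDer H (seqF J L' B) := by
  have h := (h.all_elim L).all_elim L'
  simpa using (h.all_elim B).imp_elim (by simpa using .andR hL hB)

theorem cutF_intro {K I J : Tm Γ .nt}
    (k : ∀ (Δ : Ctx) (σ : Sub Γ Δ) (H' : Multiset (Fm Δ)), PExt σ H H' →
      ∀ (L L' : Tm Δ .lst) (B : Tm Δ .prp), PDer H' (coverF (K.subst σ) L L') →
        SeqStep H' (I.subst σ) L B → PDer H' (seqF (J.subst σ) L' B)) : PDer H (cutF K I J) := by
  refine .all₃_imp_intro fun Δ σ H' e L L' B h => ?_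
  refine Der.seq_elim h.and_right fun Θ τ M e' hB => ?_
  have hL := e' h.and_left
  simp at hL hB ⊢
  simpa [← Tm.subst_subst] using k Θ _ M (e.trans e') _ _ _ (by simpa [← Tm.subst_subst] using hL)
    (by simpa [← Tm.subst_subst] using hB)

/-- A derivation of height `z` is a leaf: either a hypothesis, replaced by its covering derivation,
or `tt`. -/
theorem cutF_z (K : Tm Γ .nt) : PDer H (cutF K z K) := by
  refine cutF_intro fun Δ σ H' e L L' B hL hB => ?_
  generalize hI : z.subst σ = I at hB
  cases hB with
  | init h => exact coverF_elim hL h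
  | tt => exact .seq_intro .tt
  | _ => exact (Tm.absurd_of_headCode_ne hI (by simp)).elim

/-- At a hypothesis the grafted derivation has height `K`, and `hKJ` raises it to `s J`. All other
steps cut in their premises. -/
theorem cutF_s {K I J : Tm Γ .nt} (hK : PDer H (.nat K)) (hKJ : PDer H (monoF K (s J)))
    (h : PDer H (cutF K I J)) : PDer H (cutF K (s I) (s J)) := by
  refine cutF_intro fun Δ σ H' e L L' B hL hB => ?_
  have h := e h
  have hK := e hK
  have hKJ := e hKJ
  simp only [cutF_subst, monoF_subst, Fm.subst, s_subst] at h hB hK hKJ ⊢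
  generalize hI : s (I.subst σ) = M at hB
  cases hB with
  | init h => exact monoF_elim hKJ (coverF_elim hL h)
  | tt => exact .seq_intro .tt
  | amp h₁ h₂ =>
    obtain rfl := s_inj.1 hI
    exact .seq_intro (.amp (cutF_elim h hL h₁) (cutF_elim h hL h₂))
  | oimp h₁ =>
    obtain rfl := s_inj.1 hI
    exact .seq_intro (.oimp (cutF_elim h (coverF_cons hK hL _) h₁))
  | prog hP h₁ =>
    obtain rfl := s_inj.1 hI
    exact .seq_intro (.prog hP (cutF_elim h hL h₁))
  | oall h₁ =>
    obtain rfl := s_inj.1 hI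
    refine .seq_intro (.oall (.all_intro fun Θ τ M e' N => ?_))
    have h := e' h
    have hL := e' hL
    have h₁ := (e' h₁).all_elim N
    simp at h hL h₁ ⊢
    exact cutF_elim h hL h₁

/-- The height is in effect `K + I`: it starts at `K` and grows by one per step. The invariant also
records that it dominates `K`, as `cutF_s` requires. -/
theorem exists_cut_height {K I : Tm Γ .nt} (hK : PDer H (.nat K)) (hI : PDer H (.nat I)) :
    PDer H (.ex .nt (.and (.nat v0) (cutF K.weaken I.weaken v0))) := by
  have h := Der.nat_induction (D := pcfDefinition) (H := H) (I := I)
    (fun I => .all .nt (.imp (.nat v0) (.ex .nt (.and (.nat v0)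
      (.and (monoF v1 v0) (cutF v1 I.weaken.weaken v0))))))
    (by intros; simp) ?_ ?_ hI
  · have h := (h.all_elim K).imp_elim (by simpa using hK)
    refine h.ex_elim fun Δ σ H' e J h => .ex_intro J ?_
    simp at h ⊢
    exact .andR h.and_left h.and_right.and_right
  · refine fun H => .all_imp_intro fun Δ σ H' e K hK => Der.ex_intro K ?_
    simp at hK ⊢
    exact .andR hK (.andR (monoF_refl _) (cutF_z _))
  · refine fun H I hI h => .all_imp_intro fun Δ σ H' e K hK => ?_
    have h := ((e h).all_elim K).imp_elim (by simpa using hK)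
    refine h.ex_elim fun Θ τ M e' J hJ => ?_
    have hK := e' hK
    simp at hJ hK ⊢
    refine .ex_intro (s J) ?_
    simp
    have hKJ := monoF_trans hJ.and_right.and_left (monoF_self_s hJ.and_left)
    exact .andR (.natRsucc hJ.and_left) (.andR hKJ (cutF_s hK hKJ hJ.and_right.and_right))

/-! Provability -/

theorem prvFrom_intro {I : Tm Γ .nt} {L : Tm Γ .lst} {B : Tm Γ .prp} (hI : PDer H (.nat I))
    (h : PDer H (seqF I L B)) : PDer H (prvFrom L B) :=
  .ex_intro I (by simpa using .andR hI h)

theorem prvFrom_elim {L : Tm Γ .lst} {B : Tm Γ .prp} {C : Fm Γ} (h : PDer H (prvFrom L B))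
    (k : ∀ (Δ : Ctx) (σ : Sub Γ Δ) (H' : Multiset (Fm Δ)), PExt σ H H' → ∀ I : Tm Δ .nt,
      PDer H' (.nat I) → PDer H' (seqF I (L.subst σ) (B.subst σ)) → PDer H' (C.subst σ)) :
    PDer H C := by
  refine Der.ex_elim h fun Δ σ H' e I h => ?_
  simp at h
  exact k Δ σ H' e I h.and_left h.and_right

theorem prv_tt : PDer H (prv tt) := prvFrom_intro .natRzero (.seq_intro .tt)

theorem prv_atom_intro {A : Tm Γ .atm} {G : Tm Γ .prp} (hP : Prog A G) (h : PDer H (prv G)) :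
    PDer H (prv (atom A)) := by
  refine prvFrom_elim h fun Δ σ H' e I hI h => ?_
  rw [prv_subst, atom_subst]
  exact prvFrom_intro (.natRsucc hI) (.seq_intro (.prog (hP.subst σ) h))

/-- The clause for `&` wants both premises at one height, so a common bound is taken first. -/
theorem prv_amp_intro {B C : Tm Γ .prp} (hB : PDer H (prv B)) (hC : PDer H (prv C)) :
    PDer H (prv (amp B C)) := by
  refine prvFrom_elim hB fun Δ σ H' e I hI hB => prvFrom_elim
    (by simpa using e hC : PDer H' (prv (C.subst σ))) fun Θ τ K e' J hJ hC => ?_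
  have hI := e' hI
  have hB := e' hB
  refine (exists_common_height hI hJ).ex_elim fun Ξ ρ M e'' N hN => ?_
  have hB := e'' hB
  have hC := e'' hC
  simp at hB hC hN ⊢
  exact prvFrom_intro (.natRsucc hN.and_left) (.seq_intro
    (.amp (monoF_elim hN.and_right.and_left hB) (monoF_elim hN.and_right.and_right hC)))

theorem prv_amp_elim {B C : Tm Γ .prp} (h : PDer H (prv (amp B C))) :
    PDer H (prv B) ∧ PDer H (prv C) := by
  constructor
  all_goals
    refine prvFrom_elim h fun Δ σ H' e I hI h => ?_
    rw [amp_subst] at h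
    rw [prv_subst]
  · exact prvFrom_intro hI (seqF_amp_elim hI h).1
  · exact prvFrom_intro hI (seqF_amp_elim hI h).2

theorem Der.not_element_nil {X : Tm Γ .atm} {C : Fm Γ} (h : PDer H (elementF X nil)) :
    PDer H C :=
  h.element_elim (fun _ _ _ _ _ h => (Tm.absurd_of_headCode_ne h (by simp)).elim)
    (fun _ _ _ _ _ _ h => (Tm.absurd_of_headCode_ne h (by simp)).elim)

/-- The last step in the derivation of an atom from no hypotheses. -/
theorem seqF_nil_elim {I : Tm Γ .nt} {A : Tm Γ .atm} {C : Fm Γ}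
    (h : PDer H (seqF I nil (atom A)))
    (k : ∀ (Δ : Ctx) (σ : Sub Γ Δ) (H' : Multiset (Fm Δ)), PExt σ H H' →
      ∀ (J : Tm Δ .nt) (G : Tm Δ .prp), I.subst σ = s J → Prog (A.subst σ) G →
        PDer H' (seqF J nil G) → PDer H' (C.subst σ)) : PDer H C := by
  refine h.seq_elim fun Δ σ H' e h => ?_
  rw [atom_subst] at h
  rcases h.atom_inv with h | ⟨J, G, hJ, hP, h⟩
  · exact Der.not_element_nil h
  · exact k Δ σ H' e J G hJ hP h

theorem prv_atom_elim {A : Tm Γ .atm} {C : Fm Γ} (h : PDer H (prv (atom A)))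
    (k : ∀ (Δ : Ctx) (σ : Sub Γ Δ) (H' : Multiset (Fm Δ)), PExt σ H H' →
      ∀ G : Tm Δ .prp, Prog (A.subst σ) G → PDer H' (prv G) → PDer H' (C.subst σ)) :
    PDer H C := by
  refine prvFrom_elim h fun Δ σ H' e I hI h => ?_
  rw [atom_subst, nil_subst] at h
  refine seqF_nil_elim h fun Θ τ K e' J G hJ hP h => ?_
  have hI := e' hI
  rw [Fm.subst, hJ] at hI
  rw [Fm.subst_subst]
  refine k Θ _ K (e.trans e') G ?_ (prvFrom_intro hI.nat_pred h)
  rwa [← Tm.subst_subst]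

/-- The simultaneous cut, with the one-element list of `A` covered from `nil`. -/
theorem prv_cut {A : Tm Γ .atm} {B : Tm Γ .prp} (hA : PDer H (prv (atom A)))
    (hB : PDer H (prvFrom (cons A nil) B)) : PDer H (prv B) := by
  refine prvFrom_elim hA fun Δ σ H' e K hK hA => prvFrom_elim
    (by simpa using e hB : PDer H' (prvFrom (cons (A.subst σ) nil) (B.subst σ)))
    fun Θ τ M e' I hI hB => ?_
  have hA := e' hA
  have hK := e' hK
  refine (exists_cut_height hK hI).ex_elim fun Ξ ρ N e'' J hJ => ?_
  have hB := e'' hB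
  have hA := e'' hA
  simp at hB hA hJ ⊢
  refine prvFrom_intro hJ.and_left (cutF_elim hJ.and_right (coverF_intro ?_) hB)
  refine fun Ω π O f X hX => hX.element_elim (fun Ω' π' O' f' L' h => ?_)
    (fun Ω' π' O' f' Y L' h hX => ?_)
  · have hA := f' (f hA)
    simp at hA h ⊢
    rwa [← h.1]
  · simp at h
    rw [← h.2] at hX
    exact Der.not_element_nil hX

/-- Instantiation of a typing derivation for the body of an abstraction. -/
theorem prv_typeof_app {T U N : Tm Γ .i} {R : Tm Γ (.arr .i .i)}
    (h : PDer H (prv (oall (.lam (oimp (typeof v0 T.weaken)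
      (atom (typeof (R.weaken.app v0) U.weaken)))))))
    (hN : PDer H (prv (atom (typeof N T)))) : PDer H (prv (atom (typeof (R.app N) U))) := by
  -- This is the substitution lemma of typing: the bound variable is instantiated by `N`, and the
  -- hypothesis `N : T` that remains is cut against its derivation.
  refine prv_cut hN (prvFrom_elim h fun Δ σ H' e I hI h => ?_)
  rw [oall_subst] at h
  have h := seqF_oall_elim hI h (N.subst σ)
  simp [Tm.lam_app] at h ⊢
  exact prvFrom_intro hI (seqF_oimp_elim hI h)

end

/-! ### The object-level theory -/

section

variable {Γ : Ctx}

theorem Prog.of_mem {Δ : Ctx} {A : Tm Δ .atm} {G : Tm Δ .prp}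
    (hc : progClause Δ A G ∈ progClauses) (τ : Sub Δ Γ) : Prog (A.subst τ) (G.subst τ) :=
  ⟨_, hc, τ, rfl⟩

theorem getElem_typingClauses_mem (n : ℕ) (hn : n < typingClauses.length) :
    typingClauses[n] ∈ progClauses :=
  List.mem_append_left _ (List.mem_append_left _ (List.getElem_mem _))

theorem getElem_natsemClauses_mem (n : ℕ) (hn : n < natsemClauses.length) :
    natsemClauses[n] ∈ progClauses :=
  List.mem_append_left _ (List.mem_append_right _ (List.getElem_mem _))

theorem getElem_transClauses_mem (n : ℕ) (hn : n < transClauses.length) :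
    transClauses[n] ∈ progClauses :=
  List.mem_append_right _ (List.getElem_mem _)

/-- The goal `⋀ n (n : T ⇒ R n : U)`. -/
def bodyGoal (T : Tm Γ .i) (R : Tm Γ (.arr .i .i)) (U : Tm Γ .i) : Tm Γ .prp :=
  oall (.lam (oimp (typeof v0 T.weaken) (atom (typeof (R.weaken.app v0) U.weaken))))

/-- Instances of the typing clauses. -/
inductive TypeofProg : Tm Γ .i → Tm Γ .i → Tm Γ .prp → Prop
  | zero : TypeofProg zero num tt
  | tru : TypeofProg tru bool tt
  | fls : TypeofProg fls bool tt
  | succ (M : Tm Γ .i) : TypeofProg (succ M) num (atom (typeof M num))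
  | pred (M : Tm Γ .i) : TypeofProg (pred M) num (atom (typeof M num))
  | isZero (M : Tm Γ .i) : TypeofProg (isZero M) bool (atom (typeof M num))
  | cond (M N₁ N₂ T : Tm Γ .i) : TypeofProg (cond M N₁ N₂) T
      (amp (atom (typeof M bool)) (amp (atom (typeof N₁ T)) (atom (typeof N₂ T))))
  | abs (T : Tm Γ .i) (R : Tm Γ (.arr .i .i)) (U : Tm Γ .i) :
      TypeofProg (abs T R) (arrow T U) (bodyGoal T R U)
  | app (M N T U : Tm Γ .i) : TypeofProg (app M N) T
      (amp (atom (typeof M (arrow U T))) (atom (typeof N U)))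
  | fix (T : Tm Γ .i) (R : Tm Γ (.arr .i .i)) : TypeofProg (fix T R) T (bodyGoal T R T)

/-- Instances of the clauses of the natural semantics. -/
inductive NatsemProg : Tm Γ .i → Tm Γ .i → Tm Γ .prp → Prop
  | zero : NatsemProg zero zero tt
  | tru : NatsemProg tru tru tt
  | fls : NatsemProg fls fls tt
  | succ (M V : Tm Γ .i) : NatsemProg (succ M) (succ V) (atom (natsem M V))
  | predZero (M : Tm Γ .i) : NatsemProg (pred M) FOLDN.zero (atom (natsem M FOLDN.zero))
  | predSucc (M V : Tm Γ .i) : NatsemProg (pred M) V (atom (natsem M (FOLDN.succ V)))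
  | isZeroZero (M : Tm Γ .i) : NatsemProg (isZero M) FOLDN.tru (atom (natsem M FOLDN.zero))
  | isZeroSucc (M V : Tm Γ .i) :
      NatsemProg (isZero M) FOLDN.fls (atom (natsem M (FOLDN.succ V)))
  | condTru (M N₁ N₂ V : Tm Γ .i) : NatsemProg (cond M N₁ N₂) V
      (amp (atom (natsem M FOLDN.tru)) (atom (natsem N₁ V)))
  | condFls (M N₁ N₂ V : Tm Γ .i) : NatsemProg (cond M N₁ N₂) V
      (amp (atom (natsem M FOLDN.fls)) (atom (natsem N₂ V)))
  | abs (T : Tm Γ .i) (R : Tm Γ (.arr .i .i)) : NatsemProg (abs T R) (abs T R) tt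
  | app (M N V T : Tm Γ .i) (R : Tm Γ (.arr .i .i)) : NatsemProg (app M N) V
      (amp (atom (natsem M (FOLDN.abs T R))) (atom (natsem (R.app N) V)))
  | fix (T : Tm Γ .i) (R : Tm Γ (.arr .i .i)) (V : Tm Γ .i) :
      NatsemProg (fix T R) V (atom (natsem (R.app (fix T R)) V))

/-- Instances of the clauses for one step of the transition semantics. -/
inductive TransoneProg : Tm Γ .i → Tm Γ .i → Tm Γ .prp → Prop
  | succ (M M' : Tm Γ .i) : TransoneProg (succ M) (succ M') (atom (transone M M'))
  | predZero : TransoneProg (pred zero) zero tt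
  | predSucc (V : Tm Γ .i) : TransoneProg (pred (FOLDN.succ V)) V (atom (value V))
  | pred (M M' : Tm Γ .i) : TransoneProg (pred M) (pred M') (atom (transone M M'))
  | isZeroZero : TransoneProg (isZero zero) tru tt
  | isZeroSucc (V : Tm Γ .i) : TransoneProg (isZero (FOLDN.succ V)) fls (atom (value V))
  | isZero (M M' : Tm Γ .i) : TransoneProg (isZero M) (isZero M') (atom (transone M M'))
  | condTru (M N : Tm Γ .i) : TransoneProg (cond tru M N) M tt
  | condFls (M N : Tm Γ .i) : TransoneProg (cond fls M N) N tt
  | cond (M N₁ N₂ M' : Tm Γ .i) :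
      TransoneProg (cond M N₁ N₂) (cond M' N₁ N₂) (atom (transone M M'))
  | appAbs (T : Tm Γ .i) (R : Tm Γ (.arr .i .i)) (N : Tm Γ .i) :
      TransoneProg (app (abs T R) N) (R.app N) tt
  | app (M N M' : Tm Γ .i) : TransoneProg (app M N) (app M' N) (atom (transone M M'))
  | fix (T : Tm Γ .i) (R : Tm Γ (.arr .i .i)) : TransoneProg (fix T R) (R.app (fix T R)) tt

/-- Instances of the clauses for finitely many steps of the transition semantics. -/
inductive TranssemProg : Tm Γ .i → Tm Γ .i → Tm Γ .prp → Prop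
  | refl (M : Tm Γ .i) : TranssemProg M M tt
  | step (M N M' : Tm Γ .i) : TranssemProg M N (amp (atom (transone M M')) (atom (transsem M' N)))

/-- Instances of the clauses for values. -/
inductive ValueProg : Tm Γ .i → Tm Γ .prp → Prop
  | zero : ValueProg zero tt
  | tru : ValueProg tru tt
  | fls : ValueProg fls tt
  | succ (V : Tm Γ .i) : ValueProg (succ V) (atom (value V))
  | abs (T : Tm Γ .i) (R : Tm Γ (.arr .i .i)) : ValueProg (abs T R) tt

/-- Head constants separate the five judgements, which discards all clauses except those for typing;
for these, injectivity identifies the arguments. The four inversions that follow have the same form.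
-/
theorem Prog.typeof {M T : Tm Γ .i} {G : Tm Γ .prp} (h : Prog (typeof M T) G) :
    TypeofProg M T G := by
  obtain ⟨c, hc, τ, h⟩ := h
  simp only [progClauses, typingClauses, natsemClauses, transClauses, List.mem_append,
    List.mem_cons, List.not_mem_nil, or_false, or_assoc] at hc
  repeat' rcases hc with hc | hc
  all_goals
    dsimp only [progClause] at τ h
    obtain ⟨hA, hG⟩ := Atom.prog.inj h
    simp only [typeof_subst, natsem_subst, transone_subst, transsem_subst, value_subst] at hA
    first
    | (exfalso; refine Tm.absurd_of_headCode_ne hA ?_; simp; done)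
    | simp at hA hG
      obtain ⟨rfl, rfl⟩ := hA
      subst hG
      constructor

theorem Prog.natsem {M V : Tm Γ .i} {G : Tm Γ .prp} (h : Prog (natsem M V) G) :
    NatsemProg M V G := by
  obtain ⟨c, hc, τ, h⟩ := h
  simp only [progClauses, typingClauses, natsemClauses, transClauses, List.mem_append,
    List.mem_cons, List.not_mem_nil, or_false, or_assoc] at hc
  repeat' rcases hc with hc | hc
  all_goals
    dsimp only [progClause] at τ h
    obtain ⟨hA, hG⟩ := Atom.prog.inj h
    simp only [typeof_subst, natsem_subst, transone_subst, transsem_subst, value_subst] at hA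
    first
    | (exfalso; refine Tm.absurd_of_headCode_ne hA ?_; simp; done)
    | simp at hA hG
      obtain ⟨rfl, rfl⟩ := hA
      subst hG
      constructor

theorem Prog.transone {M N : Tm Γ .i} {G : Tm Γ .prp} (h : Prog (transone M N) G) :
    TransoneProg M N G := by
  obtain ⟨c, hc, τ, h⟩ := h
  simp only [progClauses, typingClauses, natsemClauses, transClauses, List.mem_append,
    List.mem_cons, List.not_mem_nil, or_false, or_assoc] at hc
  repeat' rcases hc with hc | hc
  all_goals
    dsimp only [progClause] at τ h
    obtain ⟨hA, hG⟩ := Atom.prog.inj h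
    simp only [typeof_subst, natsem_subst, transone_subst, transsem_subst, value_subst] at hA
    first
    | (exfalso; refine Tm.absurd_of_headCode_ne hA ?_; simp; done)
    | simp at hA hG
      obtain ⟨rfl, rfl⟩ := hA
      subst hG
      constructor

theorem Prog.transsem {M N : Tm Γ .i} {G : Tm Γ .prp} (h : Prog (transsem M N) G) :
    TranssemProg M N G := by
  obtain ⟨c, hc, τ, h⟩ := h
  simp only [progClauses, typingClauses, natsemClauses, transClauses, List.mem_append,
    List.mem_cons, List.not_mem_nil, or_false, or_assoc] at hc
  repeat' rcases hc with hc | hc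
  all_goals
    dsimp only [progClause] at τ h
    obtain ⟨hA, hG⟩ := Atom.prog.inj h
    simp only [typeof_subst, natsem_subst, transone_subst, transsem_subst, value_subst] at hA
    first
    | (exfalso; refine Tm.absurd_of_headCode_ne hA ?_; simp; done)
    | simp at hA hG
      obtain ⟨rfl, rfl⟩ := hA
      subst hG
      constructor

theorem Prog.value {V : Tm Γ .i} {G : Tm Γ .prp} (h : Prog (value V) G) : ValueProg V G := by
  obtain ⟨c, hc, τ, h⟩ := h
  simp only [progClauses, typingClauses, natsemClauses, transClauses, List.mem_append,
    List.mem_cons, List.not_mem_nil, or_false, or_assoc] at hc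
  repeat' rcases hc with hc | hc
  all_goals
    dsimp only [progClause] at τ h
    obtain ⟨hA, hG⟩ := Atom.prog.inj h
    simp only [typeof_subst, natsem_subst, transone_subst, transsem_subst, value_subst] at hA
    first
    | (exfalso; refine Tm.absurd_of_headCode_ne hA ?_; simp; done)
    | simp at hA hG
      obtain rfl := hA
      subst hG
      constructor

/-- Each clause is named by its position in the list, and the substitution gives the values of its
variables in de Bruijn order. -/
theorem TypeofProg.prog {M T : Tm Γ .i} {G : Tm Γ .prp} (h : TypeofProg M T G) :
    Prog (FOLDN.typeof M T) G := by
  cases h with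
  | zero => simpa using Prog.of_mem (getElem_typingClauses_mem 0 (by decide)) (Γ := Γ) Sub.empty
  | tru => simpa using Prog.of_mem (getElem_typingClauses_mem 1 (by decide)) (Γ := Γ) Sub.empty
  | fls => simpa using Prog.of_mem (getElem_typingClauses_mem 2 (by decide)) (Γ := Γ) Sub.empty
  | succ M =>
    simpa using Prog.of_mem (getElem_typingClauses_mem 3 (by decide)) (Sub.cons M Sub.empty)
  | pred M =>
    simpa using Prog.of_mem (getElem_typingClauses_mem 4 (by decide)) (Sub.cons M Sub.empty)
  | isZero M =>
    simpa using Prog.of_mem (getElem_typingClauses_mem 5 (by decide)) (Sub.cons M Sub.empty)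
  | cond M N₁ N₂ T =>
    simpa using Prog.of_mem (getElem_typingClauses_mem 6 (by decide))
      (Sub.cons M (Sub.cons N₁ (Sub.cons N₂ (Sub.cons T Sub.empty))))
  | abs T R U =>
    simpa [bodyGoal] using Prog.of_mem (getElem_typingClauses_mem 7 (by decide))
      (Sub.cons T (Sub.cons R (Sub.cons U Sub.empty)))
  | app M N T U =>
    simpa using Prog.of_mem (getElem_typingClauses_mem 8 (by decide))
      (Sub.cons M (Sub.cons N (Sub.cons T (Sub.cons U Sub.empty))))
  | fix T R =>
    simpa [bodyGoal] using Prog.of_mem (getElem_typingClauses_mem 9 (by decide))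
      (Sub.cons T (Sub.cons R Sub.empty))

theorem NatsemProg.prog {M V : Tm Γ .i} {G : Tm Γ .prp} (h : NatsemProg M V G) :
    Prog (FOLDN.natsem M V) G := by
  cases h with
  | zero => simpa using Prog.of_mem (getElem_natsemClauses_mem 0 (by decide)) (Γ := Γ) Sub.empty
  | tru => simpa using Prog.of_mem (getElem_natsemClauses_mem 1 (by decide)) (Γ := Γ) Sub.empty
  | fls => simpa using Prog.of_mem (getElem_natsemClauses_mem 2 (by decide)) (Γ := Γ) Sub.empty
  | succ M V =>
    simpa using Prog.of_mem (getElem_natsemClauses_mem 3 (by decide))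
      (Sub.cons M (Sub.cons V Sub.empty))
  | predZero M =>
    simpa using Prog.of_mem (getElem_natsemClauses_mem 4 (by decide)) (Sub.cons M Sub.empty)
  | predSucc M V =>
    simpa using Prog.of_mem (getElem_natsemClauses_mem 5 (by decide))
      (Sub.cons M (Sub.cons V Sub.empty))
  | isZeroZero M =>
    simpa using Prog.of_mem (getElem_natsemClauses_mem 6 (by decide)) (Sub.cons M Sub.empty)
  | isZeroSucc M V =>
    simpa using Prog.of_mem (getElem_natsemClauses_mem 7 (by decide))
      (Sub.cons M (Sub.cons V Sub.empty))
  | condTru M N₁ N₂ V =>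
    simpa using Prog.of_mem (getElem_natsemClauses_mem 8 (by decide))
      (Sub.cons M (Sub.cons N₁ (Sub.cons N₂ (Sub.cons V Sub.empty))))
  | condFls M N₁ N₂ V =>
    simpa using Prog.of_mem (getElem_natsemClauses_mem 9 (by decide))
      (Sub.cons M (Sub.cons N₁ (Sub.cons N₂ (Sub.cons V Sub.empty))))
  | abs T R =>
    simpa using Prog.of_mem (getElem_natsemClauses_mem 10 (by decide))
      (Sub.cons T (Sub.cons R Sub.empty))
  | app M N V T R =>
    simpa using Prog.of_mem (getElem_natsemClauses_mem 11 (by decide))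
      (Sub.cons M (Sub.cons N (Sub.cons V (Sub.cons T (Sub.cons R Sub.empty)))))
  | fix T R V =>
    simpa using Prog.of_mem (getElem_natsemClauses_mem 12 (by decide))
      (Sub.cons T (Sub.cons R (Sub.cons V Sub.empty)))

theorem TransoneProg.prog {M N : Tm Γ .i} {G : Tm Γ .prp} (h : TransoneProg M N G) :
    Prog (FOLDN.transone M N) G := by
  cases h with
  | succ M M' =>
    simpa using Prog.of_mem (getElem_transClauses_mem 0 (by decide))
      (Sub.cons M (Sub.cons M' Sub.empty))
  | predZero =>
    simpa using Prog.of_mem (getElem_transClauses_mem 1 (by decide)) (Γ := Γ) Sub.empty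
  | predSucc V =>
    simpa using Prog.of_mem (getElem_transClauses_mem 2 (by decide)) (Sub.cons N Sub.empty)
  | pred M M' =>
    simpa using Prog.of_mem (getElem_transClauses_mem 3 (by decide))
      (Sub.cons M (Sub.cons M' Sub.empty))
  | isZeroZero =>
    simpa using Prog.of_mem (getElem_transClauses_mem 4 (by decide)) (Γ := Γ) Sub.empty
  | isZeroSucc V =>
    simpa using Prog.of_mem (getElem_transClauses_mem 5 (by decide)) (Sub.cons V Sub.empty)
  | isZero M M' =>
    simpa using Prog.of_mem (getElem_transClauses_mem 6 (by decide))
      (Sub.cons M (Sub.cons M' Sub.empty))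
  | condTru M N' =>
    simpa using Prog.of_mem (getElem_transClauses_mem 7 (by decide))
      (Sub.cons N (Sub.cons N' Sub.empty))
  | condFls M N' =>
    simpa using Prog.of_mem (getElem_transClauses_mem 8 (by decide))
      (Sub.cons M (Sub.cons N Sub.empty))
  | cond M N₁ N₂ M' =>
    simpa using Prog.of_mem (getElem_transClauses_mem 9 (by decide))
      (Sub.cons M (Sub.cons N₁ (Sub.cons N₂ (Sub.cons M' Sub.empty))))
  | appAbs T R N =>
    simpa using Prog.of_mem (getElem_transClauses_mem 10 (by decide))
      (Sub.cons T (Sub.cons R (Sub.cons N Sub.empty)))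
  | app M N M' =>
    simpa using Prog.of_mem (getElem_transClauses_mem 11 (by decide))
      (Sub.cons M (Sub.cons N (Sub.cons M' Sub.empty)))
  | fix T R =>
    simpa using Prog.of_mem (getElem_transClauses_mem 12 (by decide))
      (Sub.cons T (Sub.cons R Sub.empty))

theorem TranssemProg.prog {M N : Tm Γ .i} {G : Tm Γ .prp} (h : TranssemProg M N G) :
    Prog (FOLDN.transsem M N) G := by
  cases h with
  | refl =>
    simpa using Prog.of_mem (getElem_transClauses_mem 13 (by decide)) (Sub.cons M Sub.empty)
  | step _ M' =>
    simpa using Prog.of_mem (getElem_transClauses_mem 14 (by decide))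
      (Sub.cons M (Sub.cons N (Sub.cons M' Sub.empty)))

theorem ValueProg.prog {V : Tm Γ .i} {G : Tm Γ .prp} (h : ValueProg V G) :
    Prog (FOLDN.value V) G := by
  cases h with
  | zero => simpa using Prog.of_mem (getElem_transClauses_mem 15 (by decide)) (Γ := Γ) Sub.empty
  | tru => simpa using Prog.of_mem (getElem_transClauses_mem 16 (by decide)) (Γ := Γ) Sub.empty
  | fls => simpa using Prog.of_mem (getElem_transClauses_mem 17 (by decide)) (Γ := Γ) Sub.empty
  | succ V =>
    simpa using Prog.of_mem (getElem_transClauses_mem 18 (by decide)) (Sub.cons V Sub.empty)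
  | abs T R =>
    simpa using Prog.of_mem (getElem_transClauses_mem 19 (by decide))
      (Sub.cons T (Sub.cons R Sub.empty))

end

/-! ### Induction on derivations of the object logic -/

/-- Families of object-level atoms with two parameters. -/
abbrev AtmFam : Type := ∀ Γ : Ctx, Tm Γ .i → Tm Γ .i → Tm Γ .atm

/-- Families of formulas with three parameters. -/
abbrev FmFam (a : Ty) : Type := ∀ Γ : Ctx, Tm Γ .i → Tm Γ .i → Tm Γ a → Fm Γ

/-- The family commutes with substitution. -/
abbrev AtmFam.Natural (A : AtmFam) : Prop :=
  ∀ (Γ Δ : Ctx) (σ : Sub Γ Δ) (m v : Tm Γ .i), (A Γ m v).subst σ = A Δ (m.subst σ) (v.subst σ)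

/-- The family commutes with substitution. -/
abbrev FmFam.Natural {a : Ty} (P : FmFam a) : Prop :=
  ∀ (Γ Δ : Ctx) (σ : Sub Γ Δ) (m v : Tm Γ .i) (u : Tm Γ a),
    (P Γ m v u).subst σ = P Δ (m.subst σ) (v.subst σ) (u.subst σ)

section

variable {a : Ty} {A : AtmFam} {P C : FmFam a} {Γ Δ : Ctx} {H : Multiset (Fm Γ)}

/-- `P m v u ⊃ C m v u` for all derivations of height `I` of the atom `A m v`. -/
noncomputable def indF (A : AtmFam) (P C : FmFam a) (I : Tm Γ .nt) : Fm Γ :=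
  .all .i (.all .i (.all a (.imp
    (.and (seqF I.weaken.weaken.weaken nil (atom (A _ v2 v1))) (P _ v2 v1 v0)) (C _ v2 v1 v0))))

/-- The goal `G` has a derivation of a height for which the induction hypothesis holds. -/
def SubDer (A : AtmFam) (P C : FmFam a) (H : Multiset (Fm Γ)) (G : Tm Γ .prp) : Prop :=
  ∃ I : Tm Γ .nt, PDer H (.nat I) ∧ PDer H (indF A P C I) ∧ PDer H (seqF I nil G)

theorem SubDer.prv {G : Tm Γ .prp} (h : SubDer A P C H G) : PDer H (prv G) := by
  obtain ⟨I, hI, _, h⟩ := h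
  exact prvFrom_intro hI h

/-- `seqF_amp_elim` does not change the height, so the induction hypothesis remains usable for each
conjunct. -/
theorem SubDer.amp {B B' : Tm Γ .prp} (h : SubDer A P C H (amp B B')) :
    SubDer A P C H B ∧ SubDer A P C H B' := by
  obtain ⟨I, hI, hi, h⟩ := h
  have h := seqF_amp_elim hI h
  exact ⟨⟨I, hI, hi, h.1⟩, ⟨I, hI, hi, h.2⟩⟩

theorem indF_subst (hA : A.Natural) (hP : P.Natural) (hC : C.Natural) (σ : Sub Γ Δ)
    (I : Tm Γ .nt) : (indF A P C I).subst σ = indF A P C (I.subst σ) := by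
  simp [indF, hA, hP, hC]

theorem indF_elim (hA : A.Natural) (hP : P.Natural) (hC : C.Natural) {I : Tm Γ .nt}
    (h : PDer H (indF A P C I)) {m v : Tm Γ .i} {u : Tm Γ a}
    (hs : PDer H (seqF I nil (atom (A _ m v)))) (hm : PDer H (P _ m v u)) :
    PDer H (C _ m v u) := by
  have h := (h.all_elim m).all_elim v
  simpa [hA, hP, hC] using (h.all_elim u).imp_elim (by simpa [hA, hP, hC] using .andR hs hm)

theorem SubDer.ext (hA : A.Natural) (hP : P.Natural) (hC : C.Natural) {G : Tm Γ .prp}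
    (h : SubDer A P C H G) {σ : Sub Γ Δ} {H' : Multiset (Fm Δ)} (e : PExt σ H H') :
    SubDer A P C H' (G.subst σ) := by
  obtain ⟨I, hI, hi, h⟩ := h
  have hi := e hi
  rw [indF_subst hA hP hC] at hi
  exact ⟨_, e hI, hi, e h⟩

theorem SubDer.induction_hypothesis (hA : A.Natural) (hP : P.Natural) (hC : C.Natural)
    {m v : Tm Γ .i} {u : Tm Γ a} (h : SubDer A P C H (atom (A _ m v)))
    (hm : PDer H (P _ m v u)) : PDer H (C _ m v u) := by
  obtain ⟨I, _, hi, hs⟩ := h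
  exact indF_elim hA hP hC hi hs hm

/-- Induction on a derivation of `A m v` in the object logic. -/
theorem prv_induction (hA : A.Natural) (hP : P.Natural) (hC : C.Natural)
    (step : ∀ (Γ : Ctx) (H : Multiset (Fm Γ)) (m v : Tm Γ .i) (u : Tm Γ a) (G : Tm Γ .prp),
      Prog (A _ m v) G → PDer H (P _ m v u) → SubDer A P C H G →
      (∀ {m v : Tm Γ .i} {u : Tm Γ a}, SubDer A P C H (atom (A _ m v)) → PDer H (P _ m v u) →
        PDer H (C _ m v u)) → PDer H (C _ m v u))
    {m v : Tm Γ .i} {u : Tm Γ a} (h : PDer H (prv (atom (A _ m v)))) (hm : PDer H (P _ m v u)) :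
    PDer H (C _ m v u) := by
  refine prvFrom_elim h fun Δ σ H' e I hI h => ?_
  have hm := e hm
  rw [nil_subst, atom_subst, hA] at h
  rw [hP] at hm
  rw [hC]
  refine indF_elim hA hP hC (Der.nat_induction (fun I => indF A P C I) (indF_subst hA hP hC)
    (fun H => ?_) (fun H I hI hi => ?_) hI) h hm
  -- Without hypotheses an atom can only come from a program clause, whose height is a successor;
  -- height `z` is vacuous.
  · refine .all₃_imp_intro fun Δ σ H' e m v u h => ?_
    have hs := Der.and_left h
    simp [hA] at hs
    refine seqF_nil_elim hs fun Θ τ K e' J G hJ _ _ => ?_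
    exact (Tm.absurd_of_headCode_ne hJ (by simp)).elim
  · refine .all₃_imp_intro fun Δ σ H' e m v u h => ?_
    have hs := Der.and_left h
    have hm := Der.and_right h
    simp [hA, hP, hC] at hs hm ⊢
    refine seqF_nil_elim hs fun Θ τ K e' J G hJ hG hs => ?_
    have hI := e' (e hI)
    have hi := e' (e hi)
    have hm := e' hm
    simp only [hA, hP, hC, indF_subst hA hP hC, Fm.subst, s_subst, s_inj] at hI hi hm hJ hG ⊢
    subst hJ
    exact step _ _ _ _ _ _ hG hm ⟨_, hI, hi, hs⟩ (SubDer.induction_hypothesis hA hP hC)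

/-- Induction on a derivation of `A m v` in the object logic, with an analysis of the last step
of a derivation of `B m v u`. -/
theorem prv_induction₂ (hA : A.Natural) (hP : P.Natural) (hC : C.Natural)
    (B : ∀ Γ : Ctx, Tm Γ .i → Tm Γ .i → Tm Γ a → Tm Γ .atm)
    (hB : ∀ (Γ Δ : Ctx) (σ : Sub Γ Δ) (m v : Tm Γ .i) (u : Tm Γ a),
      (B _ m v u).subst σ = B _ (m.subst σ) (v.subst σ) (u.subst σ))
    (hPB : ∀ (Γ : Ctx) (H : Multiset (Fm Γ)) (m v : Tm Γ .i) (u : Tm Γ a), PDer H (P _ m v u) →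
      PDer H (prv (atom (B _ m v u))))
    (step : ∀ (Γ : Ctx) (H : Multiset (Fm Γ)) (m v : Tm Γ .i) (u : Tm Γ a) (G G' : Tm Γ .prp),
      Prog (A _ m v) G → Prog (B _ m v u) G' → PDer H (P _ m v u) → PDer H (prv G') →
      SubDer A P C H G →
      (∀ {m v : Tm Γ .i} {u : Tm Γ a}, SubDer A P C H (atom (A _ m v)) → PDer H (P _ m v u) →
        PDer H (C _ m v u)) → PDer H (C _ m v u))
    {m v : Tm Γ .i} {u : Tm Γ a} (h : PDer H (prv (atom (A _ m v)))) (hm : PDer H (P _ m v u)) :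
    PDer H (C _ m v u) := by
  refine prv_induction hA hP hC (fun Γ H m v u G hG hm hs ih => ?_) h hm
  refine prv_atom_elim (hPB _ _ _ _ _ hm) fun Δ σ H' e G' hG' h' => ?_
  have hm := e hm
  rw [hB] at hG'
  rw [hP] at hm
  rw [hC]
  exact step _ _ _ _ _ _ _ (hA _ _ σ m v ▸ hG.subst σ) hG' hm h' (hs.ext hA hP hC e)
    (SubDer.induction_hypothesis hA hP hC)

end

section

variable {Γ : Ctx} {H : Multiset (Fm Γ)}

/-- The object-level atom `A` is provable. -/
abbrev prvA (A : Tm Γ .atm) : Fm Γ := prv (atom A)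

/-- The formula `M ≡ N`. -/
abbrev sameF (M N : Tm Γ .i) : Fm Γ := .atom (.same M N)

/-! ### Equality -/

/-- Every unifier of `M` and `N` turns the two instances of `F` into the same formula. -/
theorem Der.same_rewrite {M N : Tm Γ .i} (h : PDer H (sameF M N)) (F : Fm (.i :: Γ))
    (h' : PDer H (F.subst (Sub.cons N Sub.id))) : PDer H (F.subst (Sub.cons M Sub.id)) := by
  refine h.same_elim fun Δ σ H' e heq => ?_
  have h' := e h'
  rwa [Fm.subst_subst, Sub.cons_comp, ← heq, ← Sub.cons_comp, ← Fm.subst_subst] at h'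

theorem Der.same_absurd {M N : Tm Γ .i} {C : Fm Γ} (h : PDer H (sameF M N))
    (hne : ∀ (Δ : Ctx) (σ : Sub Γ Δ), (M.subst σ).headCode ≠ (N.subst σ).headCode) : PDer H C :=
  h.same_elim fun _ σ _ _ heq => (Tm.absurd_of_headCode_ne heq (hne _ σ)).elim

theorem Der.same_succ {M N : Tm Γ .i} (h : PDer H (sameF M N)) :
    PDer H (sameF (succ M) (succ N)) := by
  simpa using h.same_rewrite (sameF (succ v0) (succ N.weaken)) (by simpa using .same_intro _)

theorem Der.same_pred {M N : Tm Γ .i} (h : PDer H (sameF M N)) :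
    PDer H (sameF (pred M) (pred N)) := by
  simpa using h.same_rewrite (sameF (pred v0) (pred N.weaken)) (by simpa using .same_intro _)

theorem Der.same_isZero {M N : Tm Γ .i} (h : PDer H (sameF M N)) :
    PDer H (sameF (isZero M) (isZero N)) := by
  simpa using h.same_rewrite (sameF (isZero v0) (isZero N.weaken)) (by simpa using .same_intro _)

theorem Der.same_cond {M N : Tm Γ .i} (h : PDer H (sameF M N)) (N₁ N₂ : Tm Γ .i) :
    PDer H (sameF (cond M N₁ N₂) (cond N N₁ N₂)) := by
  simpa using h.same_rewrite (sameF (cond v0 N₁.weaken N₂.weaken)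
    (cond N.weaken N₁.weaken N₂.weaken)) (by simpa using .same_intro _)

theorem Der.same_app {M N : Tm Γ .i} (h : PDer H (sameF M N)) (N₁ : Tm Γ .i) :
    PDer H (sameF (app M N₁) (app N N₁)) := by
  simpa using h.same_rewrite (sameF (app v0 N₁.weaken) (app N.weaken N₁.weaken))
    (by simpa using .same_intro _)

theorem Der.same_succ_inv {M N : Tm Γ .i} (h : PDer H (sameF (succ M) (succ N))) :
    PDer H (sameF M N) := by
  refine h.same_elim fun Δ σ H' e heq => ?_
  simp at heq ⊢
  rw [heq]
  exact .same_intro _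

/-- Equality is defined only at type `i` and `nt`; function terms are compared through the
abstractions built from them. -/
theorem Der.same_abs_rewrite {T T' : Tm Γ .i} {R R' : Tm Γ (.arr .i .i)}
    (h : PDer H (sameF (abs T R) (abs T' R'))) (F : Fm (.arr .i .i :: Γ))
    (h' : PDer H (F.subst (Sub.cons R' Sub.id))) : PDer H (F.subst (Sub.cons R Sub.id)) := by
  refine h.same_elim fun Δ σ H' e heq => ?_
  have h' := e h'
  simp at heq
  rwa [Fm.subst_subst, Sub.cons_comp, ← heq.2, ← Sub.cons_comp, ← Fm.subst_subst] at h'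

/-! ### Determinacy of the natural semantics -/

/-! ### Introduction rules for the PCF judgements -/

theorem prv_natsem {M V : Tm Γ .i} {G : Tm Γ .prp} (hP : NatsemProg M V G) (h : PDer H (prv G)) :
    PDer H (prvA (natsem M V)) :=
  prv_atom_intro hP.prog h

theorem prv_transone {M N : Tm Γ .i} {G : Tm Γ .prp} (hP : TransoneProg M N G)
    (h : PDer H (prv G)) : PDer H (prvA (transone M N)) :=
  prv_atom_intro hP.prog h

theorem prv_transsem_refl (M : Tm Γ .i) : PDer H (prvA (transsem M M)) :=
  prv_atom_intro (TranssemProg.refl M).prog prv_tt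

theorem prv_transsem_step {M M' N : Tm Γ .i} (h : PDer H (prvA (transone M M')))
    (h' : PDer H (prvA (transsem M' N))) : PDer H (prvA (transsem M N)) :=
  prv_atom_intro (TranssemProg.step M N M').prog (prv_amp_intro h h')

theorem prv_value {V : Tm Γ .i} {G : Tm Γ .prp} (hP : ValueProg V G) (h : PDer H (prv G)) :
    PDer H (prvA (value V)) :=
  prv_atom_intro hP.prog h

theorem prv_typeof {M T : Tm Γ .i} {G : Tm Γ .prp} (hP : TypeofProg M T G) (h : PDer H (prv G)) :
    PDer H (prvA (typeof M T)) :=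
  prv_atom_intro hP.prog h

/-- Two clauses for the same construct either agree or send the evaluated argument to results with
different heads, which the induction hypothesis excludes. -/
theorem natsem_deterministic {m v u : Tm Γ .i} (h : PDer H (prvA (natsem m v)))
    (h' : PDer H (prvA (natsem m u))) : PDer H (sameF v u) := by
  refine prv_induction₂ (A := fun _ m v => natsem m v) (P := fun _ m _ u => prvA (natsem m u))
    (C := fun _ _ v u => sameF v u) (fun _ _ _ _ _ => by simp) (fun _ _ _ _ _ _ => by simp)
    (fun _ _ _ _ _ _ => by simp) (fun _ m _ u => natsem m u) (fun _ _ _ _ _ _ => by simp)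
    (fun _ _ _ _ _ h => h) (fun Γ H m v u G G' hG hG' _ h' hs ih => ?_) h h'
  replace hG := hG.natsem
  replace hG' := hG'.natsem
  -- A second name for the subject allows both case analyses; the equation `hm` then sorts the pairs
  -- of clauses by clash and injectivity. The same device recurs in the later inductions.
  obtain ⟨m', hm⟩ : ∃ m', m = m' := ⟨_, rfl⟩
  rw [hm] at hG'
  cases hG <;> cases hG'
  all_goals first
    | (exfalso; refine Tm.absurd_of_headCode_ne hm ?_; simp; done)
    | skip
  case zero.zero => exact .same_intro _
  case tru.tru => exact .same_intro _
  case fls.fls => exact .same_intro _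
  case succ.succ =>
    obtain rfl := succ_inj.1 hm
    exact (ih hs h').same_succ
  case predZero.predZero => exact .same_intro _
  case predZero.predSucc =>
    obtain rfl := pred_inj.1 hm
    exact (ih hs h').same_absurd (by simp)
  case predSucc.predZero =>
    obtain rfl := pred_inj.1 hm
    exact (ih hs h').same_absurd (by simp)
  case predSucc.predSucc =>
    obtain rfl := pred_inj.1 hm
    exact (ih hs h').same_succ_inv
  case isZeroZero.isZeroZero => exact .same_intro _
  case isZeroZero.isZeroSucc =>
    obtain rfl := isZero_inj.1 hm
    exact (ih hs h').same_absurd (by simp)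
  case isZeroSucc.isZeroZero =>
    obtain rfl := isZero_inj.1 hm
    exact (ih hs h').same_absurd (by simp)
  case isZeroSucc.isZeroSucc => exact .same_intro _
  case condTru.condTru =>
    obtain ⟨rfl, rfl, rfl⟩ := cond_inj.1 hm
    exact ih hs.amp.2 (prv_amp_elim h').2
  case condTru.condFls =>
    obtain ⟨rfl, rfl, rfl⟩ := cond_inj.1 hm
    exact (ih hs.amp.1 (prv_amp_elim h').1).same_absurd (by simp)
  case condFls.condTru =>
    obtain ⟨rfl, rfl, rfl⟩ := cond_inj.1 hm
    exact (ih hs.amp.1 (prv_amp_elim h').1).same_absurd (by simp)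
  case condFls.condFls =>
    obtain ⟨rfl, rfl, rfl⟩ := cond_inj.1 hm
    exact ih hs.amp.2 (prv_amp_elim h').2
  case abs.abs => rw [hm]; exact .same_intro _
  case app.app =>
    obtain ⟨rfl, rfl⟩ := app_inj.1 hm
    -- The induction hypothesis only equates the two abstractions. The second evaluation is moved to
    -- the body of the first before it can be applied again.
    have hR := (ih hs.amp.1 (prv_amp_elim h').1).same_abs_rewrite
      (prvA (natsem (v0.app (Tm.weaken _)) u.weaken)) (by simpa using (prv_amp_elim h').2)
    exact ih hs.amp.2 (by simpa using hR)
  case fix.fix =>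
    obtain ⟨rfl, rfl⟩ := fix_inj.1 hm
    exact ih hs h'

/-! ### Determinacy of the transition semantics -/

/-- Among subjects, value clauses and step clauses share only the constructor `succ`, where the
claim passes to the argument. -/
theorem value_not_transone {m u : Tm Γ .i} {C : Fm Γ} (h : PDer H (prvA (value m)))
    (h' : PDer H (prvA (transone m u))) : PDer H C := by
  -- The induction needs a conclusion family commuting with substitution, so it proves `⊥` and an
  -- arbitrary `C` follows. The parameter `v` is idle, since `value` has one argument.
  refine Der.cut_shared (B := .bot) ?_ .botL
  refine prv_induction₂ (v := m) (A := fun _ m _ => value m)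
    (P := fun _ m _ u => prvA (transone m u))
    (C := fun _ _ _ _ => .bot) (fun _ _ _ _ _ => by simp) (fun _ _ _ _ _ _ => by simp)
    (fun _ _ _ _ _ _ => by simp) (fun _ m _ u => transone m u) (fun _ _ _ _ _ _ => by simp)
    (fun _ _ _ _ _ h => h) (fun Γ H m v u G G' hG hG' _ h' hs ih => ?_) h h'
  replace hG := hG.value
  replace hG' := hG'.transone
  obtain ⟨m', hm⟩ : ∃ m', m = m' := ⟨_, rfl⟩
  rw [hm] at hG'
  cases hG <;> cases hG'
  all_goals first
    | (exfalso; refine Tm.absurd_of_headCode_ne hm ?_; simp; done)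
    | skip
  case succ.succ =>
    obtain rfl := succ_inj.1 hm
    exact ih (v := v) hs h'

/-- A contraction and a congruence step compete only when the principal argument is a value, and
values do not step. Two congruence steps are compared by the induction hypothesis. -/
theorem transone_deterministic {m v u : Tm Γ .i} (h : PDer H (prvA (transone m v)))
    (h' : PDer H (prvA (transone m u))) : PDer H (sameF v u) := by
  refine prv_induction₂ (A := fun _ m v => transone m v) (P := fun _ m _ u => prvA (transone m u))
    (C := fun _ _ v u => sameF v u) (fun _ _ _ _ _ => by simp) (fun _ _ _ _ _ _ => by simp)
    (fun _ _ _ _ _ _ => by simp) (fun _ m _ u => transone m u) (fun _ _ _ _ _ _ => by simp)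
    (fun _ _ _ _ _ h => h) (fun Γ H m v u G G' hG hG' _ h' hs ih => ?_) h h'
  replace hG := hG.transone
  replace hG' := hG'.transone
  obtain ⟨m', hm⟩ : ∃ m', m = m' := ⟨_, rfl⟩
  rw [hm] at hG'
  cases hG <;> cases hG'
  all_goals first
    | (exfalso; refine Tm.absurd_of_headCode_ne hm ?_; simp; done)
    | (exfalso; refine Tm.absurd_of_headCode_ne (pred_inj.1 hm) ?_; simp; done)
    | (exfalso; refine Tm.absurd_of_headCode_ne (isZero_inj.1 hm) ?_; simp; done)
    | (exfalso; refine Tm.absurd_of_headCode_ne (cond_inj.1 hm).1 ?_; simp; done)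
    | skip
  case succ.succ =>
    obtain rfl := succ_inj.1 hm
    exact (ih hs h').same_succ
  case predZero.predZero => exact .same_intro _
  case predZero.pred =>
    obtain rfl := pred_inj.1 hm
    exact value_not_transone (prv_value .zero prv_tt) h'
  case predSucc.predSucc =>
    obtain rfl := succ_inj.1 (pred_inj.1 hm)
    exact .same_intro _
  case predSucc.pred =>
    obtain rfl := pred_inj.1 hm
    exact value_not_transone (prv_value (.succ _) hs.prv) h'
  case pred.predZero =>
    obtain rfl := pred_inj.1 hm
    exact value_not_transone (prv_value .zero prv_tt) hs.prv
  case pred.predSucc =>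
    obtain rfl := pred_inj.1 hm
    exact value_not_transone (prv_value (.succ _) h') hs.prv
  case pred.pred =>
    obtain rfl := pred_inj.1 hm
    exact (ih hs h').same_pred
  case isZeroZero.isZeroZero => exact .same_intro _
  case isZeroZero.isZero =>
    obtain rfl := isZero_inj.1 hm
    exact value_not_transone (prv_value .zero prv_tt) h'
  case isZeroSucc.isZeroSucc => exact .same_intro _
  case isZeroSucc.isZero =>
    obtain rfl := isZero_inj.1 hm
    exact value_not_transone (prv_value (.succ _) hs.prv) h'
  case isZero.isZeroZero =>
    obtain rfl := isZero_inj.1 hm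
    exact value_not_transone (prv_value .zero prv_tt) hs.prv
  case isZero.isZeroSucc =>
    obtain rfl := isZero_inj.1 hm
    exact value_not_transone (prv_value (.succ _) h') hs.prv
  case isZero.isZero =>
    obtain rfl := isZero_inj.1 hm
    exact (ih hs h').same_isZero
  case condTru.condTru =>
    obtain ⟨_, rfl, rfl⟩ := cond_inj.1 hm
    exact .same_intro _
  case condTru.cond =>
    obtain ⟨rfl, rfl, rfl⟩ := cond_inj.1 hm
    exact value_not_transone (prv_value .tru prv_tt) h'
  case condFls.condFls =>
    obtain ⟨_, rfl, rfl⟩ := cond_inj.1 hm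
    exact .same_intro _
  case condFls.cond =>
    obtain ⟨rfl, rfl, rfl⟩ := cond_inj.1 hm
    exact value_not_transone (prv_value .fls prv_tt) h'
  case cond.condTru =>
    obtain ⟨rfl, rfl, rfl⟩ := cond_inj.1 hm
    exact value_not_transone (prv_value .tru prv_tt) hs.prv
  case cond.condFls =>
    obtain ⟨rfl, rfl, rfl⟩ := cond_inj.1 hm
    exact value_not_transone (prv_value .fls prv_tt) hs.prv
  case cond.cond =>
    obtain ⟨rfl, rfl, rfl⟩ := cond_inj.1 hm
    exact (ih hs h').same_cond _ _
  case appAbs.appAbs =>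
    obtain ⟨h₁, rfl⟩ := app_inj.1 hm
    obtain ⟨rfl, rfl⟩ := abs_inj.1 h₁
    exact .same_intro _
  case appAbs.app =>
    obtain ⟨rfl, rfl⟩ := app_inj.1 hm
    exact value_not_transone (prv_value (.abs _ _) prv_tt) h'
  case app.appAbs =>
    obtain ⟨rfl, rfl⟩ := app_inj.1 hm
    exact value_not_transone (prv_value (.abs _ _) prv_tt) hs.prv
  case app.app =>
    obtain ⟨rfl, rfl⟩ := app_inj.1 hm
    exact (ih hs h').same_app _
  case fix.fix =>
    obtain ⟨rfl, rfl⟩ := fix_inj.1 hm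
    exact .same_intro _

/-- Values do not step, so either both chains are empty or both make a step. In the latter case the
steps agree, and the second chain is rewritten to continue from the same term as the first. -/
theorem transsem_deterministic {m v u : Tm Γ .i} (hv : PDer H (prvA (value v)))
    (h : PDer H (prvA (transsem m v))) (hu : PDer H (prvA (value u)))
    (h' : PDer H (prvA (transsem m u))) : PDer H (sameF v u) := by
  refine prv_induction₂ (A := fun _ m v => transsem m v)
    (P := fun _ m v u => .and (prvA (transsem m u)) (.and (prvA (value v)) (prvA (value u))))
    (C := fun _ _ v u => sameF v u) (fun _ _ _ _ _ => by simp) (fun _ _ _ _ _ _ => by simp)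
    (fun _ _ _ _ _ _ => by simp) (fun _ m _ u => transsem m u) (fun _ _ _ _ _ _ => by simp)
    (fun _ _ _ _ _ h => h.and_left) (fun Γ H m v u G G' hG hG' hP h' hs ih => ?_) h
    (.andR h' (.andR hv hu))
  have hv := hP.and_right.and_left
  have hu := hP.and_right.and_right
  replace hG := hG.transsem
  replace hG' := hG'.transsem
  cases hG <;> cases hG'
  case refl.refl => exact .same_intro _
  case refl.step => exact value_not_transone hv (prv_amp_elim h').1
  case step.refl => exact value_not_transone hu hs.amp.1.prv
  case step.step =>
    have h₁ := transone_deterministic hs.amp.1.prv (prv_amp_elim h').1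
    have h₂ := h₁.same_rewrite (prvA (transsem v0 u.weaken))
      (by simpa using (prv_amp_elim h').2)
    exact ih hs.amp.2 (.andR (by simpa using h₂) (.andR hv hu))

/-! ### From natural semantics to transition semantics -/

theorem transsem_trans {m v u : Tm Γ .i} (h : PDer H (prvA (transsem m v)))
    (h' : PDer H (prvA (transsem v u))) : PDer H (prvA (transsem m u)) := by
  refine prv_induction (A := fun _ m v => transsem m v) (P := fun _ _ v u => prvA (transsem v u))
    (C := fun _ m _ u => prvA (transsem m u)) (fun _ _ _ _ _ => by simp)
    (fun _ _ _ _ _ _ => by simp) (fun _ _ _ _ _ _ => by simp)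
    (fun Γ H m v u G hG h' hs ih => ?_) h h'
  cases hG.transsem with
  | refl => exact h'
  | step => exact prv_transsem_step hs.amp.1.prv (ih hs.amp.2 h')

/-- The function `F` preserves single steps. -/
noncomputable def preservesStepsF (F : Tm Γ (.arr .i .i)) : Fm Γ :=
  .all .i (.all .i (.imp (prvA (transone v1 v0))
    (prvA (transone (F.weaken.weaken.app v1) (F.weaken.weaken.app v0)))))

/-- Induction parameters are terms, so the context `f` with its hole enters as the function `f.lam`,
and its compatibility with single steps as the formula `preservesStepsF`. -/
theorem transsem_congr (f : Tm (.i :: Γ) .i)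
    (hf : ∀ (Δ : Ctx) (σ : Sub Γ Δ) (H' : Multiset (Fm Δ)) (m m' : Tm Δ .i),
      PDer H' (prvA (transone m m')) →
        PDer H' (prvA (transone (f.subst (Sub.cons m σ)) (f.subst (Sub.cons m' σ)))))
    {m v : Tm Γ .i} (h : PDer H (prvA (transsem m v))) :
    PDer H (prvA (transsem (f.subst (Sub.cons m Sub.id)) (f.subst (Sub.cons v Sub.id)))) := by
  have h := prv_induction (A := fun _ m v => transsem m v)
    (P := fun _ _ _ F => preservesStepsF F) (u := f.lam)
    (C := fun _ m v F => prvA (transsem (F.app m) (F.app v))) (fun _ _ _ _ _ => by simp)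
    (fun _ _ _ _ _ _ => by simp [preservesStepsF]) (fun _ _ _ _ _ _ => by simp)
    (fun Γ H m v F G hG hF hs ih => ?_) h ?_
  · simpa [Tm.lam_app] using h
  · cases hG.transsem with
    | refl => exact prv_transsem_refl _
    | step _ M' =>
      refine prv_transsem_step ?_ (ih hs.amp.2 hF)
      have hF := hF.all_elim m
      simpa using (hF.all_elim M').imp_elim (by simpa using hs.amp.1.prv)
  · refine .all₂_imp_intro fun Δ σ H' e m m' h => ?_
    simp [Tm.lam_app, Tm.subst_subst, Sub.lift_comp_cons, Sub.comp_id] at h ⊢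
    exact hf _ _ _ _ _ h

theorem transsem_succ {m v : Tm Γ .i} (h : PDer H (prvA (transsem m v))) :
    PDer H (prvA (transsem (succ m) (succ v))) := by
  simpa using transsem_congr (succ v0)
    (fun _ _ _ _ _ h => by simpa using prv_transone (.succ _ _) h) h

theorem transsem_pred {m v : Tm Γ .i} (h : PDer H (prvA (transsem m v))) :
    PDer H (prvA (transsem (pred m) (pred v))) := by
  simpa using transsem_congr (pred v0)
    (fun _ _ _ _ _ h => by simpa using prv_transone (.pred _ _) h) h

theorem transsem_isZero {m v : Tm Γ .i} (h : PDer H (prvA (transsem m v))) :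
    PDer H (prvA (transsem (isZero m) (isZero v))) := by
  simpa using transsem_congr (isZero v0)
    (fun _ _ _ _ _ h => by simpa using prv_transone (.isZero _ _) h) h

theorem transsem_cond {m v : Tm Γ .i} (h : PDer H (prvA (transsem m v))) (N₁ N₂ : Tm Γ .i) :
    PDer H (prvA (transsem (cond m N₁ N₂) (cond v N₁ N₂))) := by
  simpa using transsem_congr (cond v0 N₁.weaken N₂.weaken)
    (fun _ _ _ _ _ h => by simpa using prv_transone (.cond _ _ _ _) h) h

theorem transsem_app {m v : Tm Γ .i} (h : PDer H (prvA (transsem m v))) (N : Tm Γ .i) :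
    PDer H (prvA (transsem (app m N) (app v N))) := by
  simpa using transsem_congr (app v0 N.weaken)
    (fun _ _ _ _ _ h => by simpa using prv_transone (.app _ _ _) h) h

theorem value_succ_inv {V : Tm Γ .i} (h : PDer H (prvA (value (succ V)))) :
    PDer H (prvA (value V)) := by
  refine prv_atom_elim h fun Δ σ H' e G hG h => ?_
  rw [value_subst, succ_subst] at hG
  generalize hm : succ (V.subst σ) = m at hG
  replace hG := hG.value
  cases hG
  all_goals first
    | (exfalso; refine Tm.absurd_of_headCode_ne hm ?_; simp; done)
    | skip
  case succ =>
    obtain rfl := succ_inj.1 hm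
    simpa using h

/-- For an elimination construct, the chain for the evaluated argument is lifted by congruence and
followed by a contraction, and then by the chain of the contractum where there is one. -/
theorem value_and_transsem_of_natsem {m v : Tm Γ .i} (h : PDer H (prvA (natsem m v))) :
    PDer H (.and (prvA (value v)) (prvA (transsem m v))) := by
  refine prv_induction (a := .i) (u := m) (A := fun _ m v => natsem m v) (P := fun _ _ _ _ => .top)
    (C := fun _ m v _ => .and (prvA (value v)) (prvA (transsem m v))) (fun _ _ _ _ _ => by simp)
    (fun _ _ _ _ _ _ => by simp) (fun _ _ _ _ _ _ => by simp)
    (fun Γ H m v u G hG h' hs ih => ?_) h .topR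
  -- The side condition is `⊤` and the third parameter is idle; both are filled in once.
  replace ih := fun {m v : Tm Γ .i} h => ih (m := m) (v := v) (u := m) h .topR
  cases hG.natsem with
  | zero => exact .andR (prv_value .zero prv_tt) (prv_transsem_refl _)
  | tru => exact .andR (prv_value .tru prv_tt) (prv_transsem_refl _)
  | fls => exact .andR (prv_value .fls prv_tt) (prv_transsem_refl _)
  | succ =>
    have h := ih hs
    exact .andR (prv_value (.succ _) h.and_left) (transsem_succ h.and_right)
  | predZero =>
    have h := ih hs
    exact .andR h.and_left (transsem_trans (transsem_pred h.and_right)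
      (prv_transsem_step (prv_transone .predZero prv_tt) (prv_transsem_refl _)))
  | predSucc =>
    have h := ih hs
    have hv := value_succ_inv h.and_left
    exact .andR hv (transsem_trans (transsem_pred h.and_right)
      (prv_transsem_step (prv_transone (.predSucc _) hv) (prv_transsem_refl _)))
  | isZeroZero =>
    have h := ih hs
    exact .andR (prv_value .tru prv_tt) (transsem_trans (transsem_isZero h.and_right)
      (prv_transsem_step (prv_transone .isZeroZero prv_tt) (prv_transsem_refl _)))
  | isZeroSucc =>
    have h := ih hs
    have hv := value_succ_inv h.and_left
    exact .andR (prv_value .fls prv_tt) (transsem_trans (transsem_isZero h.and_right)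
      (prv_transsem_step (prv_transone (.isZeroSucc _) hv) (prv_transsem_refl _)))
  | condTru =>
    have h₁ := ih hs.amp.1
    have h₂ := ih hs.amp.2
    exact .andR h₂.and_left (transsem_trans (transsem_cond h₁.and_right _ _)
      (prv_transsem_step (prv_transone (.condTru _ _) prv_tt) h₂.and_right))
  | condFls =>
    have h₁ := ih hs.amp.1
    have h₂ := ih hs.amp.2
    exact .andR h₂.and_left (transsem_trans (transsem_cond h₁.and_right _ _)
      (prv_transsem_step (prv_transone (.condFls _ _) prv_tt) h₂.and_right))
  | abs => exact .andR (prv_value (.abs _ _) prv_tt) (prv_transsem_refl _)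
  | app =>
    have h₁ := ih hs.amp.1
    have h₂ := ih hs.amp.2
    exact .andR h₂.and_left (transsem_trans (transsem_app h₁.and_right _)
      (prv_transsem_step (prv_transone (.appAbs _ _ _) prv_tt) h₂.and_right))
  | fix =>
    have h := ih hs
    exact .andR h.and_left
      (prv_transsem_step (prv_transone (.fix _ _) prv_tt) h.and_right)

/-! ### From transition semantics to natural semantics -/

theorem natsem_of_value {v : Tm Γ .i} (h : PDer H (prvA (value v))) :
    PDer H (prvA (natsem v v)) := by
  refine prv_induction (a := .i) (u := v) (v := v) (A := fun _ m _ => value m)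
    (P := fun _ _ _ _ => .top) (C := fun _ m _ _ => prvA (natsem m m)) (fun _ _ _ _ _ => by simp)
    (fun _ _ _ _ _ _ => by simp) (fun _ _ _ _ _ _ => by simp)
    (fun Γ H m v u G hG h' hs ih => ?_) h .topR
  cases hG.value with
  | zero => exact prv_natsem .zero prv_tt
  | tru => exact prv_natsem .tru prv_tt
  | fls => exact prv_natsem .fls prv_tt
  | succ => exact prv_natsem (.succ _ _) (ih (v := v) (u := u) hs .topR)
  | abs => exact prv_natsem (.abs _ _) prv_tt

/-- Evaluation is closed under backward steps. For a congruence step the evaluation of the reduct is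
inverted and the induction hypothesis applied to its first premise. -/
theorem natsem_of_transone {m v u : Tm Γ .i} (h : PDer H (prvA (transone m v)))
    (h' : PDer H (prvA (natsem v u))) : PDer H (prvA (natsem m u)) := by
  refine prv_induction₂ (A := fun _ m v => transone m v) (P := fun _ _ v u => prvA (natsem v u))
    (C := fun _ m _ u => prvA (natsem m u)) (fun _ _ _ _ _ => by simp)
    (fun _ _ _ _ _ _ => by simp) (fun _ _ _ _ _ _ => by simp) (fun _ _ v u => natsem v u)
    (fun _ _ _ _ _ _ => by simp) (fun _ _ _ _ _ h => h)
    (fun Γ H m v u G G' hG hG' hP h' hs ih => ?_) h h'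
  replace hG := hG.transone
  replace hG' := hG'.natsem
  obtain ⟨v', hm⟩ : ∃ v', v = v' := ⟨_, rfl⟩
  rw [hm] at hG'
  cases hG
  -- From an evaluation of `V` to `u`, `succ V` evaluates to `succ u` and hence `pred (succ V)` to
  -- `u`; no inversion is needed.
  case predSucc => exact prv_natsem (.predSucc _ _) (prv_natsem (.succ _ _) hP)
  case condTru =>
    exact prv_natsem (.condTru _ _ _ _)
      (prv_amp_intro (prv_natsem .tru prv_tt) hP)
  case condFls =>
    exact prv_natsem (.condFls _ _ _ _)
      (prv_amp_intro (prv_natsem .fls prv_tt) hP)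
  case appAbs => exact prv_natsem (.app _ _ _ _ _) (prv_amp_intro (prv_natsem (.abs _ _) prv_tt) hP)
  case fix => exact prv_natsem (.fix _ _ _) hP
  all_goals
    cases hG'
    all_goals first
      | (exfalso; refine Tm.absurd_of_headCode_ne hm ?_; simp; done)
      | skip
  case succ.succ =>
    obtain rfl := succ_inj.1 hm
    exact prv_natsem (.succ _ _) (ih hs h')
  case predZero.zero => exact prv_natsem (.predZero _) (prv_natsem .zero prv_tt)
  case pred.predZero =>
    obtain rfl := pred_inj.1 hm
    exact prv_natsem (.predZero _) (ih hs h')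
  case pred.predSucc =>
    obtain rfl := pred_inj.1 hm
    exact prv_natsem (.predSucc _ _) (ih hs h')
  case isZeroZero.tru => exact prv_natsem (.isZeroZero _) (prv_natsem .zero prv_tt)
  -- The reduct `fls` says nothing about `V`; the value premise of the step supplies an evaluation
  -- of `V` to itself.
  case isZeroSucc.fls =>
    exact prv_natsem (.isZeroSucc _ _) (prv_natsem (.succ _ _) (natsem_of_value hs.prv))
  case isZero.isZeroZero =>
    obtain rfl := isZero_inj.1 hm
    exact prv_natsem (.isZeroZero _) (ih hs h')
  case isZero.isZeroSucc =>
    obtain rfl := isZero_inj.1 hm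
    exact prv_natsem (.isZeroSucc _ _) (ih hs h')
  case cond.condTru =>
    obtain ⟨rfl, rfl, rfl⟩ := cond_inj.1 hm
    have h' := prv_amp_elim h'
    exact prv_natsem (.condTru _ _ _ _) (prv_amp_intro (ih hs h'.1) h'.2)
  case cond.condFls =>
    obtain ⟨rfl, rfl, rfl⟩ := cond_inj.1 hm
    have h' := prv_amp_elim h'
    exact prv_natsem (.condFls _ _ _ _) (prv_amp_intro (ih hs h'.1) h'.2)
  case app.app =>
    obtain ⟨rfl, rfl⟩ := app_inj.1 hm
    have h' := prv_amp_elim h'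
    exact prv_natsem (.app _ _ _ _ _) (prv_amp_intro (ih hs h'.1) h'.2)

/-- The end of the chain is a value and evaluates to itself; this evaluation is pulled back step by
step. -/
theorem natsem_of_transsem {m v : Tm Γ .i} (hv : PDer H (prvA (value v)))
    (h : PDer H (prvA (transsem m v))) : PDer H (prvA (natsem m v)) := by
  refine prv_induction (a := .i) (u := v) (A := fun _ m v => transsem m v)
    (P := fun _ _ v _ => prvA (value v)) (C := fun _ m v _ => prvA (natsem m v))
    (fun _ _ _ _ _ => by simp) (fun _ _ _ _ _ _ => by simp) (fun _ _ _ _ _ _ => by simp)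
    (fun Γ H m v u G hG h' hs ih => ?_) h hv
  cases hG.transsem with
  | refl => exact natsem_of_value h'
  | step => exact natsem_of_transone hs.amp.1.prv (ih (u := u) hs.amp.2 h')

/-! ### Subject reduction -/

theorem typeof_succ_inv {V T : Tm Γ .i} (h : PDer H (prvA (typeof (succ V) T))) :
    PDer H (prvA (typeof V num)) := by
  refine prv_atom_elim h fun Δ σ H' e G hG h => ?_
  rw [typeof_subst, succ_subst] at hG
  generalize hm : succ (V.subst σ) = m at hG
  generalize T.subst σ = t at hG
  replace hG := hG.typeof
  cases hG
  all_goals first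
    | (exfalso; refine Tm.absurd_of_headCode_ne hm ?_; simp; done)
    | skip
  case succ =>
    obtain rfl := succ_inj.1 hm
    simpa using h

/-- Inversion of the typing of the abstraction yields the generic typing of its body, and
injectivity of `arrow` identifies its domain with `U`; the rest is `prv_typeof_app`. -/
theorem typeof_beta {T U V N : Tm Γ .i} {R : Tm Γ (.arr .i .i)}
    (h : PDer H (prvA (typeof (abs T R) (arrow U V)))) (hN : PDer H (prvA (typeof N U))) :
    PDer H (prvA (typeof (R.app N) V)) := by
  refine prv_atom_elim h fun Δ σ H' e G hG h => ?_
  have hN := e hN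
  simp only [prv_subst, atom_subst, typeof_subst, abs_subst, arrow_subst, Tm.subst_app] at hG hN ⊢
  replace hG := hG.typeof
  generalize hm : abs (T.subst σ) (R.subst σ) = m at hG
  generalize ht : arrow (U.subst σ) (V.subst σ) = t at hG
  cases hG
  all_goals first
    | (exfalso; refine Tm.absurd_of_headCode_ne hm ?_; simp; done)
    | skip
  case abs =>
    obtain ⟨rfl, rfl⟩ := abs_inj.1 hm
    obtain ⟨h₁, h₂⟩ := arrow_inj.1 ht
    rw [h₁] at hN
    rw [h₂]
    exact prv_typeof_app h hN

theorem typeof_of_natsem {m v t : Tm Γ .i} (h : PDer H (prvA (natsem m v)))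
    (h' : PDer H (prvA (typeof m t))) : PDer H (prvA (typeof v t)) := by
  refine prv_induction₂ (A := fun _ m v => natsem m v) (P := fun _ m _ t => prvA (typeof m t))
    (C := fun _ _ v t => prvA (typeof v t)) (fun _ _ _ _ _ => by simp)
    (fun _ _ _ _ _ _ => by simp) (fun _ _ _ _ _ _ => by simp) (fun _ m _ t => typeof m t)
    (fun _ _ _ _ _ _ => by simp) (fun _ _ _ _ _ h => h)
    (fun Γ H m v t G G' hG hG' hP h' hs ih => ?_) h h'
  replace hG := hG.natsem
  replace hG' := hG'.typeof
  obtain ⟨m', hm⟩ : ∃ m', m = m' := ⟨_, rfl⟩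
  rw [hm] at hG'
  cases hG <;> cases hG'
  all_goals first
    | (exfalso; refine Tm.absurd_of_headCode_ne hm ?_; simp; done)
    | skip
  case zero.zero => exact hP
  case tru.tru => exact hP
  case fls.fls => exact hP
  case succ.succ =>
    obtain rfl := succ_inj.1 hm
    exact prv_typeof (.succ _) (ih hs h')
  case predZero.pred => exact prv_typeof .zero prv_tt
  case predSucc.pred =>
    obtain rfl := pred_inj.1 hm
    exact typeof_succ_inv (ih hs h')
  case isZeroZero.isZero => exact prv_typeof .tru prv_tt
  case isZeroSucc.isZero => exact prv_typeof .fls prv_tt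
  case condTru.cond =>
    obtain ⟨rfl, rfl, rfl⟩ := cond_inj.1 hm
    exact ih hs.amp.2 (prv_amp_elim (prv_amp_elim h').2).1
  case condFls.cond =>
    obtain ⟨rfl, rfl, rfl⟩ := cond_inj.1 hm
    exact ih hs.amp.2 (prv_amp_elim (prv_amp_elim h').2).2
  case abs.abs => exact hP
  case app.app =>
    obtain ⟨rfl, rfl⟩ := app_inj.1 hm
    have h' := prv_amp_elim h'
    exact ih hs.amp.2 (typeof_beta (ih hs.amp.1 h'.1) h'.2)
  case fix.fix =>
    obtain ⟨rfl, rfl⟩ := fix_inj.1 hm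
    -- The recursion itself is substituted for the bound variable; `hP` is its typing.
    exact ih hs (prv_typeof_app h' hP)

theorem typeof_of_transone {m n t : Tm Γ .i} (h : PDer H (prvA (transone m n)))
    (h' : PDer H (prvA (typeof m t))) : PDer H (prvA (typeof n t)) := by
  refine prv_induction₂ (A := fun _ m v => transone m v) (P := fun _ m _ t => prvA (typeof m t))
    (C := fun _ _ v t => prvA (typeof v t)) (fun _ _ _ _ _ => by simp)
    (fun _ _ _ _ _ _ => by simp) (fun _ _ _ _ _ _ => by simp) (fun _ m _ t => typeof m t)
    (fun _ _ _ _ _ _ => by simp) (fun _ _ _ _ _ h => h)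
    (fun Γ H m v t G G' hG hG' hP h' hs ih => ?_) h h'
  replace hG := hG.transone
  replace hG' := hG'.typeof
  obtain ⟨m', hm⟩ : ∃ m', m = m' := ⟨_, rfl⟩
  rw [hm] at hG'
  cases hG <;> cases hG'
  all_goals first
    | (exfalso; refine Tm.absurd_of_headCode_ne hm ?_; simp; done)
    | skip
  case succ.succ =>
    obtain rfl := succ_inj.1 hm
    exact prv_typeof (.succ _) (ih hs h')
  case predZero.pred => exact prv_typeof .zero prv_tt
  case predSucc.pred =>
    obtain rfl := pred_inj.1 hm
    exact typeof_succ_inv h'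
  case pred.pred =>
    obtain rfl := pred_inj.1 hm
    exact prv_typeof (.pred _) (ih hs h')
  case isZeroZero.isZero => exact prv_typeof .tru prv_tt
  case isZeroSucc.isZero => exact prv_typeof .fls prv_tt
  case isZero.isZero =>
    obtain rfl := isZero_inj.1 hm
    exact prv_typeof (.isZero _) (ih hs h')
  case condTru.cond =>
    obtain ⟨rfl, rfl, rfl⟩ := cond_inj.1 hm
    exact (prv_amp_elim (prv_amp_elim h').2).1
  case condFls.cond =>
    obtain ⟨rfl, rfl, rfl⟩ := cond_inj.1 hm
    exact (prv_amp_elim (prv_amp_elim h').2).2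
  case cond.cond =>
    obtain ⟨rfl, rfl, rfl⟩ := cond_inj.1 hm
    have h' := prv_amp_elim h'
    exact prv_typeof (.cond _ _ _ _) (prv_amp_intro (ih hs h'.1) h'.2)
  case appAbs.app =>
    obtain ⟨rfl, rfl⟩ := app_inj.1 hm
    have h' := prv_amp_elim h'
    exact typeof_beta h'.1 h'.2
  case app.app =>
    obtain ⟨rfl, rfl⟩ := app_inj.1 hm
    have h' := prv_amp_elim h'
    exact prv_typeof (.app _ _ _ _) (prv_amp_intro (ih hs h'.1) h'.2)
  case fix.fix =>
    obtain ⟨rfl, rfl⟩ := fix_inj.1 hm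
    exact prv_typeof_app h' hP

theorem typeof_of_transsem {m n t : Tm Γ .i} (h : PDer H (prvA (transsem m n)))
    (h' : PDer H (prvA (typeof m t))) : PDer H (prvA (typeof n t)) := by
  refine prv_induction (A := fun _ m v => transsem m v) (P := fun _ m _ t => prvA (typeof m t))
    (C := fun _ _ v t => prvA (typeof v t)) (fun _ _ _ _ _ => by simp)
    (fun _ _ _ _ _ _ => by simp) (fun _ _ _ _ _ _ => by simp)
    (fun Γ H m v t G hG h' hs ih => ?_) h h'
  cases hG.transsem with
  | refl => exact h'
  | step => exact ih hs.amp.2 (typeof_of_transone hs.amp.1.prv h')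

/-! ### Unicity of typing -/

/-- A term of type `T`. -/
def inhabitant (T : Tm Γ .i) : Tm Γ .i := fix T (.lam v0)

@[simp] theorem inhabitant_subst {Δ : Ctx} (σ : Sub Γ Δ) (T : Tm Γ .i) :
    (inhabitant T).subst σ = inhabitant (T.subst σ) := by
  simp [inhabitant]

/-- The elements of `L` are typings of the terms `inhabitant T`. -/
noncomputable def typingCtxF (L : Tm Γ .lst) : Fm Γ :=
  .all .atm (.imp (elementF v0 L.weaken)
    (.ex .i (elementF v1 (cons (typeof (inhabitant v0) v0) nil))))

@[simp] theorem typingCtxF_subst {Δ : Ctx} (σ : Sub Γ Δ) (L : Tm Γ .lst) :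
    (typingCtxF L).subst σ = typingCtxF (L.subst σ) := by
  simp [typingCtxF]

theorem typingCtxF_nil : PDer H (typingCtxF nil) :=
  .all_imp_intro fun Δ σ H' e X h => Der.not_element_nil (X := X) (by simpa using h)

/-- There is no equality predicate for atoms; in `typingCtxF` membership in a one-element list takes
its place, and the head clause of `element` establishes it here. -/
theorem typingCtxF_cons {L : Tm Γ .lst} (h : PDer H (typingCtxF L)) (T : Tm Γ .i) :
    PDer H (typingCtxF (cons (typeof (inhabitant T) T) L)) := by
  refine .all_imp_intro fun Δ σ H' e X hX => Der.element_elim hX (fun Θ τ K e' M hM => ?_)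
    (fun Θ τ K e' Y M hM hX => ?_)
  · simp at hM ⊢
    refine .ex_intro ((T.subst σ).subst τ) ?_
    simp [hM.1]
    exact .element_head _ _
  · have h := e' (e h)
    simp at h hM hX ⊢
    rw [← hM.2] at hX
    simpa using (h.all_elim _).imp_elim (by simpa using hX)

/-- A typing found in the context has an `inhabitant` as its subject, by the shape of the entries;
otherwise the last step is a typing clause. No freshness of variables is involved. -/
theorem typeof_seq_elim {I : Tm Γ .nt} {L : Tm Γ .lst} {m t : Tm Γ .i} {C : Fm Γ}
    (hI : PDer H (.nat I)) (hL : PDer H (typingCtxF L))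
    (h : PDer H (seqF I L (atom (typeof m t))))
    (k : ∀ (Δ : Ctx) (σ : Sub Γ Δ) (H' : Multiset (Fm Δ)), PExt σ H H' →
      (m.subst σ = inhabitant (t.subst σ) ∨ ∃ (J : Tm Δ .nt) (G : Tm Δ .prp),
        I.subst σ = s J ∧ PDer H' (.nat J) ∧ TypeofProg (m.subst σ) (t.subst σ) G ∧
          PDer H' (seqF J (L.subst σ) G)) → PDer H' (C.subst σ)) : PDer H C := by
  refine h.seq_elim fun Δ σ H' e h => ?_
  rw [atom_subst] at h
  rcases h.atom_inv with h | ⟨J, G, hJ, hP, h⟩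
  · have hL := e hL
    simp at hL
    have hL := (hL.all_elim _).imp_elim (by simpa using h)
    refine hL.ex_elim fun Θ τ K e' T hT => ?_
    simp at hT
    refine Der.element_elim hT (fun Ξ ρ M e'' L' h => ?_) (fun Ξ ρ M e'' Y L' h hX => ?_)
    · simp at h
      rw [Fm.subst_subst, Fm.subst_subst]
      refine k _ _ _ (e.trans (e'.trans e'')) (.inl ?_)
      simp only [← Tm.subst_subst]
      rw [← h.1.1, h.1.2]
    · simp at h
      rw [← h.2] at hX
      exact Der.not_element_nil hX
  · have hI := e hI
    rw [Fm.subst, hJ] at hI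
    exact k _ _ _ e (.inr ⟨J, G, hJ, hI.nat_pred, (typeof_subst σ m t ▸ hP).typeof, h⟩)

/-- Unicity of the types derived with height `I`. -/
noncomputable def unicityF (I : Tm Γ .nt) : Fm Γ :=
  .all .lst (.all .i (.all .i (.all .i (.imp
    (.and (typingCtxF v3) (.and (seqF I.weaken.weaken.weaken.weaken v3 (atom (typeof v2 v1)))
      (prvFrom v3 (atom (typeof v2 v0))))) (sameF v1 v0)))))

@[simp] theorem unicityF_subst {Δ : Ctx} (σ : Sub Γ Δ) (I : Tm Γ .nt) :
    (unicityF I).subst σ = unicityF (I.subst σ) := by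
  simp [unicityF]

theorem unicityF_elim {I : Tm Γ .nt} (h : PDer H (unicityF I)) {L : Tm Γ .lst} {m t u : Tm Γ .i}
    (hL : PDer H (typingCtxF L)) (ht : PDer H (seqF I L (atom (typeof m t))))
    (hu : PDer H (prvFrom L (atom (typeof m u)))) : PDer H (sameF t u) := by
  have h := ((h.all_elim L).all_elim m).all_elim t
  simpa using (h.all_elim u).imp_elim (by simpa using .andR hL (.andR ht hu))

theorem Der.same_arrow_inv {T T' U U' : Tm Γ .i} (h : PDer H (sameF (arrow T U) (arrow T' U'))) :
    PDer H (sameF U U') := by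
  refine h.same_elim fun Δ σ H' e heq => ?_
  simp at heq ⊢
  rw [heq.2]
  exact .same_intro _

theorem Der.same_arrow {U U' : Tm Γ .i} (h : PDer H (sameF U U')) (T : Tm Γ .i) :
    PDer H (sameF (arrow T U) (arrow T U')) := by
  simpa using h.same_rewrite (sameF (arrow T.weaken v0) (arrow T.weaken U'.weaken))
    (by simpa using .same_intro _)

theorem bodyGoal_elim {I : Tm Γ .nt} {L : Tm Γ .lst} {T U : Tm Γ .i} {R : Tm Γ (.arr .i .i)}
    (hI : PDer H (.nat I)) (h : PDer H (seqF I L (bodyGoal T R U))) (N : Tm Γ .i) :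
    PDer H (seqF I (cons (typeof N T) L) (atom (typeof (R.app N) U))) := by
  have h := seqF_oall_elim hI h N
  simp [Tm.lam_app] at h
  exact seqF_oimp_elim hI h

/-- The inductive step of the unicity of typing. -/
theorem unicity_step {I J : Tm Γ .nt} {L : Tm Γ .lst} {m t u : Tm Γ .i} {G G' : Tm Γ .prp}
    (hI : PDer H (.nat I)) (hi : PDer H (unicityF I)) (hL : PDer H (typingCtxF L))
    (hG : TypeofProg m t G) (h : PDer H (seqF I L G)) (hJ : PDer H (.nat J))
    (hG' : TypeofProg m u G') (h' : PDer H (seqF J L G')) : PDer H (sameF t u) := by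
  obtain ⟨m', hm⟩ : ∃ m', m = m' := ⟨_, rfl⟩
  rw [hm] at hG'
  cases hG <;> cases hG'
  all_goals first
    | (exfalso; refine Tm.absurd_of_headCode_ne hm ?_; simp; done)
    | exact .same_intro _
    | skip
  case cond.cond =>
    obtain ⟨rfl, rfl, rfl⟩ := cond_inj.1 hm
    exact unicityF_elim hi hL (seqF_amp_elim hI (seqF_amp_elim hI h).2).1
      (prvFrom_intro hJ (seqF_amp_elim hJ (seqF_amp_elim hJ h').2).1)
  case abs.abs =>
    obtain ⟨rfl, rfl⟩ := abs_inj.1 hm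
    -- The bound variable is instantiated by the `inhabitant` of the annotation. The annotation is
    -- common to both derivations, so they are extended by the same admissible context entry.
    exact Der.same_arrow (unicityF_elim hi (typingCtxF_cons hL _) (bodyGoal_elim hI h _)
      (prvFrom_intro hJ (bodyGoal_elim hJ h' _))) _
  case app.app =>
    obtain ⟨rfl, rfl⟩ := app_inj.1 hm
    -- The type of the function determines that of the application, so the argument types need not
    -- be compared.
    exact Der.same_arrow_inv (unicityF_elim hi hL (seqF_amp_elim hI h).1
      (prvFrom_intro hJ (seqF_amp_elim hJ h').1))
  case fix.fix =>
    obtain ⟨rfl, rfl⟩ := fix_inj.1 hm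
    exact .same_intro _

/-- Recursion has a single typing clause, which returns the annotation. Clauses and context entries
therefore agree on these terms. -/
theorem TypeofProg.of_inhabitant {T t : Tm Γ .i} {G : Tm Γ .prp}
    (h : TypeofProg (inhabitant T) t G) : t = T := by
  generalize hm : inhabitant T = m at h
  rw [inhabitant] at hm
  cases h
  all_goals first
    | (exfalso; refine Tm.absurd_of_headCode_ne hm ?_; simp; done)
    | exact (fix_inj.1 hm).1.symm

/-- Each typing comes from the context or from a clause. If either comes from the context, the
subject is an `inhabitant` and both types equal its annotation, so only two clauses are left to `k`.
The second height is hidden in `prvFrom`; the induction concerns the first alone. -/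
theorem unicityF_intro {I : Tm Γ .nt} (hI : PDer H (.nat I))
    (k : ∀ (Δ : Ctx) (σ : Sub Γ Δ) (H' : Multiset (Fm Δ)), PExt σ H H' →
      ∀ (J J' : Tm Δ .nt) (L : Tm Δ .lst) (m t u : Tm Δ .i) (G G' : Tm Δ .prp),
        PDer H' (typingCtxF L) → I.subst σ = s J → PDer H' (.nat J) → TypeofProg m t G →
        PDer H' (seqF J L G) → PDer H' (.nat J') → TypeofProg m u G' → PDer H' (seqF J' L G') →
        PDer H' (sameF t u)) : PDer H (unicityF I) := by
  refine .all₂_intro fun Δ σ H' e L m => .all₂_imp_intro fun Θ τ K e' t u h => ?_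
  have hL := Der.and_left h
  have ht := (Der.and_right h).and_left
  have hu := (Der.and_right h).and_right
  have hI := e' (e hI)
  simp at hL ht hu hI ⊢
  generalize L.subst τ = L, m.subst τ = m at *
  refine prvFrom_elim hu fun Δ₁ σ₁ H₁ e₁ J' hJ' hu => ?_
  have hI₁ := e₁ hI
  have hL₁ := e₁ hL
  have ht₁ := e₁ ht
  simp at hI₁ hL₁ ht₁ hu
  refine typeof_seq_elim hI₁ hL₁ ht₁ fun Δ₂ σ₂ H₂ e₂ h₁ => ?_
  have hL₂ := e₂ hL₁
  have hJ₂ := e₂ hJ'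
  have hu₂ := e₂ hu
  simp at hL₂ hJ₂ hu₂
  refine typeof_seq_elim hJ₂ hL₂ hu₂ fun Δ₃ σ₃ H₃ e₃ h₂ => ?_
  have hL₃ := e₃ hL₂
  simp at hL₃ ⊢
  rcases h₁ with h₁ | ⟨J, G, hJ, hJn, hG, h₁⟩
  · have h₁ := congrArg (Tm.subst σ₃) h₁
    rw [inhabitant_subst] at h₁
    rw [h₁] at h₂
    rcases h₂ with h₂ | ⟨J, G, hJ, hJn, hG, h₂⟩
    · rw [(fix_inj.1 h₂).1]
      exact .same_intro _
    · rw [hG.of_inhabitant]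
      exact .same_intro _
  · have hP := (hG.prog.subst σ₃)
    rw [typeof_subst] at hP
    rcases h₂ with h₂ | ⟨J', G', hJ', hJn', hG', h₂⟩
    · rw [h₂] at hP
      rw [hP.typeof.of_inhabitant]
      exact .same_intro _
    · have hJ := congrArg (Tm.subst σ₃) hJ
      simp only [s_subst, Tm.subst_subst] at hJ
      refine k Δ₃ _ H₃ (e.trans (e'.trans (e₁.trans (e₂.trans e₃)))) _ _ _ _ _ _ _ _ hL₃ ?_
        (e₃ hJn) hP.typeof (e₃ h₁) hJn' hG' h₂
      rw [← hJ]
      simp only [← Tm.subst_subst]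

theorem unicityF_of_nat {I : Tm Γ .nt} (h : PDer H (.nat I)) : PDer H (unicityF I) := by
  refine Der.nat_induction (fun I => unicityF I) (by intros; simp) (fun H => ?_)
    (fun H I hI hi => ?_) h
  -- Clause steps need a successor height, so at `z` the continuation is vacuous.
  · refine unicityF_intro .natRzero fun _ σ _ _ J _ _ _ _ _ _ _ _ hJ => ?_
    exact (Tm.absurd_of_headCode_ne hJ (by simp)).elim
  · refine unicityF_intro (.natRsucc hI)
      fun Δ σ H' e J J' L m t u G G' hL hJ hJn hG h hJ' hG' h' => ?_
    have hi := e hi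
    simp at hi hJ
    rw [hJ] at hi
    exact unicity_step hJn hi hL hG h hJ' hG' h'

theorem typeof_unique {m t u : Tm Γ .i} (h : PDer H (prvA (typeof m t)))
    (h' : PDer H (prvA (typeof m u))) : PDer H (sameF t u) := by
  refine prvFrom_elim h fun Δ σ H' e I hI h => ?_
  have h' := e h'
  simp at h h' ⊢
  exact unicityF_elim (unicityF_of_nat hI) typingCtxF_nil h h'

end

end FOLDN

/-! ### The nine formulas, assembled from the derived rules -/

theorem mainTheorem6 :
    -- Determinacy of semantics
    (Derivable pcfDefinition
      (.all .i (.all .i (.all .i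
        (.imp (prv (atom (natsem v2 v1)))
          (.imp (prv (atom (natsem v2 v0)))
            (.atom (.same v1 v0))))))) ∧
     Derivable pcfDefinition
      (.all .i (.all .i (.all .i
        (.imp (prv (atom (transone v2 v1)))
          (.imp (prv (atom (transone v2 v0)))
            (.atom (.same v1 v0))))))) ∧
     Derivable pcfDefinition
      (.all .i (.all .i (.all .i
        (.imp (prv (atom (value v1)))
          (.imp (prv (atom (transsem v2 v1)))
            (.imp (prv (atom (value v0)))
              (.imp (prv (atom (transsem v2 v0)))
                (.atom (.same v1 v0)))))))))) ∧
    -- Equivalence of semantics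
    (Derivable pcfDefinition
      (.all .i (.all .i
        (.imp (prv (atom (natsem v1 v0)))
          (.and (prv (atom (value v0))) (prv (atom (transsem v1 v0))))))) ∧
     Derivable pcfDefinition
      (.all .i (.all .i
        (.imp (.and (prv (atom (value v0))) (prv (atom (transsem v1 v0))))
          (prv (atom (natsem v1 v0))))))) ∧
    -- Subject reduction
    (Derivable pcfDefinition
      (.all .i (.all .i
        (.imp (prv (atom (natsem v1 v0)))
          (.all .i (.imp (prv (atom (typeof v2 v0))) (prv (atom (typeof v1 v0)))))))) ∧
     Derivable pcfDefinition
      (.all .i (.all .i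
        (.imp (prv (atom (transone v1 v0)))
          (.all .i (.imp (prv (atom (typeof v2 v0))) (prv (atom (typeof v1 v0)))))))) ∧
     Derivable pcfDefinition
      (.all .i (.all .i
        (.imp (prv (atom (transsem v1 v0)))
          (.all .i (.imp (prv (atom (typeof v2 v0))) (prv (atom (typeof v1 v0))))))))) ∧
    -- Unicity of typing
    Derivable pcfDefinition
      (.all .i (.all .i (.all .i
        (.imp (prv (atom (typeof v2 v1)))
          (.imp (prv (atom (typeof v2 v0)))
            (.atom (.same v1 v0))))))) := by
  refine ⟨⟨?_, ?_, ?_⟩, ⟨?_, ?_⟩, ⟨?_, ?_, ?_⟩, ?_⟩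
  · refine .all₃_imp_intro fun Δ σ H e m t u h => .imp_intro fun K e' h' => ?_
    have h := e' h
    simp at h h' ⊢
    exact natsem_deterministic h h'
  · refine .all₃_imp_intro fun Δ σ H e m t u h => .imp_intro fun K e' h' => ?_
    have h := e' h
    simp at h h' ⊢
    exact transone_deterministic h h'
  · refine .all₃_imp_intro fun Δ σ H e m v u hv => .imp_intro fun K₁ e₁ hm =>
      .imp_intro fun K₂ e₂ hu => .imp_intro fun K₃ e₃ hm' => ?_
    have hv := e₃ (e₂ (e₁ hv))
    have hm := e₃ (e₂ hm)
    have hu := e₃ hu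
    simp at hv hm hu hm' ⊢
    exact transsem_deterministic hv hm hu hm'
  · refine .all₂_imp_intro fun Δ σ H e m v h => ?_
    simp at h ⊢
    exact value_and_transsem_of_natsem h
  · refine .all₂_imp_intro fun Δ σ H e m v h => ?_
    simp at h ⊢
    exact natsem_of_transsem h.and_left h.and_right
  · refine .all₂_imp_intro fun Δ σ H e m n h => .all_imp_intro fun Θ τ K e' t h' => ?_
    have h := e' h
    simp at h h' ⊢
    exact typeof_of_natsem h h'
  · refine .all₂_imp_intro fun Δ σ H e m n h => .all_imp_intro fun Θ τ K e' t h' => ?_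
    have h := e' h
    simp at h h' ⊢
    exact typeof_of_transone h h'
  · refine .all₂_imp_intro fun Δ σ H e m n h => .all_imp_intro fun Θ τ K e' t h' => ?_
    have h := e' h
    simp at h h' ⊢
    exact typeof_of_transsem h h'
  · refine .all₃_imp_intro fun Δ σ H e m t u h => .imp_intro fun K e' h' => ?_
    have h := e' h
    simp at h h' ⊢
    exact typeof_unique h h'
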